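/- **Setting.** Let $\mathcal T_h$ be a conforming triangulation of a bounded polyhedral domain $\widehat\Omega\subset\mathbb R^3$ into finitely many closed tetrahedra, let $h$ be the largest diameter of a tetrahedron, and suppose that $\mathcal T_h$ is shape-regular with constant $\sigma$ (each $T$ contains a ball of radius $\operatorname{diam}(T)/\sigma$) and quasi-uniform with constant $\kappa$ ($h\le\kappa\operatorname{diam}(T)$ for all $T$). Let $\Omega\subset\widehat\Omega$ be a nonempty bounded open set with Lipschitz boundary $\Gamma$ and outward unit normal $\mathbf n$ (the approximate physical domain at a time step), and let $\delta\ge0$. Put $$\mathcal T_e=\{T\in\mathcal T_h: \operatorname{dist}(x,\Omega)\le\delta\text{ for some }x\in T\},\qquad \mathcal T_i=\{T\in\mathcal T_e:\operatorname{int}T\subset\Omega\},$$ and for $\mathcal S\subset\mathcal T_h$ put $\Omega_{\mathcal S}=\operatorname{int}\bigcup_{T\in\mathcal S}T$; write $\Omega_e=\Omega_{\mathcal T_e}$ and $\Omega_i=\Omega_{\mathcal T_i}$. An edge of $\mathcal T_i$ is interior if its relative interior lies in $\Omega_i$. Let $\tilde{\mathcal T}_i$ be the set of those $T\in\mathcal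 T_i$ which have at least three interior edges with linearly independent directions. For a velocity field $\mathbf v$, which is piecewise polynomial, let $$\|\mathbf v\|_{e}^2=\|\nabla\mathbf v\|_{L^2(\Omega_e)}^2+\|\nabla\mathbf v\|_{L^2(\Omega)}^2+h^{-1}\|\mathbf v\|_{L^2(\Gamma)}^2+h\|\nabla\mathbf v\|_{L^2(\Gamma)}^2$$ (traces on $\Gamma$ taken from $\Omega$), and for a sub-mesh $\mathcal S$ with set of interior faces $\mathcal F(\mathcal S)$ (the triangular faces shared by two tetrahedra of $\mathcal S$) let $$|q|_{\mathcal S}^2=h^2\sum_{T\in\mathcal S}\|\nabla q\|_{L^2(T)}^2+h\sum_{F\in\mathcal F(\mathcal S)}\|[q]\|_{L^2(F)}^2,$$ where $[q]$ is the jump across $F$. Let $b(\mathbf v,q)=\int_\Omega(\operatorname{div}\mathbf v)\,q\,dx-\int_\Gamma(\mathbf v\cdot\mathbf n)\,q\,ds$. For global finite element spaces $\mathbf V_h\times Q_h$ and sub-meshes $\mathcal N,\mathcal S\subset\mathcal T_i$, we say that *the three conditions hold with constant $C$, normalisation on $\mathcal N$ and norm on $\mathcal S$* if for every $q\in\{p|_{\Omega_e}:p\in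 Q_h,\ \int_{\Omega_{\mathcal N}}p\,dx=0\}$ there is $\mathbf v\in\{\mathbf w|_{\Omega_e}:\mathbf w\in\mathbf V_h\}$ with $$\|\mathbf v\|_e\le C|q|_{\mathcal S},\qquad |q|_{\mathcal S}^2\le b(\mathbf v,q),\qquad \|\mathbf v\|_{L^2(\Omega)}\le C\,h\,|q|_{\mathcal S}.$$ Write ${\rm P}_k(\mathcal T_h)$ for the piecewise polynomials of degree at most $k$ and ${\rm P}_k^c(\mathcal T_h)={\rm P}_k(\mathcal T_h)\cap H^1(\widehat\Omega)$ for the continuous ones; bold letters denote vector fields. **Theorem.** For all $\sigma,\kappa>0$ the following hold, for all $\mathcal T_h$, $\Omega$, $\delta$ as above, with constants that depend only on $\sigma$ and $\kappa$ (and on $m$ in 2.); in particular they do not depend on $h$, $\delta$ or on how $\Gamma$ cuts the mesh. 1. (Mini element.) For $\mathbf V_h=\{\mathbf v\in\mathbf H^1(\widehat\Omega):\mathbf v|_T\in\mathbf P_1(T)+b_T\mathbf P_0(T)\ \forall T\in\mathcal T_h\}$, where $b_T$ is the product of the four barycentric coordinates of $T$, and $Q_h={\rm P}_1^c(\mathcal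 T_h)$, the three conditions hold with normalisation and norm on $\mathcal T_i$. 2. (Generalized Taylor–Hood.) For each $m\ge2$, $\mathbf V_h=\mathbf P_m^c(\mathcal T_h)$ and $Q_h={\rm P}_{m-1}^c(\mathcal T_h)$, the three conditions hold with norm on the reduced mesh $\tilde{\mathcal T}_i$, with normalisation on $\mathcal T_i$ as well as with normalisation on $\tilde{\mathcal T}_i$. 3. ($P_3$–$P_0$.) For $\mathbf V_h=\mathbf P_3^c(\mathcal T_h)$ and $Q_h={\rm P}_0(\mathcal T_h)$, the three conditions hold with normalisation and norm on $\mathcal T_i$. -/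

import Mathlib

open MeasureTheory Filter Topology
open scoped ENNReal NNReal

noncomputable section

namespace CutFEM

/-- Euclidean three-space. -/
abbrev E3 := EuclideanSpace ℝ (Fin 3)

/-! ### Domains, normals, traces -/

/-- A nonempty bounded open set with Lipschitz boundary: near each boundary point it is, in suitable
orthonormal coordinates, the region strictly below the graph of a Lipschitz function. -/
def IsLipschitzDomain (Ω : Set E3) : Prop :=
  IsOpen Ω ∧ Ω.Nonempty ∧ Bornology.IsBounded Ω ∧
    ∀ x ∈ frontier Ω, ∃ (ν : E3) (g : E3 → ℝ) (L : ℝ≥0), ‖ν‖ = 1 ∧ LipschitzWith L g ∧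
      ∀ᶠ y in 𝓝 x, (y ∈ Ω ↔ inner ℝ ν y < g (y - inner ℝ ν y • ν))

/-- `n` is the (measure-theoretic, Federer) exterior unit normal of `Ω` at `x`: blowing up at `x`,
`Ω` becomes the half-space `{y | ⟪y - x, n⟫ < 0}`. Such an `n` is unique, and for a Lipschitz
domain it exists at almost every boundary point and is the usual outward unit normal. -/
def IsOuterNormal (Ω : Set E3) (x n : E3) : Prop :=
  ‖n‖ = 1 ∧
    Tendsto (fun r : ℝ => volume.real {y ∈ Metric.ball x r | y ∈ Ω ∧ 0 < inner ℝ (y - x) n} / r ^ 3)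
      (𝓝[>] 0) (𝓝 0) ∧
    Tendsto (fun r : ℝ => volume.real {y ∈ Metric.ball x r | y ∉ Ω ∧ inner ℝ (y - x) n < 0} / r ^ 3)
      (𝓝[>] 0) (𝓝 0)

open Classical in
/-- The outward unit normal field (zero on the null set where there is none). -/
def outerNormal (Ω : Set E3) (x : E3) : E3 :=
  if h : ∃ n, IsOuterNormal Ω x n then h.choose else 0

open Classical in
/-- The trace at `x` of `g`, taken from the side of `Ω`: the limit of the mean values of `g` over
`Ω ∩ B_r(x)` as `r → 0` (zero where there is no limit). -/
def innerTrace {F : Type*} [NormedAddCommGroup F] [NormedSpace ℝ F] (Ω : Set E3) (g : E3 → F)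
    (x : E3) : F :=
  if h : ∃ l, Tendsto (fun r : ℝ => ⨍ y in Metric.ball x r ∩ Ω, g y) (𝓝[>] 0) (𝓝 l)
  then h.choose else 0

/-- Surface measure on a set `Γ`: the two-dimensional Hausdorff measure, normalised to be the area
on planes, restricted to `Γ`. -/
def surf (Γ : Set E3) : Measure E3 := (μHE[2] : Measure E3).restrict Γ

/-- The squared `L²(μ)` norm, with values in `[0, ∞]`. -/
def l2Sq {F : Type*} [NormedAddCommGroup F] (μ : Measure E3) (g : E3 → F) : ℝ≥0∞ :=
  ∫⁻ x, ‖g x‖ₑ ^ 2 ∂μ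

/-- The `i`-th row of the Jacobian matrix of `v`, that is the gradient of the `i`-th component. -/
def gradRow (v : E3 → E3) (i : Fin 3) : E3 → E3 := gradient (fun y => v y i)

/-- The divergence of a vector field. -/
def divergence (v : E3 → E3) (x : E3) : ℝ := ∑ i, gradRow v i x i

/-! ### Meshes -/

/-- A conforming tetrahedral triangulation: a finite simplicial complex in three-space every simplex
of which is a face of a tetrahedron. -/
structure TetMesh extends Geometry.SimplicialComplex ℝ E3 where
  finite_faces : faces.Finite
  pure_faces : ∀ s ∈ faces, ∃ t ∈ faces, s ⊆ t ∧ t.card = 4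

/-- The closed simplex spanned by a finite set of vertices. -/
abbrev hull (T : Finset E3) : Set E3 := convexHull ℝ (T : Set E3)

/-- The tetrahedra of the mesh (as vertex sets). -/
def TetMesh.tets (M : TetMesh) : Finset (Finset E3) :=
  M.finite_faces.toFinset.filter (fun T => T.card = 4)

/-- The open domain induced by a set of tetrahedra: the interior of their union. -/
def meshDomain (S : Finset (Finset E3)) : Set E3 := interior (⋃ T ∈ S, hull T)

/-- The triangulated background domain. -/
def TetMesh.domain (M : TetMesh) : Set E3 := meshDomain M.tets

/-- The mesh size `h`, the largest diameter of a tetrahedron. -/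
def TetMesh.h (M : TetMesh) : ℝ := ⨆ T : M.tets, Metric.diam (hull T)

/-- Shape regularity with constant `σ`: each tetrahedron contains a ball whose radius is comparable
with the diameter of the tetrahedron. -/
def TetMesh.ShapeRegular (M : TetMesh) (σ : ℝ) : Prop :=
  ∀ T ∈ M.tets, ∃ x : E3, Metric.ball x (Metric.diam (hull T) / σ) ⊆ hull T

/-- Quasi-uniformity with constant `κ`. -/
def TetMesh.QuasiUniform (M : TetMesh) (κ : ℝ) : Prop :=
  ∀ T ∈ M.tets, M.h ≤ κ * Metric.diam (hull T)

open Classical in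
/-- The active triangulation: the tetrahedra that meet the closed `δ`-neighbourhood of `Ω`. -/
def TetMesh.active (M : TetMesh) (Ω : Set E3) (δ : ℝ) : Finset (Finset E3) :=
  M.tets.filter (fun T => ∃ x ∈ hull T, Metric.infDist x Ω ≤ δ)

open Classical in
/-- The interior triangulation: the active tetrahedra whose interior lies in `Ω`. -/
def TetMesh.inner (M : TetMesh) (Ω : Set E3) (δ : ℝ) : Finset (Finset E3) :=
  (M.active Ω δ).filter (fun T => interior (hull T) ⊆ Ω)

/-- The segment between `a` and `b` does not lie on the boundary of the interior mesh domain: its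
relative interior lies in the open domain. -/
def TetMesh.IsInnerEdge (M : TetMesh) (Ω : Set E3) (δ : ℝ) (a b : E3) : Prop :=
  openSegment ℝ a b ⊆ meshDomain (M.inner Ω δ)

open Classical in
/-- The reduced interior triangulation: the interior tetrahedra with (at least) three interior edges
that have linearly independent directions. -/
def TetMesh.reduced (M : TetMesh) (Ω : Set E3) (δ : ℝ) : Finset (Finset E3) :=
  (M.inner Ω δ).filter (fun T => ∃ a b : Fin 3 → E3,
    (∀ i, a i ∈ T ∧ b i ∈ T ∧ M.IsInnerEdge Ω δ (a i) (b i)) ∧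
      LinearIndependent ℝ (fun i => b i - a i))

/-! ### Finite element spaces -/

/-- Polynomial functions of total degree at most `k`. -/
def IsPoly (k : ℕ) (f : E3 → ℝ) : Prop :=
  ∃ p : MvPolynomial (Fin 3) ℝ, p.totalDegree ≤ k ∧ ∀ x : E3, f x = MvPolynomial.eval (fun i => x i) p

/-- Piecewise polynomials of degree at most `k` (the values on the null set of points that are
interior to no tetrahedron are irrelevant and left free). -/
def TetMesh.P (M : TetMesh) (k : ℕ) : Set (E3 → ℝ) :=
  {q | ∀ T ∈ M.tets, ∃ f, IsPoly k f ∧ Set.EqOn q f (interior (hull T))}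

/-- Continuous piecewise polynomials, that is the piecewise polynomials in `H¹` of the domain. -/
def TetMesh.Pc (M : TetMesh) (k : ℕ) : Set (E3 → ℝ) :=
  {q | q ∈ M.P k ∧ ContinuousOn q M.domain}

/-- Vector fields with components in `Pc`. -/
def TetMesh.PcVec (M : TetMesh) (k : ℕ) : Set (E3 → E3) :=
  {v | ∀ i, (fun x => v x i) ∈ M.Pc k}

/-- `l a`, for `a` a vertex of `T`, are the barycentric coordinates of the tetrahedron `T`. -/
def IsBarycentric (T : Finset E3) (l : E3 → E3 →ᵃ[ℝ] ℝ) : Prop :=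
  ∀ a ∈ T, l a a = 1 ∧ ∀ b ∈ T, b ≠ a → l a b = 0

/-- The velocity space of the lowest-order Mini element: on each tetrahedron, an affine field plus a
constant vector times the quartic bubble (the product of the barycentric coordinates). -/
def TetMesh.miniVelocity (M : TetMesh) : Set (E3 → E3) :=
  {v | ContinuousOn v M.domain ∧ ∀ T ∈ M.tets, ∃ (l : E3 → E3 →ᵃ[ℝ] ℝ) (w : E3 → E3) (c : E3),
    IsBarycentric T l ∧ (∀ i, IsPoly 1 (fun x => w x i)) ∧
      ∀ x ∈ interior (hull T), v x = w x + (∏ a ∈ T, l a x) • c}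

/-- Restriction of a velocity space to the active domain. -/
def TetMesh.velocitySpace (M : TetMesh) (Ω : Set E3) (δ : ℝ) (V : Set (E3 → E3)) :
    Set (E3 → E3) :=
  {v | ∃ w ∈ V, Set.EqOn v w (meshDomain (M.active Ω δ))}

/-- Restriction to the active domain of the functions in a pressure space that have zero mean on the
domain of the sub-mesh `N`. -/
def TetMesh.pressureSpace (M : TetMesh) (Ω : Set E3) (δ : ℝ) (N : Finset (Finset E3))
    (Q : Set (E3 → ℝ)) : Set (E3 → ℝ) :=
  {q | ∃ p ∈ Q, Set.EqOn q p (meshDomain (M.active Ω δ)) ∧ ∫ x in meshDomain N, p x = 0}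

/-! ### Norms and the divergence form -/

/-- `‖∇v‖²_Ω + h⁻¹ ‖v‖²_Γ + h ‖∇v‖²_Γ` with `Γ = ∂Ω`, the boundary values being taken from `Ω`. -/
def TetMesh.nitscheSq (M : TetMesh) (Ω : Set E3) (v : E3 → E3) : ℝ≥0∞ :=
  (∑ i, l2Sq (volume.restrict Ω) (gradRow v i)) +
    ENNReal.ofReal M.h⁻¹ * l2Sq (surf (frontier Ω)) (innerTrace Ω v) +
    ENNReal.ofReal M.h * ∑ i, l2Sq (surf (frontier Ω)) (innerTrace Ω (gradRow v i))

/-- The extended velocity norm, the square root of `‖∇v‖²` over the active domain plus the square of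
the Nitsche norm. -/
def TetMesh.velocityNorm (M : TetMesh) (Ω : Set E3) (δ : ℝ) (v : E3 → E3) : ℝ≥0∞ :=
  ((∑ i, l2Sq (volume.restrict (meshDomain (M.active Ω δ))) (gradRow v i)) +
    M.nitscheSq Ω v) ^ (1 / 2 : ℝ)

/-- The jump (up to sign) of `q` between `T₁` and `T₂`, at a point of a common face: the difference
of the continuous extensions of `q` from the interiors of the two tetrahedra. -/
def jump (q : E3 → ℝ) (T₁ T₂ : Finset E3) (x : E3) : ℝ :=
  extendFrom (interior (hull T₁)) q x - extendFrom (interior (hull T₂)) q x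

open Classical in
/-- The ordered pairs of distinct tetrahedra of `S` that share a (triangular) face. Every interior
face of `S` is `hull T₁ ∩ hull T₂` for exactly two such pairs. -/
def facePairs (S : Finset (Finset E3)) : Finset (Finset E3 × Finset E3) :=
  (S ×ˢ S).filter (fun P => P.1 ≠ P.2 ∧ (P.1 ∩ P.2).card = 3)

/-- The weighted `H¹` pressure seminorm on the sub-mesh `S`, the square root of
`h² ∑_T ‖∇q‖²_T + h ∑_F ‖⟦q⟧‖²_F`, over the tetrahedra `T` and the interior faces `F` of `S`. -/
def TetMesh.pressureNorm (M : TetMesh) (S : Finset (Finset E3)) (q : E3 → ℝ) : ℝ≥0∞ :=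
  (ENNReal.ofReal M.h ^ 2 * (∑ T ∈ S, l2Sq (volume.restrict (hull T)) (gradient q)) +
    ENNReal.ofReal M.h * ((1 / 2) * ∑ P ∈ facePairs S,
      l2Sq (surf (hull P.1 ∩ hull P.2)) (jump q P.1 P.2))) ^ (1 / 2 : ℝ)

/-- `∫_Ω (div v) q dx - ∫_Γ (v · n) q ds`. -/
def divForm (Ω : Set E3) (v : E3 → E3) (q : E3 → ℝ) : ℝ :=
  (∫ x in Ω, divergence v x * q x) -
    ∫ x, inner ℝ (innerTrace Ω v x) (outerNormal Ω x) * innerTrace Ω q x ∂(surf (frontier Ω))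

/-- The three stability conditions on a velocity-pressure pair `V × Q`, with the constant `C`. The
pressures are normalised to zero mean on the sub-mesh `N` and measured on the sub-mesh `S`. -/
def TetMesh.StablePair (M : TetMesh) (Ω : Set E3) (δ : ℝ) (N S : Finset (Finset E3))
    (V : Set (E3 → E3)) (Q : Set (E3 → ℝ)) (C : ℝ≥0) : Prop :=
  ∀ q ∈ M.pressureSpace Ω δ N Q, ∃ v ∈ M.velocitySpace Ω δ V,
    M.velocityNorm Ω δ v ≤ C * M.pressureNorm S q ∧
    ((M.pressureNorm S q ^ 2 : ℝ≥0∞) : EReal) ≤ ((divForm Ω v q : ℝ) : EReal) ∧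
    l2Sq (volume.restrict Ω) v ^ (1 / 2 : ℝ) ≤ C * (ENNReal.ofReal M.h * M.pressureNorm S q)

/-- A physical domain `Ω` cut out of a shape-regular and quasi-uniform background mesh, together
with the width `δ` of the extension layer. -/
structure Setting (σ κ : ℝ) (M : TetMesh) (Ω : Set E3) (δ : ℝ) : Prop where
  shapeRegular : M.ShapeRegular σ
  quasiUniform : M.QuasiUniform κ
  lipschitz : IsLipschitzDomain Ω
  subset_domain : Ω ⊆ M.domain
  delta_nonneg : 0 ≤ δ

end CutFEM

end

noncomputable section

namespace CutFEM

/-! ### Polynomial functions -/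

/-! The velocity is written down explicitly. On each interior tetrahedron it is a sum of elementary
fields `G • t` with constant direction `t`, whose divergence is the derivative of `G` along `t`. The
coefficient `G` is a bubble (a product of barycentric coordinates) times a polynomial read off from
the pressure. The bubbles are chosen so that the pieces fit together to a continuous field which
vanishes outside the interior mesh and on the boundary `Γ` of `Ω`. Hence the boundary integral in
the form `b` drops out, and `b` is a sum over the interior tetrahedra (`divForm_glue`).

Continuous pressures: for an edge from `a` to `b` take the bubble times the derivative of `q` along
`b - a`, in the direction `a - b`. Integration by parts along the edge has no boundary term, because
each face either is parallel to the edge or carries a zero of the bubble. What remains is the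
integral of the bubble times the square of the edge derivative (`integral_edge_field`). With the
product of the two coordinates at the ends of an interior edge this is the Taylor–Hood case:
tangential derivatives of a continuous function agree along a common edge, and three independent
interior edges control the whole gradient on the reduced mesh. With the quartic element bubble and
all pairs of vertices it is the Mini case.

Piecewise constant pressures: take the cubic face bubble times the jump, in a direction in which the
bubble increases on average on one side of the face. The mean derivatives on the two sides cancel
(`TetMesh.integral_fderiv_face_bubble`), so the form sees the squared jump. Both integrations by
parts come from translation invariance of Lebesgue measure (`sum_integral_fderiv_eq_zero`).

The estimates are local. Finite dimension and scaling bound a polynomial pointwise by its mean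
square over a ball inside the tetrahedron on which every bubble is bounded below
(`exists_bubble_inverse_inequality`). So the contribution of each elementary field to `b` controls
the field and its gradient, and the sum of the contributions controls the pressure seminorm.
Multiplying the field by a suitable number then yields the three conditions (`exists_stable_const`).

The position of `Γ` is harmless for the following reason: `Γ` meets an interior tetrahedron only in
its boundary, whose area is at most a constant times `h ^ 2`. This bounds the trace of the gradient
without any information on the area of `Γ` (`exists_trace_gradient_bound`). -/

theorem IsPoly.mono {k l : ℕ} {f : E3 → ℝ} (h : IsPoly k f) (hkl : k ≤ l) : IsPoly l f :=
  let ⟨p, hp, e⟩ := h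
  ⟨p, hp.trans hkl, e⟩

theorem isPoly_const (k : ℕ) (c : ℝ) : IsPoly k (fun _ => c) :=
  ⟨MvPolynomial.C c, by simp, by simp⟩

theorem isPoly_coord (i : Fin 3) : IsPoly 1 (fun x => x i) :=
  ⟨MvPolynomial.X i, by simp, by simp⟩

theorem IsPoly.add {k : ℕ} {f g : E3 → ℝ} (hf : IsPoly k f) (hg : IsPoly k g) :
    IsPoly k (fun x => f x + g x) := by
  obtain ⟨p, hp, ep⟩ := hf
  obtain ⟨q, hq, eq⟩ := hg
  exact ⟨p + q, (MvPolynomial.totalDegree_add _ _).trans (max_le hp hq), by simp [ep, eq]⟩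

theorem IsPoly.mul {k l : ℕ} {f g : E3 → ℝ} (hf : IsPoly k f) (hg : IsPoly l g) :
    IsPoly (k + l) (fun x => f x * g x) := by
  obtain ⟨p, hp, ep⟩ := hf
  obtain ⟨q, hq, eq⟩ := hg
  exact ⟨p * q, (MvPolynomial.totalDegree_mul _ _).trans (add_le_add hp hq), by simp [ep, eq]⟩

theorem IsPoly.const_mul {k : ℕ} {f : E3 → ℝ} (c : ℝ) (hf : IsPoly k f) :
    IsPoly k (fun x => c * f x) := by
  simpa using (isPoly_const 0 c).mul hf

theorem IsPoly.sum {ι : Type*} {k : ℕ} (s : Finset ι) {f : ι → E3 → ℝ}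
    (hf : ∀ i ∈ s, IsPoly k (f i)) : IsPoly k (fun x => ∑ i ∈ s, f i x) := by
  classical
  induction s using Finset.induction_on with
  | empty => simpa using isPoly_const k 0
  | insert a s ha ih =>
    simp only [Finset.sum_insert ha]
    exact (hf a (by simp)).add (ih fun i hi => hf i (by simp [hi]))

theorem IsPoly.prod {ι : Type*} (s : Finset ι) {k : ι → ℕ} {f : ι → E3 → ℝ}
    (hf : ∀ i ∈ s, IsPoly (k i) (f i)) : IsPoly (∑ i ∈ s, k i) (fun x => ∏ i ∈ s, f i x) := by
  classical
  induction s using Finset.induction_on with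
  | empty => simpa using isPoly_const 0 1
  | insert a s ha ih =>
    simp only [Finset.prod_insert ha, Finset.sum_insert ha]
    exact (hf a (by simp)).mul (ih fun i hi => hf i (by simp [hi]))

theorem IsPoly.pow {k : ℕ} {f : E3 → ℝ} (hf : IsPoly k f) (n : ℕ) :
    IsPoly (n * k) (fun x => f x ^ n) := by
  simpa using IsPoly.prod (Finset.range n) (k := fun _ => k) (f := fun _ => f) (fun _ _ => hf)

/-- An affine substitution turns the monomial with exponent `s` into a product of total degree at
most the sum of `s`. Needed for the translation and dilation in the scaling argument. -/
theorem IsPoly.comp {k : ℕ} {f : E3 → ℝ} (hf : IsPoly k f) {g : E3 → E3}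
    (hg : ∀ i, IsPoly 1 (fun x => g x i)) : IsPoly k (fun x => f (g x)) := by
  obtain ⟨p, hp, ep⟩ := hf
  have : (fun x => f (g x)) = fun x => ∑ s ∈ p.support, p.coeff s * ∏ i, g x i ^ s i := by
    funext x
    rw [ep, MvPolynomial.eval_eq']
  rw [this]
  refine IsPoly.sum _ fun s hs => IsPoly.const_mul _ ?_
  have h := IsPoly.prod Finset.univ (k := fun i => s i * 1) (f := fun i x => g x i ^ s i)
    (fun i _ => (hg i).pow (s i))
  refine h.mono (le_trans ?_ hp)
  have := MvPolynomial.le_totalDegree hs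
  rw [Finsupp.sum_fintype _ _ (by simp)] at this
  simpa using this

theorem isPoly_affine (l : E3 →ᵃ[ℝ] ℝ) : IsPoly 1 (fun x => l x) := by
  have : (fun x => l x) = fun x : E3 =>
      (∑ i, l.linear (EuclideanSpace.single i 1) * x i) + l 0 := by
    funext x
    have h1 : l x = l.linear x + l 0 := congrFun (AffineMap.decomp l) x
    rw [h1]
    congr 1
    have h2 : x = ∑ i, x i • (EuclideanSpace.single i (1 : ℝ) : E3) := by
      ext j
      fin_cases j <;> simp [Fin.sum_univ_three]
    conv_lhs => rw [h2]
    simp [map_sum, mul_comm]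
  rw [this]
  exact (IsPoly.sum _ fun i _ => (isPoly_coord i).const_mul _).add (isPoly_const _ _)

theorem IsPoly.contDiff {k : ℕ} {f : E3 → ℝ} (hf : IsPoly k f) {n : WithTop ℕ∞} : ContDiff ℝ n f := by
  obtain ⟨p, hp, ep⟩ := hf
  rw [funext ep]
  simp only [MvPolynomial.eval_eq']
  fun_prop

/-- Derivatives are expressed through formal ones because `MvPolynomial.pderiv` is a linear operator
on polynomials, to which the compactness bound `exists_mvPolynomial_bound` applies. -/
theorem hasFDerivAt_mvPolynomial (p : MvPolynomial (Fin 3) ℝ) (x : E3) :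
    HasFDerivAt (fun x : E3 => MvPolynomial.eval (fun i => x i) p)
      (∑ i, MvPolynomial.eval (fun i => x i) (MvPolynomial.pderiv i p) •
        (EuclideanSpace.proj i : E3 →L[ℝ] ℝ)) x := by
  induction p using MvPolynomial.induction_on with
  | C a => simpa using hasFDerivAt_const a x
  | add p q hp hq =>
    simp only [map_add, add_smul, Finset.sum_add_distrib]
    exact hp.add hq
  | mul_X p j hp =>
    have hj : HasFDerivAt (fun x : E3 => x j) (EuclideanSpace.proj j : E3 →L[ℝ] ℝ) x :=
      (EuclideanSpace.proj j : E3 →L[ℝ] ℝ).hasFDerivAt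
    have h := hp.mul hj
    simp only [map_mul, MvPolynomial.eval_X]
    refine h.congr_fderiv ?_
    ext v
    simp [Derivation.leibniz, add_mul, Finset.sum_add_distrib, MvPolynomial.pderiv_X,
      Pi.single_apply, Finset.mul_sum, mul_assoc, apply_ite (MvPolynomial.eval fun i => x i)]

theorem totalDegree_pderiv_le (i : Fin 3) (p : MvPolynomial (Fin 3) ℝ) :
    (MvPolynomial.pderiv i p).totalDegree ≤ p.totalDegree - 1 := by
  conv_lhs => rw [p.as_sum, map_sum]
  refine MvPolynomial.totalDegree_finsetSum_le fun s hs => ?_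
  rw [MvPolynomial.pderiv_monomial]
  -- A monomial without the variable has derivative zero; otherwise the exponent sum drops by
  -- exactly one, so truncated subtraction does no harm.
  by_cases hi : s i = 0
  · simp [hi]
  refine (MvPolynomial.totalDegree_monomial_le _ _).trans ?_
  have h := MvPolynomial.le_totalDegree hs
  rw [Finsupp.sum_fintype _ _ (by simp)] at h ⊢
  have h2 : ∑ j, (s - Finsupp.single i 1 : Fin 3 →₀ ℕ) j + 1 ≤ ∑ j, s j := by
    rw [← Finset.add_sum_erase _ _ (Finset.mem_univ i), ← Finset.add_sum_erase _ (fun j => s j) (Finset.mem_univ i)]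
    have : ∑ j ∈ Finset.univ.erase i, (s - Finsupp.single i 1 : Fin 3 →₀ ℕ) j
        = ∑ j ∈ Finset.univ.erase i, s j := by
      refine Finset.sum_congr rfl fun j hj => ?_
      have := Finset.ne_of_mem_erase hj
      simp [this.symm]
    rw [this]
    simp
    omega
  simp only [id] at h h2 ⊢
  omega

theorem IsPoly.fderiv {k : ℕ} {f : E3 → ℝ} (hf : IsPoly k f) (t : E3) :
    IsPoly (k - 1) (fun x => fderiv ℝ f x t) := by
  obtain ⟨p, hp, ep⟩ := hf
  have : (fun x => _root_.fderiv ℝ f x t) = fun x : E3 =>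
      ∑ i, t i * MvPolynomial.eval (fun i => x i) (MvPolynomial.pderiv i p) := by
    funext x
    rw [funext ep, (hasFDerivAt_mvPolynomial p x).fderiv]
    simp [mul_comm]
  rw [this]
  exact IsPoly.sum _ fun i _ => IsPoly.const_mul _
    ⟨_, (totalDegree_pderiv_le i p).trans (Nat.sub_le_sub_right hp 1), fun _ => rfl⟩

theorem IsPoly.exists_eq_const {f : E3 → ℝ} (hf : IsPoly 0 f) : ∃ c, ∀ x, f x = c := by
  obtain ⟨p, hp, ep⟩ := hf
  rw [Nat.le_zero, MvPolynomial.totalDegree_eq_zero_iff_eq_C] at hp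
  exact ⟨p.coeff 0, fun x => by rw [ep, hp]; simp⟩

/-! ### Norm equivalence for polynomials -/

/-- A polynomial that vanishes on a ball is zero. -/
theorem mvPolynomial_eq_zero_of_ball {p : MvPolynomial (Fin 3) ℝ} {r : ℝ} (hr : 0 < r)
    (h : ∀ x ∈ Metric.ball (0 : E3) r, MvPolynomial.eval (fun i => x i) p = 0) : p = 0 := by
  refine MvPolynomial.funext_set (fun _ => Set.Ioo (-(r / 2)) (r / 2))
    (fun _ => Set.Ioo_infinite (by linarith)) fun x hx => ?_
  rw [map_zero]
  refine h (WithLp.toLp 2 x) ?_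
  have hb : ∀ i, x i ^ 2 ≤ (r / 2) ^ 2 := fun i => by
    have := hx i (Set.mem_univ i)
    exact sq_le_sq' this.1.le this.2.le
  rw [mem_ball_zero_iff, EuclideanSpace.norm_eq]
  refine (Real.sqrt_lt' hr).2 ?_
  simp only [Real.norm_eq_abs, sq_abs, Fin.sum_univ_three]
  nlinarith [hb 0, hb 1, hb 2, sq_nonneg r, mul_pos hr hr]

/-- On polynomials of bounded degree, the values of a linear operator are bounded by the mean square
over a ball. -/
theorem exists_mvPolynomial_bound (k : ℕ) {r : ℝ} (hr : 0 < r)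
    (L : MvPolynomial (Fin 3) ℝ →ₗ[ℝ] MvPolynomial (Fin 3) ℝ) :
    ∃ C : ℝ, 0 < C ∧ ∀ p : MvPolynomial (Fin 3) ℝ, p.totalDegree ≤ k →
      ∀ x ∈ Metric.closedBall (0 : E3) 1, MvPolynomial.eval (fun i => x i) (L p) ^ 2 ≤
        C * ∫ y in Metric.ball (0 : E3) r, MvPolynomial.eval (fun i => y i) p ^ 2 := by
  let V := MvPolynomial.restrictTotalDegree (Fin 3) ℝ k
  let b := Module.finBasis ℝ V
  let n := Module.finrank ℝ V
  let ev : (Fin n → ℝ) → E3 → ℝ := fun c x =>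
    ∑ i, c i * MvPolynomial.eval (fun j => x j) (b i : MvPolynomial (Fin 3) ℝ)
  let ew : (Fin n → ℝ) → E3 → ℝ := fun c x =>
    ∑ i, c i * MvPolynomial.eval (fun j => x j) (L (b i : MvPolynomial (Fin 3) ℝ))
  have ewp : ∀ c x, ew c x = MvPolynomial.eval (fun j => x j)
      (L ((∑ i, c i • b i : V) : MvPolynomial (Fin 3) ℝ)) := by
    intro c x
    simp [ew, MvPolynomial.smul_eval]
  have evp : ∀ c x, ev c x = MvPolynomial.eval (fun j => x j)
      ((∑ i, c i • b i : V) : MvPolynomial (Fin 3) ℝ) := by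
    intro c x
    simp [ev, MvPolynomial.smul_eval]
  have hevc : Continuous (fun z : (Fin n → ℝ) × E3 => ev z.1 z.2) := by
    simp only [ev, MvPolynomial.eval_eq']
    fun_prop
  have hewc : Continuous (fun z : (Fin n → ℝ) × E3 => ew z.1 z.2) := by
    simp only [ew, MvPolynomial.eval_eq']
    fun_prop
  have hcont : Continuous (fun c => ∫ y in Metric.ball (0 : E3) r, ev c y ^ 2) := by
    -- The closed ball differs by a null set and is compact, so the integral depends continuously on
    -- the coefficients.
    have hX : (fun c => ∫ y in Metric.ball (0 : E3) r, ev c y ^ 2) =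
        fun c => ∫ y in Metric.closedBall (0 : E3) r, ev c y ^ 2 := by
      funext c
      exact setIntegral_congr_set (ae_eq_of_subset_of_measure_ge Metric.ball_subset_closedBall
        (Measure.addHaar_closedBall_eq_addHaar_ball _ _ _).le
        Metric.isOpen_ball.measurableSet.nullMeasurableSet measure_closedBall_lt_top.ne)
    rw [hX]
    exact continuous_parametric_integral_of_continuous (by fun_prop) (isCompact_closedBall _ _)
  have hint : ∀ c, IntegrableOn (fun y => ev c y ^ 2) (Metric.ball (0 : E3) r) := by
    intro c
    have : Continuous (fun y => ev c y ^ 2) := by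
      have := hevc.comp (Continuous.prodMk_right c)
      exact this.pow 2
    exact (this.continuousOn.integrableOn_compact (isCompact_closedBall (0 : E3) r)).mono_set
      Metric.ball_subset_closedBall
  have hpos : ∀ c, c ≠ 0 → 0 < ∫ y in Metric.ball (0 : E3) r, ev c y ^ 2 := by
    intro c hc
    refine lt_of_le_of_ne (integral_nonneg fun _ => sq_nonneg _) fun h0 => hc ?_
    have h1 := (setIntegral_eq_zero_iff_of_nonneg_ae (ae_of_all _ fun _ => sq_nonneg _) (hint c)).1 h0.symm
    have h2 : Set.EqOn (fun y => ev c y ^ 2) 0 (Metric.ball (0 : E3) r) := by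
      refine Measure.eqOn_open_of_ae_eq (μ := volume) h1 Metric.isOpen_ball ?_ continuousOn_const
      exact ((hevc.comp (Continuous.prodMk_right c)).pow 2).continuousOn
    have h3 : ((∑ i, c i • b i : V) : MvPolynomial (Fin 3) ℝ) = 0 := by
      refine mvPolynomial_eq_zero_of_ball hr fun x hx => ?_
      have := h2 hx
      rw [← evp]
      simpa using this
    have h4 : (∑ i, c i • b i : V) = 0 := Subtype.ext h3
    have := Fintype.linearIndependent_iff.1 b.linearIndependent c h4
    exact funext this
  -- By homogeneity only coefficient vectors of norm one matter. There compactness gives a positive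
  -- minimum `m` of the mean square and a bound `A` for the values.
  have hK : IsCompact (Metric.sphere (0 : Fin n → ℝ) 1) := isCompact_sphere _ _
  obtain ⟨m, hm, hmle⟩ : ∃ m : ℝ, 0 < m ∧ ∀ c ∈ Metric.sphere (0 : Fin n → ℝ) 1,
      m ≤ ∫ y in Metric.ball (0 : E3) r, ev c y ^ 2 := by
    rcases (Metric.sphere (0 : Fin n → ℝ) 1).eq_empty_or_nonempty with he | hne
    · exact ⟨1, one_pos, by simp [he]⟩
    · obtain ⟨c, hc, hmin⟩ := hK.exists_isMinOn hne hcont.continuousOn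
      exact ⟨_, hpos c (by rintro rfl; simp at hc), fun c' hc' => hmin hc'⟩
  obtain ⟨A, hA⟩ := (hK.prod (isCompact_closedBall (0 : E3) 1)).exists_bound_of_continuousOn
    hewc.continuousOn
  have hA0 : 0 ≤ A ^ 2 + 1 := by positivity
  refine ⟨(A ^ 2 + 1) / m, by positivity, fun p hp x hx => ?_⟩
  let pv : V := ⟨p, (MvPolynomial.mem_restrictTotalDegree _ _ _).2 hp⟩
  let c : Fin n → ℝ := fun i => b.repr pv i
  have hfc : ∀ x : E3, MvPolynomial.eval (fun i => x i) p = ev c x := by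
    intro x
    rw [evp, b.sum_repr pv]
  have hgc : ∀ x : E3, MvPolynomial.eval (fun i => x i) (L p) = ew c x := by
    intro x
    rw [ewp, b.sum_repr pv]
  by_cases hc : c = 0
  · have : ∀ x : E3, MvPolynomial.eval (fun i => x i) (L p) = 0 := fun x => by
      rw [hgc, hc]; simp [ew]
    rw [this]
    have : 0 ≤ ∫ y in Metric.ball (0 : E3) r, MvPolynomial.eval (fun i => y i) p ^ 2 :=
      integral_nonneg fun _ => sq_nonneg _
    rw [zero_pow two_ne_zero]
    exact mul_nonneg (by positivity) this
  have hc' : 0 < ‖c‖ := norm_pos_iff.2 hc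
  set e : Fin n → ℝ := ‖c‖⁻¹ • c with he
  have hes : e ∈ Metric.sphere (0 : Fin n → ℝ) 1 := by
    simp [he, norm_smul, hc'.ne']
  have hfe : ∀ x : E3, MvPolynomial.eval (fun i => x i) p = ‖c‖ * ev e x := by
    intro x
    rw [hfc]
    simp only [ev, he, Finset.mul_sum, Pi.smul_apply, smul_eq_mul]
    refine Finset.sum_congr rfl fun i _ => ?_
    field_simp
  have hge : ∀ x : E3, MvPolynomial.eval (fun i => x i) (L p) = ‖c‖ * ew e x := by
    intro x
    rw [hgc]
    simp only [ew, he, Finset.mul_sum, Pi.smul_apply, smul_eq_mul]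
    refine Finset.sum_congr rfl fun i _ => ?_
    field_simp
  have h1 : ew e x ^ 2 ≤ A ^ 2 := by
    have := hA (e, x) ⟨hes, hx⟩
    rw [Real.norm_eq_abs] at this
    exact sq_le_sq' (abs_le.1 this).1 (abs_le.1 this).2
  have h2 := hmle e hes
  simp only [hfe, hge, mul_pow]
  rw [integral_const_mul]
  have h3 : A ^ 2 + 1 ≤ (A ^ 2 + 1) / m * ∫ y in Metric.ball (0 : E3) r, ev e y ^ 2 := by
    rw [div_mul_eq_mul_div, le_div_iff₀ hm]
    exact mul_le_mul_of_nonneg_left h2 hA0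
  have h4 := sq_nonneg ‖c‖
  nlinarith

theorem norm_fderiv_mvPolynomial_sq_le (p : MvPolynomial (Fin 3) ℝ) (x : E3) :
    ‖fderiv ℝ (fun x : E3 => MvPolynomial.eval (fun i => x i) p) x‖ ^ 2 ≤
      3 * ∑ i, MvPolynomial.eval (fun i => x i) (MvPolynomial.pderiv i p) ^ 2 := by
  rw [(hasFDerivAt_mvPolynomial p x).fderiv]
  have h1 : ‖∑ i, MvPolynomial.eval (fun i => x i) (MvPolynomial.pderiv i p) •
        (EuclideanSpace.proj i : E3 →L[ℝ] ℝ)‖ ≤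
      ∑ i, |MvPolynomial.eval (fun i => x i) (MvPolynomial.pderiv i p)| := by
    refine (norm_sum_le _ _).trans (Finset.sum_le_sum fun i _ => ?_)
    rw [norm_smul, Real.norm_eq_abs]
    refine mul_le_of_le_one_right (abs_nonneg _) ?_
    refine ContinuousLinearMap.opNorm_le_bound _ zero_le_one fun y => ?_
    simpa using PiLp.norm_apply_le y i
  refine (pow_le_pow_left₀ (norm_nonneg _) h1 2).trans ?_
  refine (sq_sum_le_card_mul_sum_sq).trans ?_
  simp

/-- Inverse inequality: values and derivatives of a polynomial are bounded by its mean square over a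
smaller ball, with the natural scaling. -/
theorem exists_inverse_inequality (k : ℕ) {s : ℝ} (hs : 0 < s) :
    ∃ C : ℝ, 0 < C ∧ ∀ f : E3 → ℝ, IsPoly k f → ∀ (x₀ : E3) (d : ℝ), 0 < d →
      ∀ x ∈ Metric.closedBall x₀ d,
        d ^ 3 * f x ^ 2 ≤ C * ∫ y in Metric.ball x₀ (s * d), f y ^ 2 ∧
        d ^ 3 * (d * ‖fderiv ℝ f x‖) ^ 2 ≤ C * ∫ y in Metric.ball x₀ (s * d), f y ^ 2 := by
  obtain ⟨C₀, hC₀, h₀⟩ := exists_mvPolynomial_bound k hs LinearMap.id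
  choose C₁ hC₁ h₁ using fun i : Fin 3 =>
    exists_mvPolynomial_bound k hs (MvPolynomial.pderiv (R := ℝ) i).toLinearMap
  have hsum : 0 ≤ ∑ i, C₁ i := Finset.sum_nonneg fun i _ => (hC₁ i).le
  refine ⟨C₀ + 3 * ∑ i, C₁ i, by positivity, fun f hf x₀ d hd x hx => ?_⟩
  -- Pull back to the unit ball: the integral scales with `d ^ 3`, the derivative with `d`.
  let F : E3 → ℝ := fun y => f (x₀ + d • y)
  have hF : IsPoly k F := by
    refine hf.comp fun i => ?_
    simp only [PiLp.add_apply, PiLp.smul_apply, smul_eq_mul]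
    exact (isPoly_const _ _).add ((isPoly_coord i).const_mul d)
  have hI : ∫ y in Metric.ball x₀ (s * d), f y ^ 2 =
      d ^ 3 * ∫ y in Metric.ball (0 : E3) s, F y ^ 2 := by
    have e1 : ∫ y in Metric.ball x₀ (s * d), f y ^ 2 =
        ∫ y in Metric.ball (0 : E3) (s * d), f (x₀ + y) ^ 2 := by
      have := (measurePreserving_add_left (volume : Measure E3) x₀).setIntegral_preimage_emb
        (measurableEmbedding_addLeft x₀) (fun y => f y ^ 2) (Metric.ball x₀ (s * d))
      rw [← this]
      simp
    have e2 := Measure.setIntegral_comp_smul (volume : Measure E3) (fun y => f (x₀ + y) ^ 2)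
      (Metric.ball (0 : E3) s) hd.ne'
    rw [smul_ball hd.ne'] at e2
    simp only [finrank_euclideanSpace, Fintype.card_fin, smul_zero, Real.norm_eq_abs, abs_of_pos hd,
      smul_eq_mul, abs_of_pos (inv_pos.2 (pow_pos hd 3))] at e2
    rw [e1, mul_comm s d]
    simp only [F]
    rw [e2]
    field_simp
  obtain ⟨z, hz, rfl⟩ : ∃ z ∈ Metric.closedBall (0 : E3) 1, x₀ + d • z = x := by
    refine ⟨d⁻¹ • (x - x₀), ?_, ?_⟩
    · rw [mem_closedBall_iff_norm] at hx
      rw [mem_closedBall_zero_iff, norm_smul, norm_inv, Real.norm_eq_abs, abs_of_pos hd,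
        inv_mul_le_iff₀ hd]
      simpa using hx
    · rw [smul_inv_smul₀ hd.ne']
      abel
  have hD : d * ‖fderiv ℝ f (x₀ + d • z)‖ = ‖fderiv ℝ F z‖ := by
    have h1 : HasFDerivAt F ((fderiv ℝ f (x₀ + d • z)).comp
        (d • ContinuousLinearMap.id ℝ E3)) z := by
      have hf1 : HasFDerivAt f (fderiv ℝ f (x₀ + d • z)) (x₀ + d • z) :=
        ((hf.contDiff (n := 1)).differentiable one_ne_zero _).hasFDerivAt
      exact hf1.comp z (((hasFDerivAt_id z).const_smul d).const_add x₀)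
    rw [h1.fderiv, ContinuousLinearMap.comp_smul, norm_smul, Real.norm_eq_abs, abs_of_pos hd,
      ContinuousLinearMap.comp_id]
  obtain ⟨p, hp, ep⟩ := hF
  have hnn : 0 ≤ ∫ y in Metric.ball (0 : E3) s, F y ^ 2 := integral_nonneg fun _ => sq_nonneg _
  rw [hI, hD]
  have a0 := h₀ p hp z hz
  have a1 : ‖fderiv ℝ F z‖ ^ 2 ≤ 3 * ∑ i, C₁ i * ∫ y in Metric.ball (0 : E3) s, F y ^ 2 := by
    simp only [funext ep]
    refine (norm_fderiv_mvPolynomial_sq_le p z).trans ?_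
    gcongr with i
    exact h₁ i p hp z hz
  rw [← Finset.sum_mul] at a1
  have a0' : f (x₀ + d • z) ^ 2 ≤ C₀ * ∫ y in Metric.ball (0 : E3) s, F y ^ 2 := by
    have : f (x₀ + d • z) = F z := rfl
    rw [this]
    simp only [funext ep]
    exact a0
  have hd3 : 0 < d ^ 3 := by positivity
  constructor
  · have := mul_le_mul_of_nonneg_left a0' hd3.le
    have h5 : 0 ≤ d ^ 3 * ((∑ i, C₁ i) * ∫ y in Metric.ball (0 : E3) s, F y ^ 2) := by positivity
    linarith
  · have := mul_le_mul_of_nonneg_left a1 hd3.le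
    have h5 : 0 ≤ d ^ 3 * (C₀ * ∫ y in Metric.ball (0 : E3) s, F y ^ 2) := by positivity
    linarith

/-! ### Barycentric coordinates -/

/-- The vertex set of a nondegenerate tetrahedron. -/
structure IsTet (T : Finset E3) : Prop where
  indep : AffineIndependent ℝ ((↑) : T → E3)
  card_eq : T.card = 4

/-- The vertices of a tetrahedron as an affine basis. -/
def IsTet.basis {T : Finset E3} (hT : IsTet T) : AffineBasis T ℝ E3 where
  toFun := (↑)
  ind' := hT.indep
  tot' := by
    rw [hT.indep.affineSpan_eq_top_iff_card_eq_finrank_add_one]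
    simp [hT.card_eq]

open Classical in
/-- The barycentric coordinate of the tetrahedron `T` that belongs to the vertex `a`. -/
def bary (T : Finset E3) (a : E3) : E3 →ᵃ[ℝ] ℝ :=
  if h : IsTet T ∧ a ∈ T then h.1.basis.coord ⟨a, h.2⟩ else 0

section Tet

variable {T : Finset E3} {a b x : E3}

theorem bary_def (hT : IsTet T) (ha : a ∈ T) : bary T a = hT.basis.coord ⟨a, ha⟩ := by
  rw [bary, dif_pos ⟨hT, ha⟩]

/-- The default value zero is the right convention: the hat function of a vertex vanishes on the
tetrahedra that do not contain it, so coordinates of neighbours can be compared for every point `a`.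
-/
theorem bary_of_notMem (ha : a ∉ T) : bary T a = 0 := by
  rw [bary, dif_neg fun h => ha h.2]

theorem bary_self (hT : IsTet T) (ha : a ∈ T) : bary T a a = 1 := by
  rw [bary_def hT ha]
  exact hT.basis.coord_apply_eq ⟨a, ha⟩

theorem bary_of_ne (hT : IsTet T) (hb : b ∈ T) (hab : b ≠ a) : bary T a b = 0 := by
  by_cases ha : a ∈ T
  · rw [bary_def hT ha]
    exact hT.basis.coord_apply_ne (i := ⟨a, ha⟩) (j := ⟨b, hb⟩) (fun h => hab (Subtype.ext_iff.1 h).symm)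
  · simp [bary_of_notMem ha]

theorem sum_bary (hT : IsTet T) (x : E3) : ∑ a ∈ T, bary T a x = 1 := by
  rw [← hT.basis.sum_coord_apply_eq_one x, ← Finset.sum_coe_sort T]
  exact Finset.sum_congr rfl fun a _ => by rw [bary_def hT a.2]

theorem sum_bary_smul (hT : IsTet T) (x : E3) : ∑ a ∈ T, bary T a x • a = x := by
  conv_rhs => rw [← hT.basis.linear_combination_coord_eq_self x]
  rw [← Finset.sum_coe_sort T]
  exact Finset.sum_congr rfl fun a _ => by rw [bary_def hT a.2]; rfl

theorem affine_apply_sum (l : E3 →ᵃ[ℝ] ℝ) (F : Finset E3) (w : E3 → ℝ) (hw : ∑ c ∈ F, w c = 1) :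
    l (∑ c ∈ F, w c • c) = ∑ c ∈ F, w c * l c := by
  have h : ∀ y, l y = l.linear y + l 0 := congrFun (AffineMap.decomp l)
  rw [h, map_sum]
  simp only [map_smul, smul_eq_mul]
  conv_rhs => enter [2, c]; rw [h c, mul_add]
  rw [Finset.sum_add_distrib, ← Finset.sum_mul, hw, one_mul]

theorem affine_eq_sum_bary (hT : IsTet T) (l : E3 →ᵃ[ℝ] ℝ) (x : E3) :
    l x = ∑ a ∈ T, bary T a x * l a := by
  conv_lhs => rw [← sum_bary_smul hT x]
  exact affine_apply_sum _ _ _ (sum_bary hT x)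

theorem range_basis (hT : IsTet T) : Set.range hT.basis = (T : Set E3) :=
  Subtype.range_coe

theorem mem_hull_iff (hT : IsTet T) : x ∈ hull T ↔ ∀ a ∈ T, 0 ≤ bary T a x := by
  have h := hT.basis.convexHull_eq_nonneg_coord
  rw [range_basis hT] at h
  rw [hull, h]
  exact ⟨fun h a ha => by rw [bary_def hT ha]; exact h _, fun h a => by
    rw [← bary_def hT a.2]; exact h _ a.2⟩

theorem mem_interior_hull_iff (hT : IsTet T) :
    x ∈ interior (hull T) ↔ ∀ a ∈ T, 0 < bary T a x := by
  have h := hT.basis.interior_convexHull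
  rw [range_basis hT] at h
  rw [hull, h]
  exact ⟨fun h a ha => by rw [bary_def hT ha]; exact h _, fun h a => by
    rw [← bary_def hT a.2]; exact h _ a.2⟩

theorem bary_le_one (hT : IsTet T) (hx : x ∈ hull T) (a : E3) : bary T a x ≤ 1 := by
  by_cases ha : a ∈ T
  · rw [← sum_bary hT x]
    exact Finset.single_le_sum (f := fun a => bary T a x) ((mem_hull_iff hT).1 hx) ha
  · simp [bary_of_notMem ha]

theorem bary_nonneg (hT : IsTet T) (hx : x ∈ hull T) (a : E3) : 0 ≤ bary T a x := by
  by_cases ha : a ∈ T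
  · exact (mem_hull_iff hT).1 hx a ha
  · simp [bary_of_notMem ha]

theorem continuous_affine (l : E3 →ᵃ[ℝ] ℝ) : Continuous l :=
  AffineMap.continuous_of_finiteDimensional l

theorem isCompact_hull (T : Finset E3) : IsCompact (hull T) :=
  T.finite_toSet.isCompact_convexHull ℝ

theorem isClosed_hull (T : Finset E3) : IsClosed (hull T) :=
  (isCompact_hull T).isClosed

theorem bary_sum (hT : IsTet T) {F : Finset E3} (hF : F ⊆ T) {w : E3 → ℝ}
    (hw : ∑ c ∈ F, w c = 1) (ha : a ∈ F) : bary T a (∑ c ∈ F, w c • c) = w a := by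
  rw [affine_apply_sum _ _ _ hw, Finset.sum_eq_single a]
  · rw [bary_self hT (hF ha), mul_one]
  · intro b hb hba
    rw [bary_of_ne hT (hF hb) hba, mul_zero]
  · exact fun h => absurd ha h

theorem bary_eq_zero_of_mem_hull (hT : IsTet T) {F : Finset E3} (hF : F ⊆ T) (ha : a ∉ F)
    (hx : x ∈ hull F) : bary T a x = 0 := by
  obtain ⟨w, -, hw, rfl⟩ := Finset.mem_convexHull'.1 hx
  rw [affine_apply_sum _ _ _ hw]
  refine Finset.sum_eq_zero fun b hb => ?_
  rw [bary_of_ne hT (hF hb) (by rintro rfl; exact ha hb), mul_zero]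

/-- On a common face both coordinates return the weight of `a` in any convex representation of the
point. -/
theorem bary_congr {T' : Finset E3} (hT : IsTet T) (hT' : IsTet T') {F : Finset E3} (hF : F ⊆ T)
    (hF' : F ⊆ T') (ha : a ∈ F) (hx : x ∈ hull F) : bary T a x = bary T' a x := by
  obtain ⟨w, -, hw, rfl⟩ := Finset.mem_convexHull'.1 hx
  rw [bary_sum hT hF hw ha, bary_sum hT' hF' hw ha]

/-- The centroid of a nonempty face has positive coordinates on the face. -/
theorem exists_mem_hull_pos (hT : IsTet T) {F : Finset E3} (hF : F ⊆ T) (hne : F.Nonempty) :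
    ∃ y ∈ hull F, ∀ a ∈ F, 0 < bary T a y := by
  have hc : (0 : ℝ) < F.card := by exact_mod_cast hne.card_pos
  have hw : ∑ c ∈ F, (fun _ => (F.card : ℝ)⁻¹) c = 1 := by simp [hc.ne']
  refine ⟨∑ c ∈ F, (F.card : ℝ)⁻¹ • c, Finset.mem_convexHull'.2 ⟨_, fun _ _ => by positivity, hw, rfl⟩,
    fun a ha => ?_⟩
  rw [bary_sum hT hF hw ha]
  positivity

theorem IsTet.nonempty (hT : IsTet T) : T.Nonempty := by
  rw [← Finset.card_pos, hT.card_eq]; norm_num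

theorem interior_hull_nonempty (hT : IsTet T) : (interior (hull T)).Nonempty := by
  obtain ⟨y, -, h⟩ := exists_mem_hull_pos hT (Finset.Subset.refl T) hT.nonempty
  exact ⟨y, (mem_interior_hull_iff hT).2 h⟩

theorem closure_interior_hull (hT : IsTet T) : closure (interior (hull T)) = hull T := by
  rw [(convex_convexHull ℝ (T : Set E3)).closure_interior_eq_closure_of_nonempty_interior
    (interior_hull_nonempty hT)]
  exact (isClosed_hull T).closure_eq

theorem volume_hull_diff_interior (T : Finset E3) : volume (hull T \ interior (hull T)) = 0 := by
  have := (convex_convexHull ℝ (T : Set E3)).addHaar_frontier volume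
  rwa [frontier, (isClosed_hull T).closure_eq] at this

theorem interior_hull_ae_eq (T : Finset E3) : interior (hull T) =ᵐ[volume] hull T :=
  (ae_eq_set.2 ⟨by simp [Set.sdiff_eq_empty.2 interior_subset], volume_hull_diff_interior T⟩)

theorem affine_lineMap_eq (l : E3 →ᵃ[ℝ] ℝ) (y x : E3) (s : ℝ) :
    l (AffineMap.lineMap y x s) = (1 - s) * l y + s * l x := by
  rw [AffineMap.apply_lineMap, AffineMap.lineMap_apply_module]
  simp

theorem affine_add_smul (l : E3 →ᵃ[ℝ] ℝ) (x t : E3) (s : ℝ) :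
    l (x + s • t) = l x + s * l.linear t := by
  have := l.map_vadd x (s • t)
  simp only [vadd_eq_add, map_smul, smul_eq_mul] at this
  rw [add_comm x, this, add_comm]

theorem linear_sub (l : E3 →ᵃ[ℝ] ℝ) (x y : E3) : l.linear (x - y) = l x - l y := by
  have := l.linearMap_vsub x y
  simpa using this

end Tet

/-! ### Conforming meshes -/

section Mesh

variable {M : TetMesh} {T T' : Finset E3} {a b x : E3}

theorem TetMesh.mem_tets : T ∈ M.tets ↔ T ∈ M.faces ∧ T.card = 4 := by
  simp [TetMesh.tets]

theorem TetMesh.isTet (hT : T ∈ M.tets) : IsTet T :=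
  ⟨M.indep (mem_tets.1 hT).1, (mem_tets.1 hT).2⟩

open Classical in
theorem TetMesh.mem_hull_inter (hT : T ∈ M.tets) (hT' : T' ∈ M.tets) (hx : x ∈ hull T)
    (hx' : x ∈ hull T') : x ∈ hull (T ∩ T') := by
  have := M.inter_subset_convexHull (mem_tets.1 hT).1 (mem_tets.1 hT').1 ⟨hx, hx'⟩
  rwa [hull, Finset.coe_inter]

/-- By conformity a common point lies in the hull of the common vertices, where the coordinates of
all other vertices vanish. A positive coordinate therefore identifies a shared vertex. -/
theorem TetMesh.mem_of_bary_pos (hT : T ∈ M.tets) (hT' : T' ∈ M.tets) (hx : x ∈ hull T)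
    (hx' : x ∈ hull T') (hpos : 0 < bary T a x) : a ∈ T' := by
  classical
  by_contra h
  have := bary_eq_zero_of_mem_hull (isTet hT) Finset.inter_subset_left
    (fun h' => h (Finset.mem_inter.1 h').2) (mem_hull_inter hT hT' hx hx')
  exact hpos.ne' this

/-- The barycentric coordinates are thus global, single-valued functions on the mesh, which makes
bubbles continuous across faces. -/
theorem TetMesh.bary_eq (hT : T ∈ M.tets) (hT' : T' ∈ M.tets) (hx : x ∈ hull T)
    (hx' : x ∈ hull T') (a : E3) : bary T a x = bary T' a x := by
  classical
  have h := mem_hull_inter hT hT' hx hx'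
  by_cases ha : a ∈ T ∩ T'
  · exact bary_congr (isTet hT) (isTet hT') Finset.inter_subset_left Finset.inter_subset_right ha h
  · rw [bary_eq_zero_of_mem_hull (isTet hT) Finset.inter_subset_left ha h,
      bary_eq_zero_of_mem_hull (isTet hT') Finset.inter_subset_right ha h]

/-- At an interior point all four coordinates are positive, so all four vertices are shared. -/
theorem TetMesh.eq_of_mem_interior (hT : T ∈ M.tets) (hT' : T' ∈ M.tets)
    (hx : x ∈ interior (hull T)) (hx' : x ∈ hull T') : T = T' := by
  refine Finset.eq_of_subset_of_card_le (fun a ha => ?_) ?_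
  · exact mem_of_bary_pos hT hT' (interior_subset hx) hx' ((mem_interior_hull_iff (isTet hT)).1 hx a ha)
  · rw [(isTet hT).card_eq, (isTet hT').card_eq]

theorem TetMesh.disjoint_interior (hT : T ∈ M.tets) (hT' : T' ∈ M.tets) (h : T ≠ T') :
    Disjoint (interior (hull T)) (interior (hull T')) :=
  Set.disjoint_left.2 fun _ hx hx' => h (eq_of_mem_interior hT hT' hx (interior_subset hx'))

/-- Near a point, only the tetrahedra that contain it are met. -/
theorem eventually_mem_hull_imp (S : Finset (Finset E3)) (x : E3) :
    ∀ᶠ z in 𝓝 x, ∀ T ∈ S, z ∈ hull T → x ∈ hull T := by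
  rw [Filter.eventually_all_finset]
  intro T _
  by_cases hx : x ∈ hull T
  · exact Eventually.of_forall fun _ _ => hx
  · filter_upwards [(isClosed_hull T).isOpen_compl.mem_nhds hx] with z hz hz'
    exact absurd hz' hz

theorem mem_meshDomain_iff {S : Finset (Finset E3)} :
    x ∈ meshDomain S ↔ ∀ᶠ z in 𝓝 x, ∃ T ∈ S, z ∈ hull T := by
  rw [meshDomain, mem_interior_iff_mem_nhds]
  have : (⋃ T ∈ S, hull T) = {z | ∃ T ∈ S, z ∈ hull T} := by
    ext z
    simp
  rw [this]
  rfl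

theorem meshDomain_mono {S S' : Finset (Finset E3)} (h : S ⊆ S') : meshDomain S ⊆ meshDomain S' :=
  interior_mono (Set.biUnion_subset_biUnion_left h)

theorem exists_mem_hull_of_mem_meshDomain {S : Finset (Finset E3)} (hx : x ∈ meshDomain S) :
    ∃ T ∈ S, x ∈ hull T := by
  simpa using interior_subset hx

theorem interior_hull_subset_meshDomain {S : Finset (Finset E3)} (hT : T ∈ S) :
    interior (hull T) ⊆ meshDomain S :=
  interior_mono (Set.subset_biUnion_of_mem (u := fun T => hull T) hT)

open Classical in
/-- If a relative interior point of the simplex `G` is interior to the union of `S`, then so is every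
point at which the coordinates belonging to `G` are positive. -/
theorem TetMesh.mem_meshDomain_star {S : Finset (Finset E3)} (hS : S ⊆ M.tets) {T₀ G : Finset E3}
    (hT₀ : T₀ ∈ M.tets) (hG : G ⊆ T₀) {y : E3} (hyG : y ∈ hull G)
    (hypos : ∀ a ∈ G, 0 < bary T₀ a y) (hyS : y ∈ meshDomain S) (hx : x ∈ hull T₀)
    (hxpos : ∀ a ∈ G, 0 < bary T₀ a x) :
    x ∈ meshDomain (S.filter (fun T => G ⊆ T)) := by
  have hy₀ : y ∈ hull T₀ := convexHull_mono (by exact_mod_cast hG) hyG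
  have hcont : Tendsto (fun s : ℝ => AffineMap.lineMap y x s) (𝓝[>] 0) (𝓝 y) := by
    have : Continuous (fun s : ℝ => AffineMap.lineMap y x s) := by fun_prop
    have h := this.tendsto 0
    rw [AffineMap.lineMap_apply_zero] at h
    exact h.mono_left nhdsWithin_le_nhds
  -- A point of the segment from `y` to `x`, close to `y`, lies in the open mesh domain. The
  -- contraction towards `y` with factor `s` carries neighbourhoods of `x` to neighbourhoods of it.
  obtain ⟨s, hsU, hs0, hs1⟩ : ∃ s : ℝ, AffineMap.lineMap y x s ∈ meshDomain S ∧ 0 < s ∧ s < 1 := by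
    have h1 : ∀ᶠ s in 𝓝[>] (0 : ℝ), AffineMap.lineMap y x s ∈ meshDomain S :=
      hcont (isOpen_interior.mem_nhds hyS)
    have h2 : ∀ᶠ s in 𝓝[>] (0 : ℝ), s ∈ Set.Ioo (0 : ℝ) 1 := Ioo_mem_nhdsGT one_pos
    obtain ⟨s, hs⟩ := (h1.and h2).exists
    exact ⟨s, hs.1, hs.2.1, hs.2.2⟩
  set xs := AffineMap.lineMap y x s with hxs
  have hxs₀ : xs ∈ hull T₀ := by
    rw [mem_hull_iff (isTet hT₀)]
    intro a ha
    rw [hxs, affine_lineMap_eq]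
    have h1 := bary_nonneg (isTet hT₀) hy₀ a
    have h2 := bary_nonneg (isTet hT₀) hx a
    have : 0 ≤ 1 - s := by linarith
    positivity
  have hxspos : ∀ a ∈ G, 0 < bary T₀ a xs := by
    intro a ha
    rw [hxs, affine_lineMap_eq]
    have h1 := hypos a ha
    have h2 := hxpos a ha
    have : 0 < 1 - s := by linarith
    positivity
  have hcz : Tendsto (fun z : E3 => AffineMap.lineMap y z s) (𝓝 x) (𝓝 xs) := by
    have : Continuous (fun z : E3 => AffineMap.lineMap y z s) := by
      simp only [AffineMap.lineMap_apply_module]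
      fun_prop
    exact this.tendsto x
  have e1 := hcz.eventually (mem_meshDomain_iff.1 hsU)
  have e2 := hcz.eventually (eventually_mem_hull_imp S xs)
  -- The coordinates of `G` are positive at `xs`, so each tetrahedron there contains `G`; since they
  -- agree at `y` and at `xs`, they agree at `x`.
  have key : ∀ T ∈ S, xs ∈ hull T → G ⊆ T ∧ ∀ a ∈ G, 0 < bary T a x := by
    intro T hT hxT
    have hTt := hS hT
    have hGT : G ⊆ T := fun a ha => mem_of_bary_pos hT₀ hTt hxs₀ hxT (hxspos a ha)
    refine ⟨hGT, fun a ha => ?_⟩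
    have h1 := bary_eq hT₀ hTt hxs₀ hxT a
    have h2 := bary_congr (isTet hT₀) (isTet hTt) hG hGT ha hyG
    rw [hxs, affine_lineMap_eq, affine_lineMap_eq, h2] at h1
    have h3 : bary T₀ a x = bary T a x := by
      have := add_left_cancel h1
      exact mul_left_cancel₀ hs0.ne' this
    rw [← h3]
    exact hxpos a ha
  have e3 : ∀ᶠ z in 𝓝 x, ∀ T ∈ S, xs ∈ hull T → ∀ a ∈ G, 0 < bary T a z := by
    rw [Filter.eventually_all_finset]
    intro T hT
    by_cases hxT : xs ∈ hull T
    · simp only [hxT, forall_const]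
      rw [Filter.eventually_all_finset]
      intro a ha
      exact (continuous_affine (bary T a)).continuousAt.eventually
        (lt_mem_nhds ((key T hT hxT).2 a ha))
    · simp [hxT]
  rw [mem_meshDomain_iff]
  filter_upwards [e1, e2, e3] with z hz1 hz2 hz3
  obtain ⟨T, hT, hzT⟩ := hz1
  have hxT := hz2 T hT hzT
  have hTt := hS hT
  refine ⟨T, Finset.mem_filter.2 ⟨hT, (key T hT hxT).1⟩, ?_⟩
  rw [mem_hull_iff (isTet hTt)]
  intro c hc
  by_cases hcG : c ∈ G
  · exact (hz3 T hT hxT c hcG).le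
  -- The coordinate of `c` vanishes at `y`, so the contraction only multiplies it by `s` and its
  -- sign at `z` is the same.
  · have h1 := (mem_hull_iff (isTet hTt)).1 hzT c hc
    rw [affine_lineMap_eq, bary_eq_zero_of_mem_hull (isTet hTt) (key T hT hxT).1 hcG hyG,
      mul_zero, zero_add] at h1
    exact nonneg_of_mul_nonneg_right h1 hs0

end Mesh

/-! ### Shared faces -/

section Faces

variable {M : TetMesh} {T T' T₁ T₂ : Finset E3} {a b x : E3}

open Classical in
/-- The vertex of `T₁` opposite to the face shared with `T₂`. -/
theorem exists_opposite (hT : IsTet T₁) (h3 : (T₁ ∩ T₂).card = 3) :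
    ∃ d ∈ T₁, d ∉ T₂ ∧ ∀ c ∈ T₁, c ∉ T₁ ∩ T₂ → c = d := by
  have h : (T₁ \ (T₁ ∩ T₂)).card = 1 := by
    rw [Finset.card_sdiff_of_subset Finset.inter_subset_left, hT.card_eq, h3]
  obtain ⟨d, hd⟩ := Finset.card_eq_one.1 h
  have hd' : d ∈ T₁ \ (T₁ ∩ T₂) := by rw [hd]; simp
  rw [Finset.mem_sdiff, Finset.mem_inter] at hd'
  refine ⟨d, hd'.1, fun h => hd'.2 ⟨hd'.1, h⟩, fun c hc hc' => ?_⟩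
  have : c ∈ T₁ \ (T₁ ∩ T₂) := Finset.mem_sdiff.2 ⟨hc, hc'⟩
  rw [hd] at this
  simpa using this

theorem eventually_bary_pos {F : Finset E3} (h : ∀ a ∈ F, 0 < bary T a x) :
    ∀ᶠ z in 𝓝 x, ∀ a ∈ F, 0 < bary T a z := by
  rw [Filter.eventually_all_finset]
  exact fun a ha => (continuous_affine (bary T a)).continuousAt.eventually (lt_mem_nhds (h a ha))

open Classical in
/-- Two tetrahedra that share a face lie on different sides of it. -/
theorem TetMesh.bary_opposite_neg (h₁ : T₁ ∈ M.tets) (h₂ : T₂ ∈ M.tets)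
    (h3 : (T₁ ∩ T₂).card = 3) {d₁ d₂ : E3} (hd₁ : d₁ ∈ T₁)
    (hd₁' : ∀ c ∈ T₁, c ∉ T₁ ∩ T₂ → c = d₁) (hd₁n : d₁ ∉ T₂) (hd₂ : d₂ ∈ T₂) (hd₂n : d₂ ∉ T₁) :
    bary T₁ d₁ d₂ < 0 := by
  have t₁ := isTet h₁
  have t₂ := isTet h₂
  -- Otherwise a short move from a relative interior point of the face towards `d₂` would stay in
  -- `T₁`. The point reached would be common to both tetrahedra, although its coordinate at `d₂` is
  -- positive.
  by_contra! hneg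
  obtain ⟨y, hy, hpos⟩ := exists_mem_hull_pos t₁ (F := T₁ ∩ T₂) Finset.inter_subset_left
    (Finset.card_pos.1 (by omega))
  have hcont : Tendsto (fun s : ℝ => AffineMap.lineMap y d₂ s) (𝓝[>] 0) (𝓝 y) := by
    have : Continuous (fun s : ℝ => AffineMap.lineMap y d₂ s) := by fun_prop
    have h := this.tendsto 0
    rw [AffineMap.lineMap_apply_zero] at h
    exact h.mono_left nhdsWithin_le_nhds
  have e1 := hcont.eventually (eventually_bary_pos hpos)
  have e2 : ∀ᶠ s in 𝓝[>] (0 : ℝ), s ∈ Set.Ioo (0 : ℝ) 1 := Ioo_mem_nhdsGT one_pos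
  obtain ⟨s, hs1, hs2⟩ := (e1.and e2).exists
  have hy₂ : y ∈ hull T₂ := convexHull_mono (by exact_mod_cast Finset.inter_subset_right) hy
  have hz₂ : AffineMap.lineMap y d₂ s ∈ hull T₂ :=
    (convex_convexHull ℝ _).lineMap_mem hy₂ (subset_convexHull ℝ _ hd₂) ⟨hs2.1.le, hs2.2.le⟩
  have hz₁ : AffineMap.lineMap y d₂ s ∈ hull T₁ := by
    rw [mem_hull_iff t₁]
    intro c hc
    by_cases hcF : c ∈ T₁ ∩ T₂
    · exact (hs1 c hcF).le
    · have hcd := hd₁' c hc hcF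
      subst hcd
      rw [affine_lineMap_eq, bary_eq_zero_of_mem_hull t₁ Finset.inter_subset_left hcF hy, mul_zero,
        zero_add]
      exact mul_nonneg hs2.1.le hneg
  have h0 := bary_eq_zero_of_mem_hull t₂ (Finset.inter_subset_right (s₁ := T₁)) (a := d₂)
    (fun h => hd₂n (Finset.mem_inter.1 h).1) (mem_hull_inter h₁ h₂ hz₁ hz₂)
  rw [affine_lineMap_eq, bary_self t₂ hd₂, bary_eq_zero_of_mem_hull t₂ Finset.inter_subset_right
    (fun h => hd₂n (Finset.mem_inter.1 h).1) hy] at h0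
  linarith [hs2.1]

open Classical in
-- Near a relative interior point of the shared face one of the two tetrahedra always applies,
-- according to the sign of the coordinate opposite to the face. `mem_meshDomain_star` carries this
-- over to all points at which the coordinates of the face are positive.
theorem TetMesh.mem_meshDomain_pair (h₁ : T₁ ∈ M.tets) (h₂ : T₂ ∈ M.tets)
    (h3 : (T₁ ∩ T₂).card = 3) (hx : x ∈ hull T₁)
    (hpos : ∀ a ∈ T₁ ∩ T₂, 0 < bary T₁ a x) : x ∈ meshDomain {T₁, T₂} := by
  have t₁ := isTet h₁
  have t₂ := isTet h₂
  obtain ⟨d₁, hd₁, hd₁n, hd₁'⟩ := exists_opposite t₁ h3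
  obtain ⟨d₂, hd₂, hd₂n, hd₂'⟩ := exists_opposite t₂ (by rwa [Finset.inter_comm] : (T₂ ∩ T₁).card = 3)
  have hneg := bary_opposite_neg h₁ h₂ h3 hd₁ hd₁' hd₁n hd₂ hd₂n
  obtain ⟨y, hy, hypos⟩ := exists_mem_hull_pos t₁ (F := T₁ ∩ T₂) Finset.inter_subset_left
    (Finset.card_pos.1 (by omega))
  have hypos₂ : ∀ a ∈ T₁ ∩ T₂, 0 < bary T₂ a y := fun a ha => by
    rw [← bary_congr t₁ t₂ Finset.inter_subset_left Finset.inter_subset_right ha hy]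
    exact hypos a ha
  have hyS : y ∈ meshDomain {T₁, T₂} := by
    rw [mem_meshDomain_iff]
    filter_upwards [eventually_bary_pos hypos, eventually_bary_pos hypos₂] with z hz₁ hz₂
    rcases le_or_gt 0 (bary T₁ d₁ z) with h | h
    · refine ⟨T₁, by simp, (mem_hull_iff t₁).2 fun c hc => ?_⟩
      by_cases hcF : c ∈ T₁ ∩ T₂
      · exact (hz₁ c hcF).le
      · rwa [hd₁' c hc hcF]
    · refine ⟨T₂, by simp, (mem_hull_iff t₂).2 fun c hc => ?_⟩
      by_cases hcF : c ∈ T₁ ∩ T₂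
      · exact (hz₂ c hcF).le
      · rw [hd₂' c hc (by rwa [Finset.inter_comm])]
        -- The coordinate of `d₁` vanishes at the shared vertices, so it is a negative multiple of
        -- the coordinate of `d₂`.
        have e : bary T₁ d₁ z = bary T₂ d₂ z * bary T₁ d₁ d₂ := by
          rw [affine_eq_sum_bary t₂ (bary T₁ d₁) z, Finset.sum_eq_single d₂]
          · intro b hb hbd
            have hb1 : b ∈ T₁ := by
              by_contra hb1
              exact hbd (hd₂' b hb fun h => hb1 (Finset.mem_inter.1 h).2)
            rw [bary_of_ne t₁ hb1 (by rintro rfl; exact hd₁n hb), mul_zero]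
          · exact fun h => absurd hd₂ h
        rw [e] at h
        by_contra! hc0
        nlinarith
  exact meshDomain_mono (Finset.filter_subset _ _) (mem_meshDomain_star (S := {T₁, T₂})
    (by intro T hT; simp at hT; rcases hT with rfl | rfl <;> assumption)
    h₁ Finset.inter_subset_left hy hypos hyS hx hpos)

open Classical in
/-- A face belongs to at most two tetrahedra. -/
theorem TetMesh.eq_or_eq_of_inter_subset (h₁ : T₁ ∈ M.tets) (h₂ : T₂ ∈ M.tets)
    (h3 : (T₁ ∩ T₂).card = 3) (hT : T ∈ M.tets) (hF : T₁ ∩ T₂ ⊆ T) : T = T₁ ∨ T = T₂ := by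
  obtain ⟨y, hy, hypos⟩ := exists_mem_hull_pos (isTet h₁) (F := T₁ ∩ T₂) Finset.inter_subset_left
    (Finset.card_pos.1 (by omega))
  have hy₁ : y ∈ hull T₁ := convexHull_mono (by exact_mod_cast Finset.inter_subset_left) hy
  have hyT : y ∈ closure (interior (hull T)) := by
    rw [closure_interior_hull (isTet hT)]
    exact convexHull_mono (by exact_mod_cast hF) hy
  have hU := mem_meshDomain_pair h₁ h₂ h3 hy₁ hypos
  -- The interior of `T` comes arbitrarily close to `y`, around which space is covered by `T₁` and
  -- `T₂` alone.
  obtain ⟨z, hzU, hz⟩ := mem_closure_iff.1 hyT _ isOpen_interior hU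
  obtain ⟨T', hT', hzT'⟩ := exists_mem_hull_of_mem_meshDomain hzU
  simp only [Finset.mem_insert, Finset.mem_singleton] at hT'
  rcases hT' with rfl | rfl
  · exact Or.inl (eq_of_mem_interior hT h₁ hz hzT')
  · exact Or.inr (eq_of_mem_interior hT h₂ hz hzT')

end Faces

/-! ### Shape regularity -/

section Shape

variable {T : Finset E3} {a x x₀ : E3} {σ : ℝ}

theorem isBounded_hull (T : Finset E3) : Bornology.IsBounded (hull T) :=
  (isCompact_hull T).isBounded

theorem diam_hull_pos (hT : IsTet T) : 0 < Metric.diam (hull T) := by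
  obtain ⟨a, ha, b, hb, hab⟩ := Finset.one_lt_card.1 (by rw [hT.card_eq]; norm_num : 1 < T.card)
  exact (dist_pos.2 hab).trans_le (Metric.dist_le_diam_of_mem (isBounded_hull T)
    (subset_convexHull ℝ _ ha) (subset_convexHull ℝ _ hb))

theorem norm_sub_le_diam {y : E3} (hx : x ∈ hull T) (hy : y ∈ hull T) :
    ‖x - y‖ ≤ Metric.diam (hull T) := by
  rw [← dist_eq_norm]
  exact Metric.dist_le_diam_of_mem (isBounded_hull T) hx hy

theorem center_mem_hull (hT : IsTet T) (hσ : 0 < σ)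
    (hball : Metric.ball x₀ (Metric.diam (hull T) / σ) ⊆ hull T) : x₀ ∈ hull T :=
  hball (Metric.mem_ball_self (div_pos (diam_hull_pos hT) hσ))

theorem hull_subset_closedBall (hx : x₀ ∈ hull T) :
    hull T ⊆ Metric.closedBall x₀ (Metric.diam (hull T)) := fun y hy => by
  rw [mem_closedBall_iff_norm]
  exact norm_sub_le_diam hy hx

/-- This ball of half the guaranteed radius keeps a distance from the faces, so that all bubbles are
bounded below on it. -/
theorem core_subset (hT : IsTet T) (hσ : 0 < σ)
    (hball : Metric.ball x₀ (Metric.diam (hull T) / σ) ⊆ hull T) :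
    Metric.ball x₀ (1 / (2 * σ) * Metric.diam (hull T)) ⊆ hull T := by
  refine (Metric.ball_subset_ball ?_).trans hball
  have := diam_hull_pos hT
  rw [div_mul_eq_mul_div, one_mul, div_le_div_iff₀ (by positivity) hσ]
  nlinarith

/-- The barycentric coordinates are bounded below on a concentric smaller ball. -/
theorem bary_ge_of_mem_core (hT : IsTet T) (hσ : 0 < σ)
    (hball : Metric.ball x₀ (Metric.diam (hull T) / σ) ⊆ hull T)
    (hx : x ∈ Metric.ball x₀ (1 / (2 * σ) * Metric.diam (hull T))) (ha : a ∈ T) :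
    1 / (2 * σ + 1) ≤ bary T a x := by
  have hD := diam_hull_pos hT
  have hxT := core_subset hT hσ hball hx
  have haT : a ∈ hull T := subset_convexHull ℝ _ ha
  -- Moving away from the vertex `a` by this fraction of `a - x` does not leave the tetrahedron.
  -- Nonnegativity of the coordinate there reads `2 * σ * l ≥ 1 - l` for its value `l` at `x`.
  have hmem : x + (-(1 / (2 * σ))) • (a - x) ∈ hull T := by
    refine hball ?_
    rw [mem_ball_iff_norm] at hx ⊢
    have e : x + (-(1 / (2 * σ))) • (a - x) - x₀ = (x - x₀) - (1 / (2 * σ)) • (a - x) := by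
      module
    rw [e]
    refine (norm_sub_le _ _).trans_lt ?_
    rw [norm_smul, Real.norm_eq_abs, abs_of_pos (by positivity)]
    have h1 : 1 / (2 * σ) * ‖a - x‖ ≤ 1 / (2 * σ) * Metric.diam (hull T) := by
      gcongr
      exact norm_sub_le_diam haT hxT
    have h2 : Metric.diam (hull T) / σ =
        1 / (2 * σ) * Metric.diam (hull T) + 1 / (2 * σ) * Metric.diam (hull T) := by
      field_simp
      norm_num
    linarith
  have h0 := bary_nonneg hT hmem a
  rw [affine_add_smul, linear_sub, bary_self hT ha] at h0
  rw [div_le_iff₀ (by positivity)]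
  have h3 : 0 ≤ 2 * σ * (bary T a x + -(1 / (2 * σ)) * (1 - bary T a x)) := by positivity
  have h4 : 2 * σ * (bary T a x + -(1 / (2 * σ)) * (1 - bary T a x)) =
      bary T a x * (2 * σ + 1) - 1 := by
    field_simp
    ring
  linarith

/-- A coordinate stays between 0 and 1 on the inscribed ball, so its slope is at most the inverse of
the length available on either side of the centre. -/
theorem abs_bary_linear_le (hT : IsTet T) (hσ : 0 < σ)
    (hball : Metric.ball x₀ (Metric.diam (hull T) / σ) ⊆ hull T) (a t : E3) :
    |(bary T a).linear t| ≤ 2 * σ / Metric.diam (hull T) * ‖t‖ := by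
  have hD := diam_hull_pos hT
  rcases eq_or_ne t 0 with rfl | ht
  · simp
  have ht' := norm_pos_iff.2 ht
  set s : ℝ := Metric.diam (hull T) / (2 * σ) / ‖t‖ with hs
  have hs0 : 0 < s := by positivity
  have hm : ∀ r : ℝ, |r| = s → x₀ + r • t ∈ hull T := by
    intro r hr
    refine hball ?_
    rw [mem_ball_iff_norm, add_sub_cancel_left, norm_smul, Real.norm_eq_abs, hr, hs,
      div_mul_cancel₀ _ ht'.ne']
    rw [div_lt_div_iff₀ (by positivity) hσ]
    nlinarith
  have hx₀ := center_mem_hull hT hσ hball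
  have h1 := bary_nonneg hT (hm s (abs_of_pos hs0)) a
  have h2 := bary_nonneg hT (hm (-s) (by rw [abs_neg, abs_of_pos hs0])) a
  have h3 := bary_le_one hT hx₀ a
  rw [affine_add_smul] at h1 h2
  have h4 : s * |(bary T a).linear t| ≤ 1 := by
    rcases abs_cases ((bary T a).linear t) with h | h <;> rw [h.1] <;> linarith
  have h5 : 2 * σ / Metric.diam (hull T) * ‖t‖ = 1 / s := by
    rw [hs]
    field_simp
  rw [h5, le_div_iff₀ hs0]
  linarith

theorem volume_hull_le (hT : IsTet T) :
    volume.real (hull T) ≤ Metric.diam (hull T) ^ 3 * volume.real (Metric.ball (0 : E3) 1) := by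
  obtain ⟨a, ha⟩ := hT.nonempty
  have haT : a ∈ hull T := subset_convexHull ℝ _ ha
  refine (measureReal_mono (hull_subset_closedBall haT) measure_closedBall_lt_top.ne).trans ?_
  rw [Measure.addHaar_real_closedBall _ _ (diam_hull_pos hT).le]
  simp

end Shape

/-! ### The physical domain -/

section Domain

variable {M : TetMesh} {Ω : Set E3} {δ : ℝ} {T : Finset E3}

/-- A Lipschitz domain is the interior of its closure. -/
theorem IsLipschitzDomain.interior_closure_subset (h : IsLipschitzDomain Ω) :
    interior (closure Ω) ⊆ Ω := by
  intro x hx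
  by_contra hxΩ
  have hfr : x ∈ frontier Ω := by
    rw [frontier, h.1.interior_eq]
    exact ⟨interior_subset hx, hxΩ⟩
  obtain ⟨ν, g, L, hν, hg, hev⟩ := h.2.2.2 x hfr
  obtain ⟨W, hW, hWo, hxW⟩ := eventually_nhds_iff.1 hev
  -- Near `x` the closure stays weakly below the graph. A step upwards along `ν` from a point that
  -- is not strictly below would leave the closure, contradicting that `x` is interior to it.
  have hcl : ∀ y ∈ closure Ω, y ∈ W → inner ℝ ν y ≤ g (y - inner ℝ ν y • ν) := by
    intro y hy hyW
    have hcont : Continuous fun y : E3 => g (y - inner ℝ ν y • ν) :=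
      hg.continuous.comp (by fun_prop)
    have hcl' : y ∈ closure (Ω ∩ W) := by
      rw [mem_closure_iff] at hy ⊢
      intro o ho hyo
      obtain ⟨z, hz, hzΩ⟩ := hy (o ∩ W) (ho.inter hWo) ⟨hyo, hyW⟩
      exact ⟨z, hz.1, hzΩ, hz.2⟩
    refine closure_minimal (t := {y : E3 | inner ℝ ν y ≤ g (y - inner ℝ ν y • ν)}) ?_
      (isClosed_le (by fun_prop) hcont) hcl'
    exact fun z hz => ((hW z hz.2).1 hz.1).le
  have hxge : g (x - inner ℝ ν x • ν) ≤ inner ℝ ν x :=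
    not_lt.1 fun hlt => hxΩ ((hW x hxW).2 hlt)
  have hcont : Tendsto (fun s : ℝ => x + s • ν) (𝓝[>] 0) (𝓝 x) := by
    have : Continuous (fun s : ℝ => x + s • ν) := by fun_prop
    have h := this.tendsto 0
    simp only [zero_smul, add_zero] at h
    exact h.mono_left nhdsWithin_le_nhds
  have e1 : ∀ᶠ s in 𝓝[>] (0 : ℝ), x + s • ν ∈ W := hcont (hWo.mem_nhds hxW)
  have e2 : ∀ᶠ s in 𝓝[>] (0 : ℝ), x + s • ν ∈ closure Ω := hcont (mem_interior_iff_mem_nhds.1 hx)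
  obtain ⟨s, ⟨hs1, hs2⟩, hs0⟩ := ((e1.and e2).and self_mem_nhdsWithin).exists
  have h1 := hcl _ hs2 hs1
  have e : inner ℝ ν (x + s • ν) = inner ℝ ν x + s := by
    rw [inner_add_right, inner_smul_right, real_inner_self_eq_norm_sq, hν]
    ring
  rw [e] at h1
  have e2 : x + s • ν - (inner ℝ ν x + s) • ν = x - inner ℝ ν x • ν := by module
  rw [e2] at h1
  have : (0 : ℝ) < s := hs0
  linarith

open Classical in
theorem TetMesh.inner_subset_active : M.inner Ω δ ⊆ M.active Ω δ := Finset.filter_subset _ _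

open Classical in
theorem TetMesh.active_subset_tets : M.active Ω δ ⊆ M.tets := Finset.filter_subset _ _

theorem TetMesh.inner_subset_tets : M.inner Ω δ ⊆ M.tets :=
  inner_subset_active.trans active_subset_tets

open Classical in
theorem TetMesh.interior_hull_subset (hT : T ∈ M.inner Ω δ) : interior (hull T) ⊆ Ω :=
  (Finset.mem_filter.1 hT).2

/-- The union of the interior tetrahedra lies in the closure of `Ω`. The Lipschitz boundary is
needed here to exclude slits of `Ω` along mesh faces. -/
theorem TetMesh.meshDomain_inner_subset (h : IsLipschitzDomain Ω) :
    meshDomain (M.inner Ω δ) ⊆ Ω := by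
  refine (interior_mono (Set.iUnion₂_subset fun T hT => ?_)).trans h.interior_closure_subset
  rw [← closure_interior_hull (isTet (inner_subset_tets hT))]
  exact closure_mono (interior_hull_subset hT)

theorem TetMesh.diam_le_h (hT : T ∈ M.tets) : Metric.diam (hull T) ≤ M.h :=
  le_ciSup (f := fun T : M.tets => Metric.diam (hull (T : Finset E3))) (Set.finite_range _).bddAbove
    ⟨T, hT⟩

theorem TetMesh.h_pos (hT : T ∈ M.tets) : 0 < M.h :=
  (diam_hull_pos (isTet hT)).trans_le (diam_le_h hT)

end Domain

/-! ### Integration by parts on a patch of tetrahedra -/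

/-- A function on the line that is pointwise Lipschitz with constant `K` is Lipschitz. -/
theorem abs_sub_le_of_eventually_le {f : ℝ → ℝ} {K : ℝ}
    (h : ∀ s, ∀ᶠ z in 𝓝 s, |f z - f s| ≤ K * |z - s|) (a b : ℝ) : |f b - f a| ≤ K * |b - a| := by
  have hcont : ∀ s, ContinuousAt f s := by
    intro s
    refine tendsto_iff_norm_sub_tendsto_zero.2 ?_
    have h0 : Tendsto (fun z => K * |z - s|) (𝓝 s) (𝓝 0) := by
      have : Continuous fun z => K * |z - s| := by fun_prop
      simpa using this.tendsto s
    exact squeeze_zero' (Eventually.of_forall fun _ => norm_nonneg _) (h s) h0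
  -- Upper growth estimate by comparing right difference quotients with the slope `K`; applied to
  -- `f` and `-f` it gives both signs.
  have main : ∀ g : ℝ → ℝ, (∀ s, ContinuousAt g s) →
      (∀ s, ∀ᶠ z in 𝓝 s, |g z - g s| ≤ K * |z - s|) → ∀ a b, a ≤ b → g b ≤ g a + K * (b - a) := by
    intro g hg hl a b hab
    refine image_le_of_liminf_slope_right_le_deriv_boundary (f := g) (a := a) (b := b)
      (B := fun z => g a + K * (z - a)) (B' := fun _ => K)
      (fun s _ => (hg s).continuousWithinAt) (by simp) (by fun_prop) ?_ ?_ ⟨hab, le_rfl⟩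
    · intro x _
      have : HasDerivAt (fun z => g a + K * (z - a)) (K * 1) x :=
        (((hasDerivAt_id x).sub_const a).const_mul K).const_add (g a)
      rw [mul_one] at this
      exact this.hasDerivWithinAt
    · intro x _ r hr
      refine Eventually.frequently ?_
      have h1 : ∀ᶠ z in 𝓝[>] x, |g z - g x| ≤ K * |z - x| := nhdsWithin_le_nhds (hl x)
      filter_upwards [h1, self_mem_nhdsWithin] with z hz hzx
      have hzx' : 0 < z - x := sub_pos.2 hzx
      rw [slope_def_field]
      refine lt_of_le_of_lt ?_ hr
      rw [div_le_iff₀ hzx']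
      rw [abs_of_pos hzx'] at hz
      exact (le_abs_self _).trans hz
  have main' : ∀ a b, a ≤ b → |f b - f a| ≤ K * |b - a| := by
    intro a b hab
    have h1 := main f hcont h a b hab
    have h2 := main (fun z => -f z) (fun s => (hcont s).neg) (fun s => by
      filter_upwards [h s] with z hz
      rw [← abs_neg]
      convert hz using 2
      ring) a b hab
    rw [abs_of_nonneg (sub_nonneg.2 hab), abs_le]
    constructor <;> linarith
  rcases le_total a b with hab | hab
  · exact main' a b hab
  · rw [abs_sub_comm, abs_sub_comm b]
    exact main' b a hab

theorem ae_mem_interior_or_notMem (S : Finset (Finset E3)) :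
    ∀ᵐ x : E3, ∀ T ∈ S, x ∈ hull T → x ∈ interior (hull T) := by
  have h := (MeasureTheory.ae_ball_iff (μ := (volume : Measure E3)) S.countable_toSet
    (p := fun x T _ => x ∈ hull T → x ∈ interior (hull T))).2 ?_
  · exact h
  intro T _
  rw [ae_iff]
  convert volume_hull_diff_interior T using 2
  ext x
  simp

open Classical in
/-- A function given by `f T` on the tetrahedra `T ∈ S` and by zero elsewhere. -/
def glue {F : Type*} [Zero F] (S : Finset (Finset E3)) (f : Finset E3 → E3 → F) (x : E3) : F :=
  if h : ∃ T ∈ S, x ∈ hull T then f h.choose x else 0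

section Glue

variable {F : Type*} [Zero F] {S : Finset (Finset E3)} {f : Finset E3 → E3 → F} {T : Finset E3}
  {x : E3}

theorem glue_eq (hT : T ∈ S) (hx : x ∈ hull T)
    (hcompat : ∀ T' ∈ S, x ∈ hull T' → f T' x = f T x) : glue S f x = f T x := by
  have h : ∃ T ∈ S, x ∈ hull T := ⟨T, hT, hx⟩
  rw [glue, dif_pos h]
  exact hcompat _ h.choose_spec.1 h.choose_spec.2

theorem glue_eq_zero (h : ∀ T ∈ S, x ∉ hull T) : glue S f x = 0 := by
  rw [glue, dif_neg]
  rintro ⟨T, hT, hx⟩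
  exact h T hT hx

end Glue

/-- The total directional derivative of a compatible family of functions on finitely many tetrahedra
vanishes if the glued function is continuous along lines. -/
theorem sum_integral_fderiv_eq_zero (S : Finset (Finset E3))
    (hdisj : ∀ T ∈ S, ∀ T' ∈ S, T ≠ T' → Disjoint (interior (hull T)) (interior (hull T')))
    (f : Finset E3 → E3 → ℝ) (hf : ∀ T ∈ S, ContDiff ℝ 1 (f T))
    (hcompat : ∀ T ∈ S, ∀ T' ∈ S, ∀ x ∈ hull T, x ∈ hull T' → f T' x = f T x) (t : E3)
    (hline : ∀ T ∈ S, ∀ x ∈ hull T, f T x ≠ 0 → ∀ᶠ s in 𝓝 (0 : ℝ), ∃ T' ∈ S, x + s • t ∈ hull T') :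
    ∑ T ∈ S, ∫ x in hull T, fderiv ℝ (f T) x t = 0 := by
  set F : E3 → ℝ := glue S f with hF
  have hFT : ∀ T ∈ S, ∀ x ∈ hull T, F x = f T x := fun T hT x hx =>
    glue_eq hT hx fun T' hT' hx' => hcompat T hT T' hT' x hx hx'
  have hF0 : ∀ x, (∀ T ∈ S, x ∉ hull T) → F x = 0 := fun x hx => glue_eq_zero hx
  have hdc : ∀ T ∈ S, Continuous fun x => fderiv ℝ (f T) x := fun T hT =>
    (hf T hT).continuous_fderiv one_ne_zero
  choose! C hC using fun T (hT : T ∈ S) =>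
    (isCompact_hull T).exists_bound_of_continuousOn (hdc T hT).continuousOn
  set K : ℝ := ∑ T ∈ S, |C T| * ‖t‖ with hK
  have hK0 : 0 ≤ K := Finset.sum_nonneg fun T _ => by positivity
  have hCK : ∀ T ∈ S, C T * ‖t‖ ≤ K := fun T hT =>
    (mul_le_mul_of_nonneg_right (le_abs_self _) (norm_nonneg _)).trans
      (Finset.single_le_sum (f := fun T => |C T| * ‖t‖) (fun T _ => by positivity) hT)
  -- Lipschitz continuity along lines in the direction `t`
  have hlip : ∀ x : E3, ∀ a b : ℝ, |F (x + b • t) - F (x + a • t)| ≤ K * |b - a| := by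
    intro x
    refine abs_sub_le_of_eventually_le fun s => ?_
    have hc : Tendsto (fun z : ℝ => x + z • t) (𝓝 s) (𝓝 (x + s • t)) := by
      have : Continuous fun z : ℝ => x + z • t := by fun_prop
      exact this.tendsto s
    have e1 := hc.eventually (eventually_mem_hull_imp S (x + s • t))
    have e2 : F (x + s • t) ≠ 0 → ∀ᶠ z in 𝓝 s, ∃ T' ∈ S, x + z • t ∈ hull T' := by
      intro hne
      obtain ⟨T, hT, hxT⟩ : ∃ T ∈ S, x + s • t ∈ hull T := by
        by_contra! hcon
        exact hne (hF0 _ hcon)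
      rw [hFT T hT _ hxT] at hne
      have h0 := hline T hT _ hxT hne
      have hsub : Tendsto (fun z : ℝ => z - s) (𝓝 s) (𝓝 0) := by
        have : Continuous fun z : ℝ => z - s := by fun_prop
        simpa using this.tendsto s
      filter_upwards [hsub.eventually h0] with z hz
      convert hz using 4
      module
    have e2' : ∀ᶠ z in 𝓝 s, F (x + s • t) ≠ 0 → ∃ T' ∈ S, x + z • t ∈ hull T' := by
      by_cases hne : F (x + s • t) = 0
      · simp [hne]
      · filter_upwards [e2 hne] with z hz _ using hz
    filter_upwards [e1, e2'] with z hz1 hz2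
    by_cases hz : ∃ T ∈ S, x + z • t ∈ hull T
    · obtain ⟨T, hT, hzT⟩ := hz
      have hsT := hz1 T hT hzT
      rw [hFT T hT _ hzT, hFT T hT _ hsT]
      have := (convex_convexHull ℝ (T : Set E3)).norm_image_sub_le_of_norm_fderiv_le (𝕜 := ℝ)
        (f := f T) (C := C T) (fun y _ => ((hf T hT).differentiable one_ne_zero) y) (hC T hT) hsT hzT
      rw [← Real.norm_eq_abs]
      refine this.trans ?_
      have e : x + z • t - (x + s • t) = (z - s) • t := by module
      rw [e, norm_smul, Real.norm_eq_abs]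
      calc C T * (|z - s| * ‖t‖) = C T * ‖t‖ * |z - s| := by ring
        _ ≤ K * |z - s| := mul_le_mul_of_nonneg_right (hCK T hT) (abs_nonneg _)
    -- The line is outside the union here, so `hline` forces `F` to vanish at the base point: `F`
    -- cannot jump where the line leaves the union.
    · push Not at hz
      have h0 : F (x + s • t) = 0 := by
        by_contra hne
        obtain ⟨T, hT, hzT⟩ := hz2 hne
        exact hz T hT hzT
      rw [hF0 _ hz, h0]
      simpa using mul_nonneg hK0 (abs_nonneg _)
  -- the derivative
  set F' : E3 → ℝ := fun x => ∑ T ∈ S, (interior (hull T)).indicator (fun x => fderiv ℝ (f T) x t) x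
    with hF'
  have hFsum : F =ᵐ[volume] fun x => ∑ T ∈ S, (interior (hull T)).indicator (f T) x := by
    filter_upwards [ae_mem_interior_or_notMem S] with x hx
    by_cases h : ∃ T ∈ S, x ∈ hull T
    · obtain ⟨T, hT, hxT⟩ := h
      rw [Finset.sum_eq_single T, Set.indicator_of_mem (hx T hT hxT), hFT T hT x hxT]
      · intro T' hT' hne
        refine Set.indicator_of_notMem (fun hx' => ?_) _
        exact Set.disjoint_left.1 (hdisj T hT T' hT' hne.symm) (hx T hT hxT) hx'
      · exact fun h => absurd hT h
    · push Not at h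
      rw [hF0 x h]
      refine (Finset.sum_eq_zero fun T hT => Set.indicator_of_notMem (fun hx' => ?_) _).symm
      exact h T hT (interior_subset hx')
  have hFint : Integrable F volume := by
    refine Integrable.congr ?_ hFsum.symm
    refine integrable_finsetSum _ fun T hT => ?_
    rw [integrable_indicator_iff isOpen_interior.measurableSet]
    exact ((hf T hT).continuous.continuousOn.integrableOn_compact (isCompact_hull T)).mono_set
      interior_subset
  have hF'int : ∀ T ∈ S, Integrable
      ((interior (hull T)).indicator (fun x => fderiv ℝ (f T) x t)) volume := by
    intro T hT
    rw [integrable_indicator_iff isOpen_interior.measurableSet]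
    exact (((hdc T hT).clm_apply continuous_const).continuousOn.integrableOn_compact
      (isCompact_hull T)).mono_set interior_subset
  have hdiff : ∀ᵐ x : E3, HasDerivAt (fun s : ℝ => F (x + s • t)) (F' x) 0 := by
    filter_upwards [ae_mem_interior_or_notMem S] with x hx
    have hc : Tendsto (fun z : ℝ => x + z • t) (𝓝 0) (𝓝 x) := by
      have : Continuous fun z : ℝ => x + z • t := by fun_prop
      simpa using this.tendsto 0
    by_cases h : ∃ T ∈ S, x ∈ hull T
    · obtain ⟨T, hT, hxT⟩ := h
      have hxi := hx T hT hxT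
      have e : F' x = fderiv ℝ (f T) x t := by
        rw [hF']
        simp only
        rw [Finset.sum_eq_single T, Set.indicator_of_mem hxi]
        · intro T' hT' hne
          refine Set.indicator_of_notMem (fun hx' => ?_) _
          exact Set.disjoint_left.1 (hdisj T hT T' hT' hne.symm) hxi hx'
        · exact fun h => absurd hT h
      rw [e]
      have h1 : HasFDerivAt (f T) (fderiv ℝ (f T) x) (x + (0 : ℝ) • t) := by
        rw [zero_smul, add_zero]
        exact ((hf T hT).differentiable one_ne_zero x).hasFDerivAt
      have h2 : HasDerivAt (fun s : ℝ => x + s • t) t 0 := by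
        have h3 : HasDerivAt (fun s : ℝ => s • t) ((1 : ℝ) • t) 0 := (hasDerivAt_id 0).smul_const t
        rw [one_smul] at h3
        exact h3.const_add x
      refine (h1.comp_hasDerivAt 0 h2).congr_of_eventuallyEq ?_
      filter_upwards [hc (isOpen_interior.mem_nhds hxi)] with s hs
      exact hFT T hT _ (interior_subset hs)
    · push Not at h
      have e : F' x = 0 := Finset.sum_eq_zero fun T hT =>
        Set.indicator_of_notMem (fun hx' => h T hT (interior_subset hx')) _
      rw [e]
      refine (hasDerivAt_const (0 : ℝ) (0 : ℝ)).congr_of_eventuallyEq ?_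
      filter_upwards [hc.eventually (eventually_mem_hull_imp S x)] with s hs
      exact hF0 _ fun T hT hs' => h T hT (hs T hT hs')
  obtain ⟨R, hR⟩ : ∃ R, ∀ T ∈ S, hull T ⊆ Metric.closedBall (0 : E3) R := by
    have : Bornology.IsBounded (⋃ T ∈ S, hull T) :=
      (Bornology.isBounded_biUnion_finset S).2 fun T _ => isBounded_hull T
    obtain ⟨R, hR⟩ := this.subset_closedBall 0
    exact ⟨R, fun T hT => (Set.subset_biUnion_of_mem (u := fun T => hull T) hT).trans hR⟩
  -- Differentiation under the integral sign. The Lipschitz constant along lines serves as bound on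
  -- a ball of radius `R + ‖t‖`, outside of which all translates with `|s| < 1` vanish.
  have hder := hasDerivAt_integral_of_dominated_loc_of_lip (𝕜 := ℝ) (μ := (volume : Measure E3))
    (F := fun (s : ℝ) (x : E3) => F (x + s • t)) (x₀ := 0) (s := Metric.ball (0 : ℝ) 1)
    (bound := (Metric.closedBall (0 : E3) (R + ‖t‖)).indicator fun _ => K) (F' := F')
    (Metric.ball_mem_nhds _ one_pos)
    (Eventually.of_forall fun s => (hFint.comp_add_right (s • t)).aestronglyMeasurable)
    (hFint.comp_add_right ((0 : ℝ) • t))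
    (integrable_finsetSum _ hF'int).aestronglyMeasurable ?_ ?_ hdiff
  -- By translation invariance the integral does not depend on `s`, so its derivative, the sum in
  -- question, is zero.
  · have hconst : (fun s : ℝ => ∫ x, F (x + s • t)) = fun _ => ∫ x, F x := by
      funext s
      exact integral_add_right_eq_self F (s • t)
    have h0 := hder.2
    rw [hconst] at h0
    have h1 := h0.unique (hasDerivAt_const _ _)
    rw [hF', integral_finsetSum _ hF'int] at h1
    rw [← h1]
    refine Finset.sum_congr rfl fun T hT => ?_
    rw [integral_indicator isOpen_interior.measurableSet]
    exact setIntegral_congr_set (interior_hull_ae_eq T).symm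
  · refine ae_of_all _ fun x => LipschitzOnWith.of_dist_le_mul fun a ha b hb => ?_
    by_cases hx : x ∈ Metric.closedBall (0 : E3) (R + ‖t‖)
    · rw [Set.indicator_of_mem hx, Real.dist_eq, Real.dist_eq]
      simpa [abs_of_nonneg hK0] using hlip x b a
    · have hz : ∀ s ∈ Metric.ball (0 : ℝ) 1, F (x + s • t) = 0 := by
        intro s hs
        refine hF0 _ fun T hT hxs => hx ?_
        have h1 := hR T hT hxs
        rw [mem_closedBall_zero_iff] at h1 ⊢
        rw [mem_ball_zero_iff] at hs
        have e : x = (x + s • t) - s • t := by abel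
        rw [e]
        refine (norm_sub_le _ _).trans (add_le_add h1 ?_)
        rw [norm_smul]
        exact mul_le_of_le_one_left (norm_nonneg _) hs.le
      rw [hz a ha, hz b hb, dist_self]
      positivity
  · rw [integrable_indicator_iff Metric.isClosed_closedBall.measurableSet]
    exact integrableOn_const measure_closedBall_lt_top.ne

/-! ### Bubble functions -/

/-- The product of the barycentric coordinates that belong to the vertices in `J`. -/
def bubble (T J : Finset E3) (x : E3) : ℝ := ∏ c ∈ J, bary T c x

section Bubble

variable {T J : Finset E3} {a b x : E3}

theorem isPoly_bubble (T J : Finset E3) : IsPoly J.card (bubble T J) := by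
  have := IsPoly.prod J (k := fun _ => 1) (f := fun c x => bary T c x) fun c _ => isPoly_affine _
  simp only [Finset.sum_const, smul_eq_mul, mul_one] at this
  exact this

theorem bubble_nonneg (hT : IsTet T) (hx : x ∈ hull T) : 0 ≤ bubble T J x :=
  Finset.prod_nonneg fun c _ => bary_nonneg hT hx c

theorem bubble_le_one (hT : IsTet T) (hx : x ∈ hull T) : bubble T J x ≤ 1 :=
  Finset.prod_le_one (fun c _ => bary_nonneg hT hx c) fun c _ => bary_le_one hT hx c

theorem bary_pos_of_bubble_ne_zero (hT : IsTet T) (hx : x ∈ hull T) (h : bubble T J x ≠ 0) :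
    ∀ c ∈ J, 0 < bary T c x := fun c hc =>
  lt_of_le_of_ne (bary_nonneg hT hx c) fun h0 => h (Finset.prod_eq_zero hc h0.symm)

/-- A bubble depends on the vertex set `J` only, so its pieces on neighbouring tetrahedra fit
together. -/
theorem TetMesh.bubble_eq {M : TetMesh} {T' : Finset E3} (hT : T ∈ M.tets) (hT' : T' ∈ M.tets)
    (hx : x ∈ hull T) (hx' : x ∈ hull T') (J : Finset E3) : bubble T J x = bubble T' J x :=
  Finset.prod_congr rfl fun c _ => bary_eq hT hT' hx hx' c

/-- Integration by parts in the direction of an edge, against a bubble that vanishes on the faces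
not containing the edge. -/
theorem integral_fderiv_bubble_mul (hT : IsTet T) (ha : a ∈ J) (hb : b ∈ J) (hJ : J ⊆ T) {G : E3 → ℝ}
    (hG : ContDiff ℝ 1 G) :
    ∫ x in hull T, fderiv ℝ (fun x => bubble T J x * G x) x (b - a) = 0 := by
  have h := sum_integral_fderiv_eq_zero {T} (by simp +contextual)
    (fun T x => bubble T J x * G x) (by
      intro T' hT'
      exact (isPoly_bubble _ _).contDiff.mul hG) (by simp +contextual) (b - a) ?_
  · simpa using h
  · intro T' hT' x hx hne
    rw [Finset.mem_singleton] at hT'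
    subst hT'
    have hpos := bary_pos_of_bubble_ne_zero hT hx (left_ne_zero_of_mul hne)
    have hc : Tendsto (fun s : ℝ => x + s • (b - a)) (𝓝 0) (𝓝 x) := by
      have : Continuous fun s : ℝ => x + s • (b - a) := by fun_prop
      simpa using this.tendsto 0
    filter_upwards [hc.eventually (eventually_bary_pos hpos)] with s hs
    refine ⟨T', by simp, (mem_hull_iff hT).2 fun c hcT => ?_⟩
    by_cases hcJ : c ∈ J
    · exact (hs c hcJ).le
    -- A move along the edge changes only the coordinates of `a` and `b`. The others, which may be
    -- zero, are kept.
    · rw [affine_add_smul, linear_sub, bary_of_ne hT (hJ hb) (by rintro rfl; exact hcJ hb),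
        bary_of_ne hT (hJ ha) (by rintro rfl; exact hcJ ha)]
      simpa using bary_nonneg hT hx c

open Classical in
/-- The face bubble of a shared face has vanishing total derivative. -/
theorem TetMesh.integral_fderiv_face_bubble {M : TetMesh} {T₁ T₂ : Finset E3} (h₁ : T₁ ∈ M.tets)
    (h₂ : T₂ ∈ M.tets) (hne : T₁ ≠ T₂) (h3 : (T₁ ∩ T₂).card = 3) (t : E3) :
    (∫ x in hull T₁, fderiv ℝ (bubble T₁ (T₁ ∩ T₂)) x t) +
      ∫ x in hull T₂, fderiv ℝ (bubble T₂ (T₁ ∩ T₂)) x t = 0 := by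
  have hm : ∀ T ∈ ({T₁, T₂} : Finset (Finset E3)), T ∈ M.tets := by
    intro T hT
    simp only [Finset.mem_insert, Finset.mem_singleton] at hT
    rcases hT with rfl | rfl <;> assumption
  have h := sum_integral_fderiv_eq_zero {T₁, T₂}
    (fun T hT T' hT' h => disjoint_interior (hm T hT) (hm T' hT') h)
    (fun T => bubble T (T₁ ∩ T₂)) (fun T _ => (isPoly_bubble _ _).contDiff)
    (fun T hT T' hT' x hx hx' => bubble_eq (hm T' hT') (hm T hT) hx' hx _) t ?_
  · rwa [Finset.sum_pair hne] at h
  · intro T hT x hx hne0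
    have hpos := bary_pos_of_bubble_ne_zero (isTet (hm T hT)) hx hne0
    have hU : x ∈ meshDomain {T₁, T₂} := by
      simp only [Finset.mem_insert, Finset.mem_singleton] at hT
      rcases hT with rfl | rfl
      · exact mem_meshDomain_pair h₁ h₂ h3 hx hpos
      · rw [Finset.pair_comm]
        rw [Finset.inter_comm] at h3 hpos
        exact mem_meshDomain_pair h₂ h₁ h3 hx hpos
    have hc : Tendsto (fun s : ℝ => x + s • t) (𝓝 0) (𝓝 x) := by
      have : Continuous fun s : ℝ => x + s • t := by fun_prop
      simpa using this.tendsto 0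
    exact hc.eventually (mem_meshDomain_iff.1 hU)

end Bubble

/-! ### Area of the faces -/

section Area

/-- The area of a triangle is at most a constant times the square of its diameter. -/
theorem exists_area_triangle_le : ∃ C : ℝ≥0, ∀ (F : Finset E3) (D : ℝ), F.card = 3 →
    (∀ x ∈ F, ∀ y ∈ F, ‖x - y‖ ≤ D) → (μHE[2] : Measure E3) (hull F) ≤ C * ENNReal.ofReal (D ^ 2) := by
  set κ := Measure.addHaarScalarFactor (volume : Measure (EuclideanSpace ℝ (Fin 2))) μH[(2 : ℕ)]
  refine ⟨κ * 4, fun F D hF hD => ?_⟩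
  obtain ⟨a, b, c, hab, hac, hbc, rfl⟩ := Finset.card_eq_three.1 hF
  have hb : ‖b - a‖ ≤ D := hD _ (by simp) _ (by simp)
  have hc : ‖c - a‖ ≤ D := hD _ (by simp) _ (by simp)
  have hD0 : 0 ≤ D := (norm_nonneg _).trans hb
  -- The triangle lies in the image of the unit square under an affine map with Lipschitz constant
  -- `2 * D` in the maximum norm, whence the factor 4. The scalar `κ` converts between the two
  -- normalisations of Hausdorff measure.
  let g : (Fin 2 → ℝ) → E3 := fun u => a + u 0 • (b - a) + u 1 • (c - a)
  have hlip : LipschitzWith (Real.toNNReal (2 * D)) g := by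
    refine LipschitzWith.of_dist_le_mul fun u v => ?_
    rw [dist_eq_norm, Real.coe_toNNReal _ (by positivity)]
    have e : g u - g v = (u 0 - v 0) • (b - a) + (u 1 - v 1) • (c - a) := by
      simp only [g]
      module
    rw [e]
    refine (norm_add_le _ _).trans ?_
    rw [norm_smul, norm_smul]
    have h0 : ‖u 0 - v 0‖ ≤ dist u v := by
      rw [← dist_eq_norm]
      exact dist_le_pi_dist u v 0
    have h1 : ‖u 1 - v 1‖ ≤ dist u v := by
      rw [← dist_eq_norm]
      exact dist_le_pi_dist u v 1
    calc ‖u 0 - v 0‖ * ‖b - a‖ + ‖u 1 - v 1‖ * ‖c - a‖ ≤ dist u v * D + dist u v * D := by gcongr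
      _ = 2 * D * dist u v := by ring
  have hsub : hull {a, b, c} ⊆ g '' Set.Icc 0 1 := by
    intro x hx
    obtain ⟨w, hw0, hw1, rfl⟩ := Finset.mem_convexHull'.1 hx
    rw [Finset.sum_insert (by simp [hab, hac]), Finset.sum_pair hbc] at hw1 ⊢
    have ha0 := hw0 a (by simp)
    have hb0 := hw0 b (by simp)
    have hc0 := hw0 c (by simp)
    refine ⟨![w b, w c], ⟨?_, ?_⟩, ?_⟩
    · intro i
      fin_cases i <;> simpa
    · intro i
      fin_cases i <;> simp <;> linarith
    · have : w a = 1 - w b - w c := by linarith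
      simp only [g, this]
      simp only [Matrix.cons_val_zero, Matrix.cons_val_one]
      module
  have hvol : (μH[(2 : ℕ)] : Measure (Fin 2 → ℝ)) (Set.Icc 0 1) = 1 := by
    have := hausdorffMeasure_pi_real (ι := Fin 2)
    rw [Fintype.card_fin] at this
    rw [this, Real.volume_Icc_pi]
    simp
  have h1 : (μH[(2 : ℕ)] : Measure E3) (hull {a, b, c}) ≤ ENNReal.ofReal (2 * D) ^ 2 := by
    refine (measure_mono hsub).trans ?_
    refine (hlip.hausdorffMeasure_image_le (by positivity) _).trans ?_
    rw [hvol, mul_one]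
    simp [ENNReal.ofReal]
  rw [Measure.euclideanHausdorffMeasure_def, Measure.smul_apply]
  calc κ • (μH[(2 : ℕ)] : Measure E3) (hull {a, b, c}) ≤ κ • ENNReal.ofReal (2 * D) ^ 2 := by gcongr
    _ = ((κ * 4 : ℝ≥0) : ℝ≥0∞) * ENNReal.ofReal (D ^ 2) := by
      rw [← ENNReal.ofReal_pow (by positivity), mul_pow, ENNReal.ofReal_mul (by norm_num),
        ENNReal.smul_def, smul_eq_mul, ENNReal.coe_mul, mul_assoc]
      norm_num

theorem frontier_hull_subset {T : Finset E3} (hT : IsTet T) [DecidableEq E3] :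
    frontier (hull T) ⊆ ⋃ a ∈ T, hull (T.erase a) := by
  intro x hx
  rw [frontier, (isClosed_hull T).closure_eq] at hx
  obtain ⟨hxT, hxi⟩ := hx
  rw [mem_interior_hull_iff hT] at hxi
  push Not at hxi
  obtain ⟨a, ha, hle⟩ := hxi
  have h0 : bary T a x = 0 := le_antisymm hle (bary_nonneg hT hxT a)
  refine Set.mem_biUnion (x := a) ha (Finset.mem_convexHull'.2 ⟨fun c => bary T c x, ?_, ?_, ?_⟩)
  · exact fun c _ => bary_nonneg hT hxT c
  · rw [← sum_bary hT x, ← Finset.add_sum_erase _ _ ha, h0, zero_add]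
  · conv_rhs => rw [← sum_bary_smul hT x, ← Finset.add_sum_erase _ _ ha, h0, zero_smul, zero_add]

theorem exists_area_frontier_le : ∃ C : ℝ≥0,
    (∀ T, IsTet T → (μHE[2] : Measure E3) (frontier (hull T)) ≤
      C * ENNReal.ofReal (Metric.diam (hull T) ^ 2)) ∧
    ∀ T, IsTet T → ∀ F ⊆ T, F.card = 3 → (μHE[2] : Measure E3) (hull F) ≤
      C * ENNReal.ofReal (Metric.diam (hull T) ^ 2) := by
  classical
  obtain ⟨C, hC⟩ := exists_area_triangle_le
  have h2 : ∀ T, IsTet T → ∀ F ⊆ T, F.card = 3 → (μHE[2] : Measure E3) (hull F) ≤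
      C * ENNReal.ofReal (Metric.diam (hull T) ^ 2) := fun T hT F hF h3 =>
    hC F _ h3 fun x hx y hy => norm_sub_le_diam (subset_convexHull ℝ _ (hF hx))
      (subset_convexHull ℝ _ (hF hy))
  refine ⟨4 * C, fun T hT => ?_, fun T hT F hF h3 => ?_⟩
  · refine (measure_mono (frontier_hull_subset hT)).trans ((measure_biUnion_finset_le _ _).trans ?_)
    refine (Finset.sum_le_sum fun a ha => h2 T hT (T.erase a) (Finset.erase_subset _ _)
      (by rw [Finset.card_erase_of_mem ha, hT.card_eq])).trans ?_
    rw [Finset.sum_const, hT.card_eq, nsmul_eq_mul, ENNReal.coe_mul, mul_assoc]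
    simp
  · refine (h2 T hT F hF h3).trans ?_
    gcongr
    exact le_mul_of_one_le_left zero_le (by norm_num)

end Area

/-! ### Averages and traces -/

section Trace

variable {F : Type*} [NormedAddCommGroup F] [NormedSpace ℝ F]

theorem norm_setAverage_le {s : Set E3} {g : E3 → F} {B : ℝ} (hB : 0 ≤ B) (hs : volume s < ∞)
    (h : ∀ᵐ y, y ∈ s → ‖g y‖ ≤ B) : ‖⨍ y in s, g y‖ ≤ B := by
  rw [setAverage_eq, norm_smul, norm_inv, Real.norm_eq_abs, abs_of_nonneg measureReal_nonneg]
  have h1 : ‖∫ y in s, g y‖ ≤ B * volume.real s :=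
    norm_setIntegral_le_of_norm_le_const_ae' hs h
  rcases eq_or_lt_of_le (measureReal_nonneg (μ := (volume : Measure E3)) (s := s)) with h0 | h0
  · rw [← h0]
    simpa using hB
  · rw [inv_mul_le_iff₀ h0, mul_comm]
    exact h1

/-- Bounds for averages over small balls pass to the limit; the default value zero, taken where the
limit does not exist, satisfies them too. -/
theorem norm_innerTrace_le {Ω : Set E3} {g : E3 → F} {x : E3} {B : ℝ} (hB : 0 ≤ B)
    (h : ∃ U ∈ 𝓝 x, ∀ᵐ y, y ∈ U → y ∈ Ω → ‖g y‖ ≤ B) : ‖innerTrace Ω g x‖ ≤ B := by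
  rw [innerTrace]
  split_ifs with hl
  · obtain ⟨U, hU, hae⟩ := h
    refine le_of_tendsto hl.choose_spec.norm ?_
    obtain ⟨ε, hε, hball⟩ := Metric.mem_nhds_iff.1 hU
    filter_upwards [Ioo_mem_nhdsGT hε] with r hr
    refine norm_setAverage_le hB ((measure_mono Set.inter_subset_left).trans_lt
      measure_ball_lt_top) ?_
    filter_upwards [hae] with y hy hy'
    exact hy (hball (Metric.ball_subset_ball hr.2.le hy'.1)) hy'.2
  · simpa using hB

end Trace

/-! ### Fields given by pieces on the tetrahedra -/

theorem lintegral_biUnion_finset_le' {ι : Type*} [DecidableEq ι] (S : Finset ι) (A : ι → Set E3)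
    (f : E3 → ℝ≥0∞) : ∫⁻ x in ⋃ i ∈ S, A i, f x ≤ ∑ i ∈ S, ∫⁻ x in A i, f x := by
  induction S using Finset.induction_on with
  | empty => simp
  | insert a S ha ih =>
    rw [Finset.set_biUnion_insert, Finset.sum_insert ha]
    exact (lintegral_union_le _ _ _).trans (add_le_add le_rfl ih)

theorem gradient_congr {f g : E3 → ℝ} {x : E3} (h : f =ᶠ[𝓝 x] g) : gradient f x = gradient g x := by
  rw [gradient, gradient, h.fderiv_eq]

theorem norm_gradient (f : E3 → ℝ) (x : E3) : ‖gradient f x‖ = ‖fderiv ℝ f x‖ := by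
  rw [gradient, LinearIsometryEquiv.norm_map]

/-- Smooth pieces on the interior tetrahedra that fit together to a field which is continuous in the
background domain and vanishes at the boundary of `Ω`. -/
structure Pieces (M : TetMesh) (Ω : Set E3) (δ : ℝ) (u : Finset E3 → E3 → E3) : Prop where
  smooth : ∀ T i, ContDiff ℝ 1 (fun x => u T x i)
  zero : ∀ T, T ∉ M.inner Ω δ → u T = 0
  compat : ∀ T ∈ M.tets, ∀ T' ∈ M.tets, ∀ x ∈ M.domain, x ∈ hull T → x ∈ hull T' → u T' x = u T x
  vanish : ∀ T ∈ M.inner Ω δ, ∀ x ∈ hull T, x ∉ Ω → u T x = 0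

section Pieces

variable {M : TetMesh} {Ω : Set E3} {δ : ℝ} {u : Finset E3 → E3 → E3} {T : Finset E3} {x : E3}

theorem glue_eq_of_mem_interior (hT : T ∈ M.tets) (hx : x ∈ interior (hull T)) :
    glue M.tets u x = u T x :=
  glue_eq hT (interior_subset hx) fun T' hT' hx' => by
    rw [TetMesh.eq_of_mem_interior hT hT' hx hx']

theorem Pieces.glue_eq (hu : Pieces M Ω δ u) (hT : T ∈ M.tets) (hx : x ∈ hull T)
    (hxM : x ∈ M.domain) : glue M.tets u x = u T x :=
  CutFEM.glue_eq hT hx fun T' hT' hx' => hu.compat T hT T' hT' x hxM hx hx'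

theorem Pieces.continuous (hu : Pieces M Ω δ u) (T : Finset E3) : Continuous (u T) := by
  have h : Continuous fun x => (u T x).ofLp := continuous_pi fun i => (hu.smooth T i).continuous
  exact (PiLp.continuous_toLp 2 _).comp h

theorem Pieces.continuousOn (hu : Pieces M Ω δ u) : ContinuousOn (glue M.tets u) M.domain := by
  intro x hx
  rw [ContinuousWithinAt, Metric.tendsto_nhds]
  intro ε hε
  have h1 : ∀ᶠ z in 𝓝 x, ∀ T ∈ M.tets, dist (u T z) (u T x) < ε :=
    (Filter.eventually_all_finset _).2 fun T _ =>
      Metric.tendsto_nhds.1 ((hu.continuous T).tendsto x) ε hε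
  filter_upwards [nhdsWithin_le_nhds h1, nhdsWithin_le_nhds (eventually_mem_hull_imp M.tets x),
    self_mem_nhdsWithin] with z hz1 hz2 hz3
  obtain ⟨T, hT, hzT⟩ := exists_mem_hull_of_mem_meshDomain hz3
  rw [hu.glue_eq hT hzT hz3, hu.glue_eq hT (hz2 T hT hzT) hx]
  exact hz1 T hT

theorem gradRow_glue (hT : T ∈ M.tets) (hx : x ∈ interior (hull T)) (i : Fin 3) :
    gradRow (glue M.tets u) i x = gradRow (u T) i x := by
  refine gradient_congr ?_
  filter_upwards [isOpen_interior.mem_nhds hx] with z hz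
  rw [glue_eq_of_mem_interior hT hz]

theorem divergence_glue (hT : T ∈ M.tets) (hx : x ∈ interior (hull T)) :
    divergence (glue M.tets u) x = divergence (u T) x := by
  simp only [divergence, gradRow_glue hT hx]

theorem gradRow_zero (i : Fin 3) (x : E3) : gradRow (0 : E3 → E3) i x = 0 := by
  simp [gradRow, gradient]

/-- All pieces containing a boundary point vanish there, and by continuity the field is small at
nearby points of `Ω`. This removes the boundary terms without derivatives from the norm and from the
form. -/
theorem Pieces.innerTrace_eq_zero (hu : Pieces M Ω δ u) (hΩ : IsOpen Ω) (hsub : Ω ⊆ M.domain)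
    (hx : x ∈ frontier Ω) : innerTrace Ω (glue M.tets u) x = 0 := by
  have hxΩ : x ∉ Ω := by
    rw [frontier, hΩ.interior_eq] at hx
    exact hx.2
  rw [← norm_le_zero_iff]
  refine le_of_forall_pos_le_add fun ε hε => ?_
  rw [zero_add]
  refine norm_innerTrace_le hε.le ?_
  have h0 : ∀ T ∈ M.tets, x ∈ hull T → u T x = 0 := by
    intro T _ hxT
    by_cases hTi : T ∈ M.inner Ω δ
    · exact hu.vanish T hTi x hxT hxΩ
    · rw [hu.zero T hTi]; rfl
  have h1 : ∀ᶠ z in 𝓝 x, ∀ T ∈ M.tets, dist (u T z) (u T x) < ε :=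
    (Filter.eventually_all_finset _).2 fun T _ =>
      Metric.tendsto_nhds.1 ((hu.continuous T).tendsto x) ε hε
  refine ⟨_, h1.and (eventually_mem_hull_imp M.tets x), ae_of_all _ fun y hy hyΩ => ?_⟩
  obtain ⟨T, hT, hyT⟩ := exists_mem_hull_of_mem_meshDomain (hsub hyΩ)
  rw [hu.glue_eq hT hyT (hsub hyΩ)]
  have := hy.1 T hT
  rw [h0 T hT (hy.2 T hT hyT), dist_zero_right] at this
  exact this.le

/-- The squared `L²` norm over a set covered by the mesh, from bounds on the tetrahedra. -/
theorem l2Sq_le_sum {F : Type*} [NormedAddCommGroup F] {g : E3 → F} {A : Set E3}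
    (hA : ∀ x ∈ A, ∃ T ∈ M.tets, x ∈ hull T) {B : Finset E3 → ℝ}
    (hB : ∀ T ∈ M.tets, ∀ x ∈ interior (hull T), ‖g x‖ ≤ B T) :
    l2Sq (volume.restrict A) g ≤
      ENNReal.ofReal (volume.real (Metric.ball (0 : E3) 1) * M.h ^ 3 * ∑ T ∈ M.tets, B T ^ 2) := by
  have hsub : A ⊆ ⋃ T ∈ M.tets, hull T := fun x hx => by
    obtain ⟨T, hT, hxT⟩ := hA x hx
    exact Set.mem_biUnion hT hxT
  calc l2Sq (volume.restrict A) g ≤ ∫⁻ x in ⋃ T ∈ M.tets, hull T, ‖g x‖ₑ ^ 2 :=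
        lintegral_mono_set hsub
    _ ≤ ∑ T ∈ M.tets, ∫⁻ x in hull T, ‖g x‖ₑ ^ 2 := by
        classical
        exact lintegral_biUnion_finset_le' _ _ _
    _ ≤ ∑ T ∈ M.tets, ENNReal.ofReal (volume.real (Metric.ball (0 : E3) 1) * M.h ^ 3 * B T ^ 2) := by
        refine Finset.sum_le_sum fun T hT => ?_
        have t := TetMesh.isTet hT
        rw [setLIntegral_congr (interior_hull_ae_eq T).symm]
        have h1 : ∫⁻ x in interior (hull T), ‖g x‖ₑ ^ 2 ≤
            ∫⁻ _ in interior (hull T), ENNReal.ofReal (B T ^ 2) := by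
          refine setLIntegral_mono measurable_const fun x hx => ?_
          rw [← ofReal_norm, ← ENNReal.ofReal_pow (norm_nonneg _)]
          exact ENNReal.ofReal_le_ofReal (pow_le_pow_left₀ (norm_nonneg _) (hB T hT x hx) 2)
        refine h1.trans ?_
        rw [setLIntegral_const, measure_congr (interior_hull_ae_eq T),
          ← ofReal_measureReal (isCompact_hull T).measure_lt_top.ne,
          ← ENNReal.ofReal_mul (sq_nonneg _), mul_comm (_ * _ : ℝ)]
        refine ENNReal.ofReal_le_ofReal (mul_le_mul_of_nonneg_left ?_ (sq_nonneg _))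
        refine (volume_hull_le t).trans ?_
        rw [mul_comm]
        gcongr
        exact TetMesh.diam_le_h hT
    _ = _ := by
        rw [← ENNReal.ofReal_sum_of_nonneg, Finset.mul_sum]
        intro T hT
        have := TetMesh.h_pos hT
        positivity

/-- The gradient is discontinuous, but its averages near `x` are bounded by the square root of the
sum of `B T ^ 2` over the tetrahedra containing `x`. Integrating over `Γ`, only interior tetrahedra
contribute, each with the part of its own boundary that lies on `Γ`. Hence the factor `h ^ 2`,
independent of the area of `Γ`. -/
theorem exists_trace_gradient_bound : ∃ C : ℝ, 0 ≤ C ∧ ∀ (M : TetMesh) (Ω : Set E3) (δ : ℝ)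
    (u : Finset E3 → E3 → E3), IsOpen Ω → Ω ⊆ M.domain → ∀ (B : Finset E3 → ℝ) (i : Fin 3),
    (∀ T ∈ M.tets, ∀ x ∈ interior (hull T), ‖gradRow (u T) i x‖ ≤ B T) →
    (∀ T ∈ M.tets, T ∉ M.inner Ω δ → B T = 0) →
    l2Sq (surf (frontier Ω)) (innerTrace Ω (gradRow (glue M.tets u) i)) ≤
      ENNReal.ofReal (C * M.h ^ 2 * ∑ T ∈ M.tets, B T ^ 2) := by
  classical
  obtain ⟨C, hC, -⟩ := exists_area_frontier_le
  refine ⟨C, C.2, fun M Ω δ u hΩ hsub B i hB hB0 => ?_⟩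
  have hpt : ∀ x : E3, ‖innerTrace Ω (gradRow (glue M.tets u) i) x‖ₑ ^ 2 ≤
      ∑ T ∈ M.tets, (hull T).indicator (fun _ => ENNReal.ofReal (B T ^ 2)) x := by
    intro x
    have hs0 : 0 ≤ ∑ T ∈ M.tets, (hull T).indicator (fun _ => B T ^ 2) x :=
      Finset.sum_nonneg fun T _ => Set.indicator_nonneg (fun _ _ => sq_nonneg _) x
    have h1 : ‖innerTrace Ω (gradRow (glue M.tets u) i) x‖ ≤
        Real.sqrt (∑ T ∈ M.tets, (hull T).indicator (fun _ => B T ^ 2) x) := by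
      refine norm_innerTrace_le (Real.sqrt_nonneg _) ⟨_, eventually_mem_hull_imp M.tets x, ?_⟩
      filter_upwards [ae_mem_interior_or_notMem M.tets] with y hyi hy hyΩ
      obtain ⟨T, hT, hyT⟩ := exists_mem_hull_of_mem_meshDomain (hsub hyΩ)
      rw [gradRow_glue hT (hyi T hT hyT)]
      refine (hB T hT y (hyi T hT hyT)).trans (Real.le_sqrt_of_sq_le ?_)
      have := Finset.single_le_sum (f := fun T => (hull T).indicator (fun _ => B T ^ 2) x)
        (fun T _ => Set.indicator_nonneg (fun _ _ => sq_nonneg _) x) hT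
      refine le_trans ?_ this
      rw [Set.indicator_of_mem (hy T hT hyT)]
    have h2 := pow_le_pow_left₀ (norm_nonneg _) h1 2
    rw [Real.sq_sqrt hs0] at h2
    rw [← ofReal_norm, ← ENNReal.ofReal_pow (norm_nonneg _)]
    refine (ENNReal.ofReal_le_ofReal h2).trans (le_of_eq ?_)
    rw [ENNReal.ofReal_sum_of_nonneg fun T _ => Set.indicator_nonneg (fun _ _ => sq_nonneg _) x]
    refine Finset.sum_congr rfl fun T _ => ?_
    by_cases hx : x ∈ hull T <;> simp [hx]
  calc l2Sq (surf (frontier Ω)) (innerTrace Ω (gradRow (glue M.tets u) i))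
      ≤ ∫⁻ x, ∑ T ∈ M.tets, (hull T).indicator (fun _ => ENNReal.ofReal (B T ^ 2)) x
          ∂(surf (frontier Ω)) := lintegral_mono hpt
    _ = ∑ T ∈ M.tets, ENNReal.ofReal (B T ^ 2) * surf (frontier Ω) (hull T) := by
        rw [lintegral_finsetSum _ fun T _ =>
          measurable_const.indicator (isClosed_hull T).measurableSet]
        exact Finset.sum_congr rfl fun T _ =>
          lintegral_indicator_const (isClosed_hull T).measurableSet _
    _ ≤ ∑ T ∈ M.tets, ENNReal.ofReal (C * M.h ^ 2 * B T ^ 2) := by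
        refine Finset.sum_le_sum fun T hT => ?_
        by_cases hTi : T ∈ M.inner Ω δ
        · have t := TetMesh.isTet hT
          have hm : surf (frontier Ω) (hull T) ≤ ENNReal.ofReal (C * M.h ^ 2) := by
            rw [surf, Measure.restrict_apply (isClosed_hull T).measurableSet]
            -- The interior of `T` lies in the open set `Ω` and so misses the boundary of `Ω`.
            have hsub' : hull T ∩ frontier Ω ⊆ frontier (hull T) := by
              rintro x ⟨hx, hxΩ⟩
              rw [frontier, hΩ.interior_eq] at hxΩ
              exact ⟨subset_closure hx, fun h => hxΩ.2 (TetMesh.interior_hull_subset hTi h)⟩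
            refine (measure_mono hsub').trans ((hC T t).trans ?_)
            rw [ENNReal.ofReal_mul (NNReal.coe_nonneg C), ENNReal.ofReal_coe_nnreal]
            gcongr
            exact TetMesh.diam_le_h hT
          calc _ ≤ ENNReal.ofReal (B T ^ 2) * ENNReal.ofReal (C * M.h ^ 2) := by gcongr
            _ = _ := by rw [← ENNReal.ofReal_mul (sq_nonneg _), mul_comm]
        · simp [hB0 T hT hTi]
    _ = _ := by
        rw [← ENNReal.ofReal_sum_of_nonneg, Finset.mul_sum]
        intro T _
        have := C.2
        positivity

end Pieces

/-! ### Norms and divergence form of a glued field -/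

section Assembly

variable {M : TetMesh} {Ω : Set E3} {δ : ℝ} {u : Finset E3 → E3 → E3} {T : Finset E3} {x : E3}

theorem TetMesh.h_nonneg (M : TetMesh) : 0 ≤ M.h := Real.iSup_nonneg fun _ => Metric.diam_nonneg

theorem surf_integral_eq_zero (hu : Pieces M Ω δ u) (hΩ : IsOpen Ω) (hsub : Ω ⊆ M.domain)
    (q : E3 → ℝ) : ∫ x, inner ℝ (innerTrace Ω (glue M.tets u) x) (outerNormal Ω x) *
      innerTrace Ω q x ∂(surf (frontier Ω)) = 0 := by
  refine setIntegral_eq_zero_of_forall_eq_zero fun x hx => ?_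
  rw [hu.innerTrace_eq_zero hΩ hsub hx, inner_zero_left, zero_mul]

/-- Three components over each of two domains give `6 * κ`; the weighted trace of the gradient gives
`3 * C`, its `h ^ 2` being completed to `h ^ 3` by the weight `h`. The trace of the field itself is
zero. -/
theorem exists_velocityNorm_bound : ∃ C : ℝ, 0 ≤ C ∧ ∀ (M : TetMesh) (Ω : Set E3) (δ : ℝ)
    (u : Finset E3 → E3 → E3), IsOpen Ω → Ω ⊆ M.domain → Pieces M Ω δ u → ∀ B : Finset E3 → ℝ,
    (∀ T ∈ M.tets, ∀ i, ∀ x ∈ interior (hull T), ‖gradRow (u T) i x‖ ≤ B T) →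
    (∀ T ∈ M.tets, T ∉ M.inner Ω δ → B T = 0) →
    M.velocityNorm Ω δ (glue M.tets u) ≤
      ENNReal.ofReal (C * M.h ^ 3 * ∑ T ∈ M.tets, B T ^ 2) ^ (1 / 2 : ℝ) := by
  obtain ⟨C, hC, hΓ⟩ := exists_trace_gradient_bound
  set κ := volume.real (Metric.ball (0 : E3) 1) with hκ
  have hκ0 : 0 ≤ κ := measureReal_nonneg
  refine ⟨6 * κ + 3 * C, by positivity, fun M Ω δ u hΩ hsub hu B hB hB0 => ?_⟩
  refine ENNReal.rpow_le_rpow ?_ (by norm_num)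
  have hh := M.h_nonneg
  have hS : 0 ≤ ∑ T ∈ M.tets, B T ^ 2 := Finset.sum_nonneg fun _ _ => sq_nonneg _
  have hgl : ∀ i, ∀ T ∈ M.tets, ∀ x ∈ interior (hull T),
      ‖gradRow (glue M.tets u) i x‖ ≤ B T := fun i T hT x hx => by
    rw [gradRow_glue hT hx]
    exact hB T hT i x hx
  have h1 : ∀ i, l2Sq (volume.restrict (meshDomain (M.active Ω δ))) (gradRow (glue M.tets u) i) ≤
      ENNReal.ofReal (κ * M.h ^ 3 * ∑ T ∈ M.tets, B T ^ 2) := fun i =>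
    l2Sq_le_sum (fun x hx => by
      obtain ⟨T, hT, hxT⟩ := exists_mem_hull_of_mem_meshDomain hx
      exact ⟨T, TetMesh.active_subset_tets hT, hxT⟩) (hgl i)
  have h2 : ∀ i, l2Sq (volume.restrict Ω) (gradRow (glue M.tets u) i) ≤
      ENNReal.ofReal (κ * M.h ^ 3 * ∑ T ∈ M.tets, B T ^ 2) := fun i =>
    l2Sq_le_sum (fun x hx => exists_mem_hull_of_mem_meshDomain (hsub hx)) (hgl i)
  have h3 : l2Sq (surf (frontier Ω)) (innerTrace Ω (glue M.tets u)) = 0 := by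
    rw [l2Sq, surf]
    refine setLIntegral_eq_zero isClosed_frontier.measurableSet fun x hx => ?_
    rw [hu.innerTrace_eq_zero hΩ hsub hx]
    simp
  have h4 := fun i => hΓ M Ω δ u hΩ hsub B i (fun T hT => hB T hT i) hB0
  rw [TetMesh.nitscheSq, h3, mul_zero, add_zero]
  calc _ ≤ ∑ _i : Fin 3, ENNReal.ofReal (κ * M.h ^ 3 * ∑ T ∈ M.tets, B T ^ 2) +
        (∑ _i : Fin 3, ENNReal.ofReal (κ * M.h ^ 3 * ∑ T ∈ M.tets, B T ^ 2) +
          ENNReal.ofReal M.h * ∑ _i : Fin 3, ENNReal.ofReal (C * M.h ^ 2 * ∑ T ∈ M.tets, B T ^ 2)) := by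
        gcongr with i _ i _ i _
        · exact h1 i
        · exact h2 i
        · exact h4 i
    _ = _ := by
        have e3 : ∀ y : ℝ, ∑ _i : Fin 3, ENNReal.ofReal y = ENNReal.ofReal (3 * y) := fun y => by
          rw [Finset.sum_const, ENNReal.ofReal_mul (by norm_num)]
          simp
        rw [e3, e3, ← ENNReal.ofReal_mul hh, ← ENNReal.ofReal_add (by positivity) (by positivity),
          ← ENNReal.ofReal_add (by positivity) (by positivity)]
        congr 1
        ring

theorem continuous_gradient {f : E3 → ℝ} (hf : ContDiff ℝ 1 f) : Continuous (gradient f) :=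
  (LinearIsometryEquiv.continuous _).comp (hf.continuous_fderiv one_ne_zero)

theorem Pieces.continuous_divergence (hu : Pieces M Ω δ u) (T : Finset E3) :
    Continuous (divergence (u T)) := by
  unfold divergence
  refine continuous_finsetSum _ fun i _ => ?_
  exact (PiLp.continuous_apply 2 _ i).comp (continuous_gradient (hu.smooth T i))

/-- The trace of the field is zero and its divergence vanishes almost everywhere outside the
interior tetrahedra. The cut tetrahedra therefore play no role, nor does the pressure on them. -/
theorem divForm_glue (hu : Pieces M Ω δ u) (hΩ : IsOpen Ω) (hsub : Ω ⊆ M.domain) {q : E3 → ℝ}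
    {f : Finset E3 → E3 → ℝ} (hf : ∀ T ∈ M.inner Ω δ, Continuous (f T))
    (hq : ∀ T ∈ M.inner Ω δ, Set.EqOn q (f T) (interior (hull T))) :
    divForm Ω (glue M.tets u) q =
      ∑ T ∈ M.inner Ω δ, ∫ x in hull T, divergence (u T) x * f T x := by
  rw [divForm, surf_integral_eq_zero hu hΩ hsub, sub_zero]
  have hUsub : (⋃ T ∈ M.inner Ω δ, interior (hull T)) ⊆ Ω :=
    Set.iUnion₂_subset fun T hT => TetMesh.interior_hull_subset hT
  have heq : ∀ T ∈ M.inner Ω δ, Set.EqOn (fun x => divergence (glue M.tets u) x * q x)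
      (fun x => divergence (u T) x * f T x) (interior (hull T)) := fun T hT x hx => by
    simp only
    rw [divergence_glue (TetMesh.inner_subset_tets hT) hx, hq T hT hx]
  have h1 : ∫ x in Ω, divergence (glue M.tets u) x * q x =
      ∫ x in ⋃ T ∈ M.inner Ω δ, interior (hull T), divergence (glue M.tets u) x * q x := by
    refine setIntegral_eq_of_subset_of_ae_sdiff_eq_zero hΩ.measurableSet.nullMeasurableSet hUsub ?_
    filter_upwards [ae_mem_interior_or_notMem M.tets] with x hx hxd
    obtain ⟨T, hT, hxT⟩ := exists_mem_hull_of_mem_meshDomain (hsub hxd.1)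
    have hxi := hx T hT hxT
    have hTn : T ∉ M.inner Ω δ := fun h => hxd.2 (Set.mem_biUnion h hxi)
    rw [divergence_glue hT hxi, hu.zero T hTn]
    simp [divergence, gradRow_zero]
  rw [h1, integral_biUnion_finset _ (fun T _ => isOpen_interior.measurableSet)
    (fun T hT T' hT' h => TetMesh.disjoint_interior (TetMesh.inner_subset_tets hT)
      (TetMesh.inner_subset_tets hT') h)]
  · refine Finset.sum_congr rfl fun T hT => ?_
    rw [setIntegral_congr_fun isOpen_interior.measurableSet (heq T hT)]
    exact setIntegral_congr_set (interior_hull_ae_eq T)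
  · intro T hT
    refine IntegrableOn.congr_fun ?_ (heq T hT).symm isOpen_interior.measurableSet
    exact (((hu.continuous_divergence T).mul (hf T hT)).continuousOn.integrableOn_compact
      (isCompact_hull T)).mono_set interior_subset

/-! ### Linear combinations of constant directions -/

theorem gradient_apply (f : E3 → ℝ) (x : E3) (i : Fin 3) :
    gradient f x i = fderiv ℝ f x (EuclideanSpace.single i 1) := by
  have : inner ℝ (gradient f x) (EuclideanSpace.single i (1 : ℝ)) =
      fderiv ℝ f x (EuclideanSpace.single i 1) := by
    rw [gradient, InnerProductSpace.toDual_symm_apply]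
  rw [← this, EuclideanSpace.inner_single_right]
  simp

variable {ι : Type*} {I : Finset ι} {G : ι → E3 → ℝ} {t : ι → E3}

theorem hasFDerivAt_sum_smul (hG : ∀ j ∈ I, ContDiff ℝ 1 (G j)) (i : Fin 3) (x : E3) :
    HasFDerivAt (fun y => (∑ j ∈ I, G j y • t j) i) (∑ j ∈ I, t j i • fderiv ℝ (G j) x) x := by
  have h : HasFDerivAt (fun y => ∑ j ∈ I, t j i * G j y) (∑ j ∈ I, t j i • fderiv ℝ (G j) x) x :=
    HasFDerivAt.fun_sum fun j hj =>
      (((hG j hj).differentiable one_ne_zero x).hasFDerivAt).const_mul (t j i)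
  convert h using 2
  rw [WithLp.ofLp_sum, Finset.sum_apply]
  exact Finset.sum_congr rfl fun j _ => by simp [mul_comm]

/-- For constant directions the divergence is a sum of directional derivatives, which allows
integration by parts along lines. -/
theorem divergence_sum_smul (hG : ∀ j ∈ I, ContDiff ℝ 1 (G j)) (x : E3) :
    divergence (fun y => ∑ j ∈ I, G j y • t j) x = ∑ j ∈ I, fderiv ℝ (G j) x (t j) := by
  have h1 : ∀ i, gradRow (fun y => ∑ j ∈ I, G j y • t j) i x i =
      ∑ j ∈ I, t j i * fderiv ℝ (G j) x (EuclideanSpace.single i 1) := fun i => by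
    rw [gradRow, gradient_apply, (hasFDerivAt_sum_smul hG i x).fderiv]
    simp
  rw [divergence, Finset.sum_congr rfl fun i _ => h1 i, Finset.sum_comm]
  refine Finset.sum_congr rfl fun j _ => ?_
  have h2 : t j = ∑ i, t j i • (EuclideanSpace.single i (1 : ℝ) : E3) := by
    ext k
    fin_cases k <;> simp [Fin.sum_univ_three]
  conv_rhs => rw [h2]
  simp [map_sum]

theorem norm_gradRow_sum_smul_le (hG : ∀ j ∈ I, ContDiff ℝ 1 (G j)) (i : Fin 3) (x : E3) :
    ‖gradRow (fun y => ∑ j ∈ I, G j y • t j) i x‖ ≤ ∑ j ∈ I, ‖fderiv ℝ (G j) x‖ * ‖t j‖ := by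
  rw [gradRow, norm_gradient, (hasFDerivAt_sum_smul hG i x).fderiv]
  refine (norm_sum_le _ _).trans (Finset.sum_le_sum fun j _ => ?_)
  rw [norm_smul, mul_comm]
  gcongr
  exact PiLp.norm_apply_le (t j) i

theorem contDiff_sum_smul (hG : ∀ j ∈ I, ContDiff ℝ 1 (G j)) (i : Fin 3) :
    ContDiff ℝ 1 (fun y => (∑ j ∈ I, G j y • t j) i) := by
  have h : ContDiff ℝ 1 (fun y => ∑ j ∈ I, t j i * G j y) :=
    ContDiff.sum fun j hj => contDiff_const.mul (hG j hj)
  convert h using 2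
  rw [WithLp.ofLp_sum, Finset.sum_apply]
  exact Finset.sum_congr rfl fun j _ => by simp [mul_comm]

/-! ### The rescaling argument -/

theorem Pieces.const_smul (hu : Pieces M Ω δ u) (τ : ℝ) :
    Pieces M Ω δ (fun T x => τ • u T x) where
  smooth T i := by
    simpa using contDiff_const.mul (hu.smooth T i)
  zero T hT := by
    funext x
    simp [hu.zero T hT]
  compat T hT T' hT' x hx h h' := by
    rw [hu.compat T hT T' hT' x hx h h']
  vanish T hT x hx hxΩ := by
    rw [hu.vanish T hT x hx hxΩ, smul_zero]

theorem gradRow_const_smul (hu : Pieces M Ω δ u) (τ : ℝ) (T : Finset E3) (i : Fin 3) (x : E3) :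
    gradRow (fun x => τ • u T x) i x = τ • gradRow (u T) i x := by
  have h := ((hu.smooth T i).differentiable one_ne_zero x).hasFDerivAt.const_mul τ
  have e : (fun y => (τ • u T y) i) = fun y => τ * u T y i := by
    funext y
    simp
  rw [gradRow, gradRow, gradient, gradient, e, h.fderiv, map_smul]

/-- If the pressure seminorm is controlled by the divergence form of a field, and so are the norms of
the field, then a multiple of the field satisfies the three stability conditions. -/
theorem exists_stable_const (K : ℝ) (hK : 0 ≤ K) : ∃ C : ℝ≥0,
    ∀ (M : TetMesh) (Ω : Set E3) (δ : ℝ), IsOpen Ω → Ω ⊆ M.domain →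
    ∀ (u : Finset E3 → E3 → E3), Pieces M Ω δ u → ∀ A B : Finset E3 → ℝ,
    (∀ T ∈ M.tets, ∀ x ∈ interior (hull T), ‖u T x‖ ≤ A T) →
    (∀ T ∈ M.tets, ∀ i, ∀ x ∈ interior (hull T), ‖gradRow (u T) i x‖ ≤ B T) →
    (∀ T ∈ M.tets, T ∉ M.inner Ω δ → B T = 0) →
    ∀ (q : E3 → ℝ) (f : Finset E3 → E3 → ℝ), (∀ T ∈ M.inner Ω δ, Continuous (f T)) →
    (∀ T ∈ M.inner Ω δ, Set.EqOn q (f T) (interior (hull T))) →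
    ∀ β : ℝ, 0 ≤ β → (∑ T ∈ M.inner Ω δ, ∫ x in hull T, divergence (u T) x * f T x = β) →
    M.h ^ 3 * ∑ T ∈ M.tets, A T ^ 2 ≤ K * M.h ^ 2 * β →
    M.h ^ 3 * ∑ T ∈ M.tets, B T ^ 2 ≤ K * β →
    ∀ S : Finset (Finset E3), M.pressureNorm S q ^ 2 ≤ ENNReal.ofReal (K * β) →
    ∃ τ : ℝ, M.velocityNorm Ω δ (glue M.tets fun T x => τ • u T x) ≤ C * M.pressureNorm S q ∧
      ((M.pressureNorm S q ^ 2 : ℝ≥0∞) : EReal) ≤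
        ((divForm Ω (glue M.tets fun T x => τ • u T x) q : ℝ) : EReal) ∧
      l2Sq (volume.restrict Ω) (glue M.tets fun T x => τ • u T x) ^ (1 / 2 : ℝ) ≤
        C * (ENNReal.ofReal M.h * M.pressureNorm S q) := by
  obtain ⟨C₀, hC₀, hvel⟩ := exists_velocityNorm_bound
  set κ := volume.real (Metric.ball (0 : E3) 1) with hκ
  have hκ0 : 0 ≤ κ := measureReal_nonneg
  have hc0 : 0 ≤ C₀ + κ := by positivity
  refine ⟨Real.toNNReal (Real.sqrt (C₀ + κ) * K), ?_⟩
  intro M Ω δ hΩ hsub u hu A B hA hB hB0 q f hf hq β hβ hβe hAs hBs S hP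
  set P := M.pressureNorm S q with hPdef
  have hPtop : P ≠ ∞ := fun h => by
    rw [h] at hP
    simp at hP
  set p := P.toReal with hp
  have hPp : P = ENNReal.ofReal p := (ENNReal.ofReal_toReal hPtop).symm
  have hp0 : 0 ≤ p := ENNReal.toReal_nonneg
  have hpβ : p ^ 2 ≤ K * β := by
    rw [hPp, ← ENNReal.ofReal_pow hp0] at hP
    exact (ENNReal.ofReal_le_ofReal_iff (by positivity)).1 hP
  have hh := M.h_nonneg
  have hpn : p ≤ Real.sqrt K * Real.sqrt β := by
    rw [← Real.sqrt_mul hK]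
    exact Real.le_sqrt_of_sq_le hpβ
  -- This factor balances the two requirements `τ ^ 2 * β ≤ K * p ^ 2` (norm bounds) and `p ^ 2 ≤ τ
  -- * β` (lower bound of the form). If `β = 0`, division by zero gives `τ = 0`, and `p = 0` as
  -- well.
  set τ : ℝ := Real.sqrt K * p / Real.sqrt β with hτ
  have hτβ : τ ^ 2 * β ≤ K * p ^ 2 := by
    rw [hτ, div_pow, mul_pow, Real.sq_sqrt hK, Real.sq_sqrt hβ]
    rcases hβ.eq_or_lt with h0 | h0
    · rw [← h0]
      simp only [mul_zero]
      positivity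
    · rw [div_mul_cancel₀ _ h0.ne']
  have hτp : p ^ 2 ≤ τ * β := by
    rcases hβ.eq_or_lt with h0 | h0
    · rw [← h0, mul_zero] at hpβ
      rw [← h0, mul_zero]
      exact hpβ
    · have hs := Real.sqrt_pos.2 h0
      have e : τ * β = p * (Real.sqrt K * Real.sqrt β) := by
        rw [hτ]
        nth_rewrite 2 [← Real.mul_self_sqrt hβ]
        field_simp
      rw [e, sq]
      exact mul_le_mul_of_nonneg_left hpn hp0
  have hv := hu.const_smul τ
  have hBτ : ∀ T ∈ M.tets, ∀ i, ∀ x ∈ interior (hull T),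
      ‖gradRow (fun x => τ • u T x) i x‖ ≤ |τ| * B T := fun T hT i x hx => by
    rw [gradRow_const_smul hu, norm_smul, Real.norm_eq_abs]
    exact mul_le_mul_of_nonneg_left (hB T hT i x hx) (abs_nonneg _)
  have hAτ : ∀ T ∈ M.tets, ∀ x ∈ interior (hull T),
      ‖glue M.tets (fun T x => τ • u T x) x‖ ≤ |τ| * A T := fun T hT x hx => by
    rw [glue_eq_of_mem_interior hT hx, norm_smul, Real.norm_eq_abs]
    exact mul_le_mul_of_nonneg_left (hA T hT x hx) (abs_nonneg _)
  have hsumτ : ∀ D : Finset E3 → ℝ, ∑ T ∈ M.tets, (|τ| * D T) ^ 2 = τ ^ 2 * ∑ T ∈ M.tets, D T ^ 2 := by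
    intro D
    rw [Finset.mul_sum]
    exact Finset.sum_congr rfl fun T _ => by rw [mul_pow, sq_abs]
  have hsq : Real.sqrt (C₀ + κ) ^ 2 = C₀ + κ := Real.sq_sqrt hc0
  have hroot : ∀ y : ℝ, 0 ≤ y → ENNReal.ofReal (y ^ 2) ^ (1 / 2 : ℝ) = ENNReal.ofReal y := by
    intro y hy
    rw [ENNReal.ofReal_rpow_of_nonneg (sq_nonneg _) (by norm_num), ← Real.sqrt_eq_rpow,
      Real.sqrt_sq hy]
  have hCe : ((Real.toNNReal (Real.sqrt (C₀ + κ) * K) : ℝ≥0) : ℝ≥0∞) =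
      ENNReal.ofReal (Real.sqrt (C₀ + κ) * K) := rfl
  refine ⟨τ, ?_, ?_, ?_⟩
  · refine (hvel M Ω δ _ hΩ hsub hv (fun T => |τ| * B T) hBτ
      (fun T hT hTi => by simp [hB0 T hT hTi])).trans ?_
    rw [hCe, hPp, ← ENNReal.ofReal_mul (by positivity),
      ← hroot (Real.sqrt (C₀ + κ) * K * p) (by positivity)]
    refine ENNReal.rpow_le_rpow (ENNReal.ofReal_le_ofReal ?_) (by norm_num)
    rw [hsumτ, mul_pow, mul_pow, hsq]
    calc C₀ * M.h ^ 3 * (τ ^ 2 * ∑ T ∈ M.tets, B T ^ 2)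
        = C₀ * τ ^ 2 * (M.h ^ 3 * ∑ T ∈ M.tets, B T ^ 2) := by ring
      _ ≤ C₀ * τ ^ 2 * (K * β) := by gcongr
      _ = C₀ * K * (τ ^ 2 * β) := by ring
      _ ≤ C₀ * K * (K * p ^ 2) := by gcongr
      _ ≤ (C₀ + κ) * K ^ 2 * p ^ 2 := by
        have : 0 ≤ κ * K ^ 2 * p ^ 2 := by positivity
        linarith
  · have hd : divForm Ω (glue M.tets fun T x => τ • u T x) q = τ * β := by
      rw [divForm_glue hv hΩ hsub hf hq, ← hβe, Finset.mul_sum]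
      refine Finset.sum_congr rfl fun T _ => ?_
      rw [← integral_const_mul]
      congr 1
      funext x
      have : divergence (fun x => τ • u T x) x = τ * divergence (u T) x := by
        simp only [divergence, gradRow_const_smul hu, Finset.mul_sum]
        simp
      rw [this, mul_assoc]
    rw [hd, hPp, ← ENNReal.ofReal_pow hp0]
    rw [EReal.coe_ennreal_ofReal, max_eq_left (sq_nonneg p)]
    exact EReal.coe_le_coe_iff.2 hτp
  · have h1 := l2Sq_le_sum (M := M) (A := Ω) (g := glue M.tets fun T x => τ • u T x)
      (fun x hx => exists_mem_hull_of_mem_meshDomain (hsub hx)) hAτ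
    refine (ENNReal.rpow_le_rpow h1 (by norm_num)).trans ?_
    rw [hCe, hPp, ← ENNReal.ofReal_mul hh, ← ENNReal.ofReal_mul (by positivity),
      ← hroot (Real.sqrt (C₀ + κ) * K * (M.h * p)) (by positivity)]
    refine ENNReal.rpow_le_rpow (ENNReal.ofReal_le_ofReal ?_) (by norm_num)
    rw [hsumτ, mul_pow, mul_pow, mul_pow, hsq]
    calc κ * M.h ^ 3 * (τ ^ 2 * ∑ T ∈ M.tets, A T ^ 2)
        = κ * τ ^ 2 * (M.h ^ 3 * ∑ T ∈ M.tets, A T ^ 2) := by ring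
      _ ≤ κ * τ ^ 2 * (K * M.h ^ 2 * β) := by gcongr
      _ = κ * K * M.h ^ 2 * (τ ^ 2 * β) := by ring
      _ ≤ κ * K * M.h ^ 2 * (K * p ^ 2) := by gcongr
      _ ≤ (C₀ + κ) * K ^ 2 * (M.h ^ 2 * p ^ 2) := by
        have : 0 ≤ C₀ * K ^ 2 * (M.h ^ 2 * p ^ 2) := by positivity
        linarith

end Assembly

/-! ### Local estimates on a shape-regular tetrahedron -/

section Local

variable {T J : Finset E3} {a b x x₀ : E3} {σ : ℝ}

theorem hasFDerivAt_affine (l : E3 →ᵃ[ℝ] ℝ) (x : E3) :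
    HasFDerivAt l (LinearMap.toContinuousLinearMap l.linear) x := by
  have h := ((LinearMap.toContinuousLinearMap l.linear).hasFDerivAt (x := x)).add_const (l 0)
  exact h.congr_of_eventuallyEq (Eventually.of_forall fun y => congrFun (AffineMap.decomp l) y)

theorem hasFDerivAt_bubble (T J : Finset E3) (x : E3) [DecidableEq E3] :
    HasFDerivAt (bubble T J) (∑ c ∈ J, bubble T (J.erase c) x •
      LinearMap.toContinuousLinearMap (bary T c).linear) x :=
  HasFDerivAt.finsetProd fun c _ => hasFDerivAt_affine (bary T c) x

theorem norm_bary_linear_le (hT : IsTet T) (hσ : 0 < σ)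
    (hball : Metric.ball x₀ (Metric.diam (hull T) / σ) ⊆ hull T) (c : E3) :
    ‖LinearMap.toContinuousLinearMap (bary T c).linear‖ ≤ 2 * σ / Metric.diam (hull T) := by
  have hD := diam_hull_pos hT
  refine ContinuousLinearMap.opNorm_le_bound _ (by positivity) fun y => ?_
  exact abs_bary_linear_le hT hσ hball c y

/-- The product rule gives at most four terms, each a bubble of size at most one times a coordinate
slope of size at most `2 * σ / diam`. -/
theorem diam_mul_norm_fderiv_bubble_le (hT : IsTet T) (hσ : 0 < σ)
    (hball : Metric.ball x₀ (Metric.diam (hull T) / σ) ⊆ hull T) (hJ : J ⊆ T) (hx : x ∈ hull T) :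
    Metric.diam (hull T) * ‖fderiv ℝ (bubble T J) x‖ ≤ 8 * σ := by
  classical
  have hD := diam_hull_pos hT
  rw [(hasFDerivAt_bubble T J x).fderiv]
  have h1 : ‖∑ c ∈ J, bubble T (J.erase c) x •
      LinearMap.toContinuousLinearMap (bary T c).linear‖ ≤ ∑ _c ∈ J, 2 * σ / Metric.diam (hull T) := by
    refine (norm_sum_le _ _).trans (Finset.sum_le_sum fun c _ => ?_)
    rw [norm_smul, Real.norm_eq_abs, abs_of_nonneg (bubble_nonneg hT hx)]
    exact (mul_le_of_le_one_left (norm_nonneg _) (bubble_le_one hT hx)).trans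
      (norm_bary_linear_le hT hσ hball c)
  have hc : (J.card : ℝ) ≤ 4 := by
    have := Finset.card_le_card hJ
    rw [hT.card_eq] at this
    exact_mod_cast this
  calc _ ≤ Metric.diam (hull T) * (J.card * (2 * σ / Metric.diam (hull T))) := by
        rw [Finset.sum_const, nsmul_eq_mul] at h1
        gcongr
    _ = J.card * (2 * σ) := by field_simp
    _ ≤ 4 * (2 * σ) := by gcongr
    _ = 8 * σ := by ring

theorem integrableOn_hull {f : E3 → ℝ} (hf : Continuous f) (T : Finset E3) :
    IntegrableOn f (hull T) :=
  hf.continuousOn.integrableOn_compact (isCompact_hull T)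

/-- Integrals against a bubble dominate integrals over the concentric smaller ball. -/
theorem integral_core_le (hT : IsTet T) (hσ : 0 < σ)
    (hball : Metric.ball x₀ (Metric.diam (hull T) / σ) ⊆ hull T) (hJ : J ⊆ T) {g : E3 → ℝ}
    (hg : Continuous g) (hg0 : ∀ x, 0 ≤ g x) :
    ∫ x in Metric.ball x₀ (1 / (2 * σ) * Metric.diam (hull T)), g x ≤
      (2 * σ + 1) ^ 4 * ∫ x in hull T, bubble T J x * g x := by
  have hc : 0 < 1 / (2 * σ + 1) := by positivity
  have hb : Continuous (bubble T J) := (isPoly_bubble T J).contDiff (n := 0) |>.continuous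
  -- At most four factors, each at least `1 / (2 * σ + 1)`, which is at most one.
  have hlow : ∀ x ∈ Metric.ball x₀ (1 / (2 * σ) * Metric.diam (hull T)),
      (1 / (2 * σ + 1)) ^ 4 ≤ bubble T J x := by
    intro x hx
    have h1 : (1 / (2 * σ + 1)) ^ J.card ≤ bubble T J x := by
      rw [bubble, ← Finset.prod_const]
      exact Finset.prod_le_prod (fun _ _ => hc.le) fun c hcJ =>
        bary_ge_of_mem_core hT hσ hball hx (hJ hcJ)
    refine le_trans (pow_le_pow_of_le_one hc.le ?_ ?_) h1
    · rw [div_le_one (by positivity)]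
      linarith
    · rw [← hT.card_eq]
      exact Finset.card_le_card hJ
  have hsub := core_subset hT hσ hball
  have h1 : ∫ x in Metric.ball x₀ (1 / (2 * σ) * Metric.diam (hull T)),
      (1 / (2 * σ + 1)) ^ 4 * g x ≤ ∫ x in hull T, bubble T J x * g x := by
    refine (setIntegral_mono_on ((integrableOn_hull (continuous_const.mul hg) T).mono_set hsub)
      ((integrableOn_hull (hb.mul hg) T).mono_set hsub) Metric.isOpen_ball.measurableSet
      fun x hx => mul_le_mul_of_nonneg_right (hlow x hx) (hg0 x)).trans ?_
    refine setIntegral_mono_set (integrableOn_hull (hb.mul hg) T) ?_ hsub.eventuallyLE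
    filter_upwards [ae_restrict_mem (isClosed_hull T).measurableSet] with x hx
    exact mul_nonneg (bubble_nonneg hT hx) (hg0 x)
  rw [integral_const_mul] at h1
  rw [div_pow, one_pow, div_mul_eq_mul_div, one_mul, div_le_iff₀ (by positivity)] at h1
  linarith

/-- Inverse estimates for polynomials in terms of the bubble-weighted mean square. -/
theorem exists_bubble_inverse_inequality (k : ℕ) (hσ : 0 < σ) : ∃ K : ℝ, 0 < K ∧
    ∀ (T J : Finset E3) (x₀ : E3), IsTet T → Metric.ball x₀ (Metric.diam (hull T) / σ) ⊆ hull T →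
    J ⊆ T → ∀ g : E3 → ℝ, IsPoly k g → ∀ x ∈ hull T,
      Metric.diam (hull T) ^ 3 * g x ^ 2 ≤ K * ∫ y in hull T, bubble T J y * g y ^ 2 ∧
      Metric.diam (hull T) ^ 3 * (Metric.diam (hull T) *
        ‖fderiv ℝ (fun y => bubble T J y * g y) x‖) ^ 2 ≤
        K * ∫ y in hull T, bubble T J y * g y ^ 2 := by
  -- The ratio `1 / (2 * σ)` is that of the inner ball, on which the bubble is bounded below; `K₀`
  -- accounts for the change to the weighted integral. The factor `2 * (8 * σ) ^ 2 + 2` comes from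
  -- squaring the product rule.
  obtain ⟨C, hC, hinv⟩ := exists_inverse_inequality k (s := 1 / (2 * σ)) (by positivity)
  set K₀ : ℝ := C * (2 * σ + 1) ^ 4
  have hK₀ : 0 < K₀ := by positivity
  refine ⟨K₀ * (2 * (8 * σ) ^ 2 + 2), by positivity, fun T J x₀ hT hball hJ g hg x hx => ?_⟩
  set D := Metric.diam (hull T) with hD
  have hD0 : 0 < D := diam_hull_pos hT
  set w := ∫ y in hull T, bubble T J y * g y ^ 2 with hw
  have hgc : Continuous g := (hg.contDiff (n := 0)).continuous
  have hw0 : 0 ≤ w := setIntegral_nonneg (isClosed_hull T).measurableSet fun y hy =>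
    mul_nonneg (bubble_nonneg hT hy) (sq_nonneg _)
  obtain ⟨h1, h2⟩ := hinv g hg x₀ D hD0 x (hull_subset_closedBall (center_mem_hull hT hσ hball) hx)
  have hcore := integral_core_le hT hσ hball hJ (hgc.pow 2) (fun x => sq_nonneg (g x))
  have hcore' : C * ∫ y in Metric.ball x₀ (1 / (2 * σ) * D), g y ^ 2 ≤ K₀ * w := by
    have := mul_le_mul_of_nonneg_left hcore hC.le
    rw [← mul_assoc] at this
    exact this
  replace h1 := h1.trans hcore'
  replace h2 := h2.trans hcore'
  constructor
  · refine h1.trans ?_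
    have h3 := mul_nonneg hK₀.le hw0
    nlinarith [mul_nonneg h3 (sq_nonneg (8 * σ))]
  · have hdb := diam_mul_norm_fderiv_bubble_le hT hσ hball hJ hx
    have hder : fderiv ℝ (fun y => bubble T J y * g y) x =
        bubble T J x • fderiv ℝ g x + g x • fderiv ℝ (bubble T J) x :=
      fderiv_fun_mul (((isPoly_bubble T J).contDiff (n := 1)).differentiable one_ne_zero x)
        ((hg.contDiff (n := 1)).differentiable one_ne_zero x)
    have hn : D * ‖fderiv ℝ (fun y => bubble T J y * g y) x‖ ≤
        D * ‖fderiv ℝ g x‖ + (8 * σ) * |g x| := by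
      rw [hder]
      have e1 : ‖bubble T J x • fderiv ℝ g x‖ ≤ ‖fderiv ℝ g x‖ := by
        rw [norm_smul, Real.norm_eq_abs, abs_of_nonneg (bubble_nonneg hT hx)]
        exact mul_le_of_le_one_left (norm_nonneg _) (bubble_le_one hT hx)
      have e2 : ‖g x • fderiv ℝ (bubble T J) x‖ = |g x| * ‖fderiv ℝ (bubble T J) x‖ := by
        rw [norm_smul, Real.norm_eq_abs]
      calc _ ≤ D * (‖fderiv ℝ g x‖ + |g x| * ‖fderiv ℝ (bubble T J) x‖) := by
            gcongr
            exact (norm_add_le _ _).trans (add_le_add e1 e2.le)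
        _ = D * ‖fderiv ℝ g x‖ + (D * ‖fderiv ℝ (bubble T J) x‖) * |g x| := by ring
        _ ≤ _ := by gcongr
    have hsq : (D * ‖fderiv ℝ (fun y => bubble T J y * g y) x‖) ^ 2 ≤
        2 * (D * ‖fderiv ℝ g x‖) ^ 2 + 2 * (8 * σ) ^ 2 * g x ^ 2 := by
      refine (pow_le_pow_left₀ (by positivity) hn 2).trans ?_
      have := sq_abs (g x)
      nlinarith [sq_nonneg (D * ‖fderiv ℝ g x‖ - 8 * σ * |g x|)]
    calc D ^ 3 * _ ≤ D ^ 3 * (2 * (D * ‖fderiv ℝ g x‖) ^ 2 + 2 * (8 * σ) ^ 2 * g x ^ 2) := by gcongr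
      _ = 2 * (D ^ 3 * (D * ‖fderiv ℝ g x‖) ^ 2) + 2 * (8 * σ) ^ 2 * (D ^ 3 * g x ^ 2) := by ring
      _ ≤ 2 * (K₀ * w) + 2 * (8 * σ) ^ 2 * (K₀ * w) := by gcongr
      _ = _ := by ring

/-- Integration by parts of an edge field against the function whose edge derivative it contains. -/
theorem integral_edge_field (hT : IsTet T) (ha : a ∈ J) (hb : b ∈ J) (hJ : J ⊆ T) {k : ℕ}
    {f : E3 → ℝ} (hf : IsPoly k f) :
    ∫ x in hull T, fderiv ℝ (fun y => bubble T J y * fderiv ℝ f y (b - a)) x (a - b) * f x =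
      ∫ x in hull T, bubble T J x * fderiv ℝ f x (b - a) ^ 2 := by
  have hg := hf.fderiv (b - a)
  set g : E3 → ℝ := fun y => fderiv ℝ f y (b - a) with hgdef
  have hb' := isPoly_bubble T J
  have hfc : Continuous f := (hf.contDiff (n := 0)).continuous
  have hgc : Continuous g := (hg.contDiff (n := 0)).continuous
  have hbc : Continuous (bubble T J) := (hb'.contDiff (n := 0)).continuous
  have hbg : IsPoly (J.card + (k - 1)) (fun y => bubble T J y * g y) := hb'.mul hg
  -- The derivative of bubble times `g` times `f` along the edge has integral zero. Reversing the
  -- direction to `a - b` in the field absorbs the minus sign.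
  have h0 := integral_fderiv_bubble_mul hT ha hb hJ (G := fun x => g x * f x)
    (hg.contDiff.mul hf.contDiff)
  have hder : ∀ x, fderiv ℝ (fun x => bubble T J x * (g x * f x)) x (b - a) =
      bubble T J x * g x ^ 2 - fderiv ℝ (fun y => bubble T J y * g y) x (a - b) * f x := by
    intro x
    have e : (fun x => bubble T J x * (g x * f x)) = fun x => (bubble T J x * g x) * f x := by
      funext x
      ring
    rw [e, fderiv_fun_mul ((hbg.contDiff (n := 1)).differentiable one_ne_zero x)
      ((hf.contDiff (n := 1)).differentiable one_ne_zero x)]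
    have e2 : a - b = -(b - a) := by abel
    rw [e2, map_neg]
    simp only [add_apply, smul_apply, smul_eq_mul, hgdef]
    ring
  simp only [hder] at h0
  rw [integral_sub] at h0
  · linarith
  · exact integrableOn_hull (hbc.mul (hgc.pow 2)) T
  · exact integrableOn_hull (((hbg.fderiv (a - b)).contDiff (n := 0)).continuous.mul hfc) T

/-- A linear functional is controlled by its values on the edges at one vertex. -/
theorem diam_mul_norm_le_sum (hT : IsTet T) (hσ : 0 < σ)
    (hball : Metric.ball x₀ (Metric.diam (hull T) / σ) ⊆ hull T) (φ : E3 →L[ℝ] ℝ) (p : E3) :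
    Metric.diam (hull T) * ‖φ‖ ≤ 2 * σ * ∑ a ∈ T, |φ (a - p)| := by
  have hD := diam_hull_pos hT
  have h1 : ‖φ‖ ≤ 2 * σ / Metric.diam (hull T) * ∑ a ∈ T, |φ (a - p)| := by
    refine ContinuousLinearMap.opNorm_le_bound _ (by positivity) fun v => ?_
    -- The differentials of the coordinates sum to zero, so the vertices may be replaced by the edge
    -- vectors starting at `p`.
    have hv : v = ∑ a ∈ T, (bary T a).linear v • (a - p) := by
      have e1 := sum_bary_smul hT (0 + (1 : ℝ) • v)
      have e2 := sum_bary_smul hT 0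
      have s1 := sum_bary hT (0 + (1 : ℝ) • v)
      have s2 := sum_bary hT 0
      simp only [affine_add_smul, add_smul, Finset.sum_add_distrib, one_mul] at e1 s1
      rw [e2, zero_add, one_smul, zero_add] at e1
      have s3 : ∑ a ∈ T, (bary T a).linear v = 0 := by linarith
      simp only [smul_sub, Finset.sum_sub_distrib]
      rw [e1, ← Finset.sum_smul, s3, zero_smul, sub_zero]
    have h2 : φ v = ∑ a ∈ T, (bary T a).linear v * φ (a - p) := by
      conv_lhs => rw [hv]
      simp [map_sum]
    rw [h2, Real.norm_eq_abs]
    refine (Finset.abs_sum_le_sum_abs _ _).trans ?_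
    rw [Finset.mul_sum, Finset.sum_mul]
    refine Finset.sum_le_sum fun a _ => ?_
    rw [abs_mul]
    have := mul_le_mul_of_nonneg_right (abs_bary_linear_le hT hσ hball a v) (abs_nonneg (φ (a - p)))
    linarith
  calc _ ≤ Metric.diam (hull T) * (2 * σ / Metric.diam (hull T) * ∑ a ∈ T, |φ (a - p)|) := by gcongr
    _ = _ := by field_simp

theorem le_sum_univ {ι : Type*} [Fintype ι] {f : ι → ℝ} (hf : ∀ i, 0 ≤ f i) (i : ι) : f i ≤ ∑ j, f j :=
  Finset.single_le_sum (fun j _ => hf j) (Finset.mem_univ i)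

/-- Three edges of a tetrahedron with independent directions control all edge differences, with a
universal constant. -/
theorem exists_edge_span_const : ∃ K : ℝ, 0 ≤ K ∧ ∀ T, IsTet T → ∀ a b : Fin 3 → E3,
    (∀ i, a i ∈ T ∧ b i ∈ T) → LinearIndependent ℝ (fun i => b i - a i) →
    ∀ φ : E3 →L[ℝ] ℝ, ∀ c ∈ T, ∀ d ∈ T, |φ (c - d)| ≤ K * ∑ i, |φ (b i - a i)| := by
  classical
  -- The condition involves only which of four labelled vertices the three edges join, not the
  -- geometry. There are finitely many such types, so the sum of their constants is universal; types
  -- without a constant count as zero.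
  let Good : (Fin 3 → Fin 4) × (Fin 3 → Fin 4) → ℝ → Prop := fun z K =>
    0 ≤ K ∧ ∀ v : Fin 4 → ℝ, ∀ j k, |v j - v k| ≤ K * ∑ i, |v (z.2 i) - v (z.1 i)|
  let κ : (Fin 3 → Fin 4) × (Fin 3 → Fin 4) → ℝ := fun z => if h : ∃ K, Good z K then h.choose else 0
  have hκ0 : ∀ z, 0 ≤ κ z := fun z => by
    simp only [κ]
    split_ifs with h
    · exact h.choose_spec.1
    · exact le_rfl
  refine ⟨∑ z, κ z, Finset.sum_nonneg fun z _ => hκ0 z, ?_⟩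
  intro T hT a b hab hli φ c hc d hd
  let ε : Fin 4 ≃ T := (finCongr hT.card_eq.symm).trans T.equivFin.symm
  let z : (Fin 3 → Fin 4) × (Fin 3 → Fin 4) :=
    (fun i => ε.symm ⟨a i, (hab i).1⟩, fun i => ε.symm ⟨b i, (hab i).2⟩)
  have hz1 : ∀ i, (ε (z.1 i) : E3) = a i := fun i => by simp [z]
  have hz2 : ∀ i, (ε (z.2 i) : E3) = b i := fun i => by simp [z]
  have hgood : ∃ K, Good z K := by
    let B := basisOfLinearIndependentOfCardEqFinrank hli (by simp)
    have hB : ∀ i, B i = b i - a i := fun i => by simp [B]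
    refine ⟨∑ j, ∑ k, ∑ i, |B.repr ((ε j : E3) - ε k) i|, by positivity, fun v j k => ?_⟩
    -- Arbitrary vertex values are those of an affine function on this tetrahedron. Thus the
    -- expansion of an edge vector in the three given ones becomes an identity between differences
    -- of vertex values.
    let l : E3 →ₗ[ℝ] ℝ := ∑ j, v j • (bary T (ε j)).linear
    have hl : ∀ j k, l ((ε j : E3) - ε k) = v j - v k := by
      intro j k
      have hbj : ∀ m n, bary T (ε m : E3) (ε n) = if m = n then 1 else 0 := by
        intro m n
        split_ifs with h
        · rw [h]
          exact bary_self hT (ε n).2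
        · exact bary_of_ne hT (ε n).2 fun h' => h (ε.injective (Subtype.ext h'.symm))
      simp only [l, LinearMap.sum_apply, LinearMap.smul_apply, linear_sub, hbj, smul_eq_mul,
        mul_sub, Finset.sum_sub_distrib]
      simp
    have h1 : v j - v k = ∑ i, B.repr ((ε j : E3) - ε k) i * (v (z.2 i) - v (z.1 i)) := by
      rw [← hl j k]
      conv_lhs => rw [← B.sum_repr ((ε j : E3) - ε k)]
      rw [map_sum]
      refine Finset.sum_congr rfl fun i _ => ?_
      rw [map_smul, hB, ← hz1 i, ← hz2 i, hl, smul_eq_mul]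
    have hcoef : ∀ i, |B.repr ((ε j : E3) - ε k) i| ≤
        ∑ j, ∑ k, ∑ i, |B.repr ((ε j : E3) - ε k) i| := by
      intro i
      refine (Finset.single_le_sum (f := fun i => |B.repr ((ε j : E3) - ε k) i|)
        (fun _ _ => abs_nonneg _) (Finset.mem_univ i)).trans ?_
      refine (Finset.single_le_sum (f := fun k => ∑ i, |B.repr ((ε j : E3) - ε k) i|)
        (fun _ _ => by positivity) (Finset.mem_univ k)).trans ?_
      exact Finset.single_le_sum (f := fun j => ∑ k, ∑ i, |B.repr ((ε j : E3) - ε k) i|)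
        (fun _ _ => by positivity) (Finset.mem_univ j)
    rw [h1, Finset.mul_sum]
    refine (Finset.abs_sum_le_sum_abs _ _).trans (Finset.sum_le_sum fun i _ => ?_)
    rw [abs_mul]
    exact mul_le_mul_of_nonneg_right (hcoef i) (abs_nonneg _)
  have hκz : Good z (κ z) := by
    simp only [κ, dif_pos hgood]
    exact hgood.choose_spec
  have h2 := hκz.2 (fun j => φ (ε j)) (ε.symm ⟨c, hc⟩) (ε.symm ⟨d, hd⟩)
  simp only [hz1, hz2, Equiv.apply_symm_apply, ← map_sub] at h2
  refine h2.trans (mul_le_mul_of_nonneg_right ?_ (by positivity))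
  exact le_sum_univ hκ0 z

end Local

/-! ### Stability from a decomposition of the field into elementary fields -/

section Decomposition

/-- Cauchy–Schwarz with a uniform bound for the number of elementary fields on a tetrahedron. -/
theorem sq_sum_le_of_card_le {ι : Type*} {I : Finset ι} {a b : ι → ℝ} {N c : ℝ} (hN : (I.card : ℝ) ≤ N)
    (h : ∀ j ∈ I, c * a j ^ 2 ≤ b j) (hc : 0 ≤ c) :
    c * (∑ j ∈ I, a j) ^ 2 ≤ N * ∑ j ∈ I, b j := by
  have h1 : (∑ j ∈ I, a j) ^ 2 ≤ I.card * ∑ j ∈ I, a j ^ 2 := sq_sum_le_card_mul_sum_sq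
  have h0 : 0 ≤ ∑ j ∈ I, a j ^ 2 := Finset.sum_nonneg fun _ _ => sq_nonneg _
  have hN0 : 0 ≤ N := (Nat.cast_nonneg _).trans hN
  calc c * (∑ j ∈ I, a j) ^ 2 ≤ c * (N * ∑ j ∈ I, a j ^ 2) := by
        gcongr
        exact h1.trans (mul_le_mul_of_nonneg_right hN h0)
    _ = N * ∑ j ∈ I, c * a j ^ 2 := by
        rw [← Finset.mul_sum]
        ring
    _ ≤ N * ∑ j ∈ I, b j := by
        gcongr with j hj
        exact h j hj

/-- The three stability conditions for a field that is on each tetrahedron a sum of elementary fields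
of constant direction, each controlled by its own contribution to the divergence form. -/
theorem exists_stable_sum (ι : Type*) (K N : ℝ) (hK : 0 ≤ K) (hN : 0 ≤ N) : ∃ C : ℝ≥0,
    ∀ (M : TetMesh) (Ω : Set E3) (δ : ℝ), IsOpen Ω → Ω ⊆ M.domain →
    ∀ (I : Finset E3 → Finset ι) (G : Finset E3 → ι → E3 → ℝ) (t : ι → E3) (w : Finset E3 → ι → ℝ),
    Pieces M Ω δ (fun T x => ∑ j ∈ I T, G T j x • t j) →
    (∀ T ∈ M.tets, ∀ j ∈ I T, ContDiff ℝ 1 (G T j)) →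
    (∀ T ∈ M.tets, ((I T).card : ℝ) ≤ N) → (∀ T ∈ M.tets, T ∉ M.inner Ω δ → I T = ∅) →
    (∀ T ∈ M.tets, ∀ j ∈ I T, 0 ≤ w T j) →
    (∀ T ∈ M.tets, ∀ j ∈ I T, ∀ x ∈ hull T,
      M.h ^ 3 * (‖G T j x‖ * ‖t j‖) ^ 2 ≤ K * M.h ^ 2 * w T j) →
    (∀ T ∈ M.tets, ∀ j ∈ I T, ∀ x ∈ hull T,
      M.h ^ 3 * (‖fderiv ℝ (G T j) x‖ * ‖t j‖) ^ 2 ≤ K * w T j) →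
    ∀ (q : E3 → ℝ) (f : Finset E3 → E3 → ℝ), (∀ T ∈ M.inner Ω δ, Continuous (f T)) →
    (∀ T ∈ M.inner Ω δ, Set.EqOn q (f T) (interior (hull T))) →
    ∑ T ∈ M.inner Ω δ, ∑ j ∈ I T, w T j ≤
      ∑ T ∈ M.inner Ω δ, ∑ j ∈ I T, ∫ x in hull T, fderiv ℝ (G T j) x (t j) * f T x →
    ∀ S : Finset (Finset E3), M.pressureNorm S q ^ 2 ≤
      ENNReal.ofReal (K * ∑ T ∈ M.inner Ω δ, ∑ j ∈ I T, w T j) →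
    ∃ τ : ℝ, M.velocityNorm Ω δ (glue M.tets fun T x => τ • ∑ j ∈ I T, G T j x • t j) ≤
        C * M.pressureNorm S q ∧
      ((M.pressureNorm S q ^ 2 : ℝ≥0∞) : EReal) ≤
        ((divForm Ω (glue M.tets fun T x => τ • ∑ j ∈ I T, G T j x • t j) q : ℝ) : EReal) ∧
      l2Sq (volume.restrict Ω) (glue M.tets fun T x => τ • ∑ j ∈ I T, G T j x • t j) ^ (1 / 2 : ℝ) ≤
        C * (ENNReal.ofReal M.h * M.pressureNorm S q) := by
  obtain ⟨C, hC⟩ := exists_stable_const (N * K + K) (by positivity)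
  refine ⟨C, fun M Ω δ hΩ hsub I G t w hu hG hcard hI0 hw hA hB q f hf hq hβ S hP => ?_⟩
  set W : Finset E3 → ℝ := fun T => ∑ j ∈ I T, w T j with hW
  have hh := M.h_nonneg
  have hsubT : M.inner Ω δ ⊆ M.tets := TetMesh.inner_subset_tets
  have hW0 : ∀ T ∈ M.tets, 0 ≤ W T := fun T hT => Finset.sum_nonneg (hw T hT)
  have hWsum : ∑ T ∈ M.tets, W T = ∑ T ∈ M.inner Ω δ, W T := by
    refine (Finset.sum_subset hsubT fun T hT hTn => ?_).symm
    simp [hW, hI0 T hT hTn]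
  have hWtot : 0 ≤ ∑ T ∈ M.inner Ω δ, W T := Finset.sum_nonneg fun T hT => hW0 T (hsubT hT)
  have hc3 : ∀ T ∈ M.tets, 0 < M.h ^ 3 := fun T hT => pow_pos (TetMesh.h_pos hT) 3
  -- The bounds on each tetrahedron are the square roots that at most `N` elementary fields allow.
  -- They vanish outside the interior mesh, where `W T = 0`. As `β` serves the actual value of the
  -- form, which dominates the sum of the weights.
  refine hC M Ω δ hΩ hsub _ hu (fun T => Real.sqrt (N * (K * M.h ^ 2 * W T) / M.h ^ 3))
    (fun T => Real.sqrt (N * (K * W T) / M.h ^ 3)) ?_ ?_ ?_ q f hf hq _ (hWtot.trans hβ) ?_ ?_ ?_ S ?_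
  · intro T hT x hx
    have hx' := interior_subset hx
    refine Real.le_sqrt_of_sq_le ?_
    rw [le_div_iff₀ (hc3 T hT), mul_comm]
    have h1 : ‖∑ j ∈ I T, G T j x • t j‖ ≤ ∑ j ∈ I T, ‖G T j x‖ * ‖t j‖ :=
      (norm_sum_le _ _).trans (le_of_eq (Finset.sum_congr rfl fun j _ => norm_smul _ _))
    refine (mul_le_mul_of_nonneg_left (pow_le_pow_left₀ (norm_nonneg _) h1 2) (hc3 T hT).le).trans ?_
    refine (sq_sum_le_of_card_le (hcard T hT) (fun j hj => hA T hT j hj x hx') (hc3 T hT).le).trans ?_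
    rw [← Finset.mul_sum]
  · intro T hT i x hx
    have hx' := interior_subset hx
    refine Real.le_sqrt_of_sq_le ?_
    rw [le_div_iff₀ (hc3 T hT), mul_comm]
    refine (mul_le_mul_of_nonneg_left (pow_le_pow_left₀ (norm_nonneg _)
      (norm_gradRow_sum_smul_le (hG T hT) i x) 2) (hc3 T hT).le).trans ?_
    refine (sq_sum_le_of_card_le (hcard T hT) (fun j hj => hB T hT j hj x hx') (hc3 T hT).le).trans ?_
    rw [← Finset.mul_sum]
  · intro T hT hTn
    simp [hW, hI0 T hT hTn]
  · refine Finset.sum_congr rfl fun T hT => ?_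
    have hfc := hf T hT
    rw [← integral_finsetSum]
    · refine integral_congr_ae (ae_of_all _ fun x => ?_)
      simp only
      rw [divergence_sum_smul (hG T (hsubT hT)), Finset.sum_mul]
    · intro j hj
      have := (hG T (hsubT hT) j hj).continuous_fderiv one_ne_zero
      exact integrableOn_hull ((this.clm_apply continuous_const).mul hfc) T
  · have e : ∀ T ∈ M.tets, M.h ^ 3 * Real.sqrt (N * (K * M.h ^ 2 * W T) / M.h ^ 3) ^ 2 =
        N * K * M.h ^ 2 * W T := by
      intro T hT
      have := hW0 T hT
      rw [Real.sq_sqrt (by positivity)]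
      have := (TetMesh.h_pos hT).ne'
      field_simp
    rw [Finset.mul_sum, Finset.sum_congr rfl e, ← Finset.mul_sum, hWsum]
    calc N * K * M.h ^ 2 * ∑ T ∈ M.inner Ω δ, W T ≤ (N * K + K) * M.h ^ 2 * ∑ T ∈ M.inner Ω δ, W T := by
          gcongr
          linarith
      _ ≤ _ := by gcongr
  · have e : ∀ T ∈ M.tets, M.h ^ 3 * Real.sqrt (N * (K * W T) / M.h ^ 3) ^ 2 = N * K * W T := by
      intro T hT
      have := hW0 T hT
      rw [Real.sq_sqrt (by positivity)]
      have := (TetMesh.h_pos hT).ne'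
      field_simp
    rw [Finset.mul_sum, Finset.sum_congr rfl e, ← Finset.mul_sum, hWsum]
    calc N * K * ∑ T ∈ M.inner Ω δ, W T ≤ (N * K + K) * ∑ T ∈ M.inner Ω δ, W T := by
          gcongr
          linarith
      _ ≤ _ := by gcongr
  · refine hP.trans (ENNReal.ofReal_le_ofReal ?_)
    calc K * ∑ T ∈ M.inner Ω δ, W T ≤ (N * K + K) * ∑ T ∈ M.inner Ω δ, W T := by
          gcongr
          have : 0 ≤ N * K := by positivity
          linarith
      _ ≤ _ := by gcongr

end Decomposition

/-! ### Pressures -/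

section Pressure

variable {M : TetMesh} {Ω : Set E3} {δ : ℝ} {T T₁ T₂ : Finset E3} {x : E3} {q p f : E3 → ℝ}

theorem pressureNorm_sq (M : TetMesh) (S : Finset (Finset E3)) (q : E3 → ℝ) :
    M.pressureNorm S q ^ 2 =
      ENNReal.ofReal M.h ^ 2 * (∑ T ∈ S, l2Sq (volume.restrict (hull T)) (gradient q)) +
      ENNReal.ofReal M.h * ((1 / 2) * ∑ P ∈ facePairs S,
        l2Sq (surf (hull P.1 ∩ hull P.2)) (jump q P.1 P.2)) := by
  rw [TetMesh.pressureNorm, ← ENNReal.rpow_natCast, ← ENNReal.rpow_mul]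
  norm_num

open Classical in
theorem mem_facePairs {S : Finset (Finset E3)} {P : Finset E3 × Finset E3} :
    P ∈ facePairs S ↔ P.1 ∈ S ∧ P.2 ∈ S ∧ P.1 ≠ P.2 ∧ (P.1 ∩ P.2).card = 3 := by
  simp only [facePairs, Finset.mem_filter, Finset.mem_product]
  tauto

theorem tendsto_of_eqOn_interior (hf : Continuous f) (hq : Set.EqOn q f (interior (hull T))) (x : E3) :
    Tendsto q (𝓝[interior (hull T)] x) (𝓝 (f x)) :=
  ((hf.tendsto x).mono_left nhdsWithin_le_nhds).congr' (by
    filter_upwards [self_mem_nhdsWithin] with y hy using (hq hy).symm)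

theorem mem_closure_interior (hT : IsTet T) (hx : x ∈ hull T) : x ∈ closure (interior (hull T)) := by
  rwa [closure_interior_hull hT]

theorem jump_eq {f₁ f₂ : E3 → ℝ} (h₁ : IsTet T₁) (h₂ : IsTet T₂) (hf₁ : Continuous f₁)
    (hf₂ : Continuous f₂) (hq₁ : Set.EqOn q f₁ (interior (hull T₁)))
    (hq₂ : Set.EqOn q f₂ (interior (hull T₂))) (hx₁ : x ∈ hull T₁) (hx₂ : x ∈ hull T₂) :
    jump q T₁ T₂ x = f₁ x - f₂ x := by
  rw [jump, extendFrom_eq (mem_closure_interior h₁ hx₁) (tendsto_of_eqOn_interior hf₁ hq₁ x),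
    extendFrom_eq (mem_closure_interior h₂ hx₂) (tendsto_of_eqOn_interior hf₂ hq₂ x)]

/-- A function that is continuous in the domain agrees with its polynomial pieces up to the boundary
of the tetrahedra. -/
theorem eq_of_continuousOn_domain (hp : ContinuousOn p M.domain) (hT : T ∈ M.tets)
    (hf : Continuous f) (hpf : Set.EqOn p f (interior (hull T))) (hx : x ∈ hull T)
    (hxM : x ∈ M.domain) : p x = f x := by
  have hne : (𝓝[interior (hull T)] x).NeBot :=
    mem_closure_iff_nhdsWithin_neBot.1 (mem_closure_interior (TetMesh.isTet hT) hx)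
  have h1 : Tendsto p (𝓝[interior (hull T)] x) (𝓝 (p x)) :=
    (hp x hxM).mono_left (nhdsWithin_mono x (interior_hull_subset_meshDomain hT))
  exact tendsto_nhds_unique h1 (tendsto_of_eqOn_interior hf hpf x)

open Classical in
/-- Continuous functions have no jumps. -/
theorem jump_eq_zero (hp : ContinuousOn p M.domain) {f₁ f₂ : E3 → ℝ} (h₁ : T₁ ∈ M.tets)
    (h₂ : T₂ ∈ M.tets) (h3 : (T₁ ∩ T₂).card = 3) (hf₁ : Continuous f₁)
    (hf₂ : Continuous f₂) (hp₁ : Set.EqOn p f₁ (interior (hull T₁)))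
    (hp₂ : Set.EqOn p f₂ (interior (hull T₂))) (hq₁ : Set.EqOn q f₁ (interior (hull T₁)))
    (hq₂ : Set.EqOn q f₂ (interior (hull T₂))) (hx₁ : x ∈ hull T₁) (hx₂ : x ∈ hull T₂) :
    jump q T₁ T₂ x = 0 := by
  have t₁ := TetMesh.isTet h₁
  rw [jump_eq t₁ (TetMesh.isTet h₂) hf₁ hf₂ hq₁ hq₂ hx₁ hx₂]
  have hxF := TetMesh.mem_hull_inter h₁ h₂ hx₁ hx₂
  obtain ⟨y, hy, hypos⟩ := exists_mem_hull_pos t₁ (F := T₁ ∩ T₂) Finset.inter_subset_left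
    (Finset.card_pos.1 (by omega))
  -- Continuity is known only in the open domain, and a boundary point of the face may lie outside
  -- it. Relative interior points of the face lie inside, so `x` is approached along a segment from
  -- `y`.
  have key : ∀ s ∈ Set.Ioc (0 : ℝ) 1, (f₁ - f₂) (AffineMap.lineMap x y s) = 0 := by
    intro s hs
    have hzF : AffineMap.lineMap x y s ∈ hull (T₁ ∩ T₂) :=
      (convex_convexHull ℝ _).lineMap_mem hxF hy ⟨hs.1.le, hs.2⟩
    have hz₁ : AffineMap.lineMap x y s ∈ hull T₁ :=
      convexHull_mono (by exact_mod_cast Finset.inter_subset_left) hzF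
    have hz₂ : AffineMap.lineMap x y s ∈ hull T₂ :=
      convexHull_mono (by exact_mod_cast Finset.inter_subset_right) hzF
    have hpos : ∀ a ∈ T₁ ∩ T₂, 0 < bary T₁ a (AffineMap.lineMap x y s) := by
      intro a ha
      rw [affine_lineMap_eq]
      have h1 := bary_nonneg t₁ hx₁ a
      have h2 := mul_pos hs.1 (hypos a ha)
      have h3 : 0 ≤ 1 - s := by linarith [hs.2]
      positivity
    have hzM : AffineMap.lineMap x y s ∈ M.domain :=
      meshDomain_mono (by
        intro T hT
        simp only [Finset.mem_insert, Finset.mem_singleton] at hT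
        rcases hT with rfl | rfl <;> assumption)
        (TetMesh.mem_meshDomain_pair h₁ h₂ h3 hz₁ hpos)
    rw [Pi.sub_apply, ← eq_of_continuousOn_domain hp h₁ hf₁ hp₁ hz₁ hzM,
      ← eq_of_continuousOn_domain hp h₂ hf₂ hp₂ hz₂ hzM, sub_self]
  have hlim : Tendsto (fun s : ℝ => (f₁ - f₂) (AffineMap.lineMap x y s)) (𝓝[>] 0)
      (𝓝 ((f₁ - f₂) x)) := by
    have : Continuous fun s : ℝ => (f₁ - f₂) (AffineMap.lineMap x y s) :=
      (hf₁.sub hf₂).comp (by fun_prop)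
    have h := this.tendsto 0
    rw [AffineMap.lineMap_apply_zero] at h
    exact h.mono_left nhdsWithin_le_nhds
  have h0 : Tendsto (fun s : ℝ => (f₁ - f₂) (AffineMap.lineMap x y s)) (𝓝[>] 0) (𝓝 0) := by
    refine tendsto_const_nhds.congr' ?_
    filter_upwards [Ioc_mem_nhdsGT one_pos] with s hs using (key s hs).symm
  exact tendsto_nhds_unique hlim h0

/-- The gradient part of the pressure seminorm. -/
theorem l2Sq_gradient_le (hT : IsTet T) (hq : Set.EqOn q f (interior (hull T))) {c : ℝ} (hc : 0 ≤ c)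
    (h : ∀ x ∈ hull T, Metric.diam (hull T) ^ 3 * ‖fderiv ℝ f x‖ ^ 2 ≤ c) :
    l2Sq (volume.restrict (hull T)) (gradient q) ≤
      ENNReal.ofReal (c * volume.real (Metric.ball (0 : E3) 1)) := by
  have hD := diam_hull_pos hT
  rw [l2Sq, setLIntegral_congr (interior_hull_ae_eq T).symm]
  have h1 : ∫⁻ x in interior (hull T), ‖gradient q x‖ₑ ^ 2 ≤
      ∫⁻ _ in interior (hull T), ENNReal.ofReal (c / Metric.diam (hull T) ^ 3) := by
    refine setLIntegral_mono measurable_const fun x hx => ?_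
    have e : gradient q x = gradient f x := gradient_congr (by
      filter_upwards [isOpen_interior.mem_nhds hx] with y hy using hq hy)
    rw [e, ← ofReal_norm, ← ENNReal.ofReal_pow (norm_nonneg _), norm_gradient]
    refine ENNReal.ofReal_le_ofReal ?_
    rw [le_div_iff₀ (by positivity), mul_comm]
    exact h x (interior_subset hx)
  refine h1.trans ?_
  rw [setLIntegral_const, measure_congr (interior_hull_ae_eq T),
    ← ofReal_measureReal (isCompact_hull T).measure_lt_top.ne,
    ← ENNReal.ofReal_mul (by positivity)]
  refine ENNReal.ofReal_le_ofReal ?_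
  calc c / Metric.diam (hull T) ^ 3 * volume.real (hull T)
      ≤ c / Metric.diam (hull T) ^ 3 *
        (Metric.diam (hull T) ^ 3 * volume.real (Metric.ball (0 : E3) 1)) := by
        gcongr
        exact volume_hull_le hT
    _ = _ := by field_simp

end Pressure

/-! ### Fields built from the edges -/

section Edge

/-- The three stability conditions for continuous pressures and the fields that are, on each
tetrahedron, combinations of tangential derivatives along edges, weighted by bubble functions. -/
theorem exists_edge_stable (k : ℕ) {σ κ : ℝ} (hσ : 0 < σ) (hκ : 0 < κ) (K₁ : ℝ) : ∃ C : ℝ≥0,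
    ∀ (M : TetMesh) (Ω : Set E3) (δ : ℝ), Setting σ κ M Ω δ →
    ∀ (I : Finset E3 → Finset (E3 × E3)) (J : Finset E3 → E3 × E3 → Finset E3)
      (S : Finset (Finset E3)),
    (∀ T ∈ M.tets, ∀ e ∈ I T, e.1 ∈ J T e ∧ e.2 ∈ J T e ∧ J T e ⊆ T) →
    (∀ T ∈ M.tets, T ∉ M.inner Ω δ → I T = ∅) → S ⊆ M.inner Ω δ →
    (∀ T ∈ S, ∀ φ : E3 →L[ℝ] ℝ,
      Metric.diam (hull T) * ‖φ‖ ≤ K₁ * ∑ e ∈ I T, |φ (e.2 - e.1)|) →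
    ∀ (q p : E3 → ℝ) (f : Finset E3 → E3 → ℝ), (∀ T ∈ M.tets, IsPoly k (f T)) →
    ContinuousOn p M.domain → (∀ T ∈ M.tets, Set.EqOn p (f T) (interior (hull T))) →
    Set.EqOn q p (meshDomain (M.active Ω δ)) →
    Pieces M Ω δ (fun T x => ∑ e ∈ I T,
      (bubble T (J T e) x * fderiv ℝ (f T) x (e.2 - e.1)) • (e.1 - e.2)) →
    ∃ τ : ℝ, M.velocityNorm Ω δ (glue M.tets fun T x => τ • ∑ e ∈ I T,
          (bubble T (J T e) x * fderiv ℝ (f T) x (e.2 - e.1)) • (e.1 - e.2)) ≤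
        C * M.pressureNorm S q ∧
      ((M.pressureNorm S q ^ 2 : ℝ≥0∞) : EReal) ≤
        ((divForm Ω (glue M.tets fun T x => τ • ∑ e ∈ I T,
          (bubble T (J T e) x * fderiv ℝ (f T) x (e.2 - e.1)) • (e.1 - e.2)) q : ℝ) : EReal) ∧
      l2Sq (volume.restrict Ω) (glue M.tets fun T x => τ • ∑ e ∈ I T,
          (bubble T (J T e) x * fderiv ℝ (f T) x (e.2 - e.1)) • (e.1 - e.2)) ^ (1 / 2 : ℝ) ≤
        C * (ENNReal.ofReal M.h * M.pressureNorm S q) := by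
  obtain ⟨K, hK, hinv⟩ := exists_bubble_inverse_inequality (k - 1) hσ
  set V := volume.real (Metric.ball (0 : E3) 1) with hV
  have hV0 : 0 ≤ V := measureReal_nonneg
  -- The first summand serves the bounds of the field and its derivative, the second the pressure
  -- gradient; 16 counts the ordered pairs of vertices of a tetrahedron.
  obtain ⟨C, hC⟩ := exists_stable_sum (E3 × E3) (κ ^ 3 * K + κ ^ 2 * K₁ ^ 2 * 16 * K * V) 16
    (by positivity) (by norm_num)
  refine ⟨C, fun M Ω δ hs I J S hIJ hI0 hS hspan q p f hf hp hpf hqp hu => ?_⟩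
  have hsub : M.inner Ω δ ⊆ M.tets := TetMesh.inner_subset_tets
  have hq : ∀ T ∈ M.inner Ω δ, Set.EqOn q (f T) (interior (hull T)) := fun T hT x hx =>
    (hqp (interior_hull_subset_meshDomain (TetMesh.inner_subset_active hT) hx)).trans
      (hpf T (hsub hT) hx)
  have hfc : ∀ T ∈ M.tets, Continuous (f T) := fun T hT => ((hf T hT).contDiff (n := 0)).continuous
  have hh := M.h_nonneg
  have hcard : ∀ T ∈ M.tets, ((I T).card : ℝ) ≤ 16 := by
    intro T hT
    have h1 : I T ⊆ T ×ˢ T := fun e he =>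
      Finset.mem_product.2 ⟨(hIJ T hT e he).2.2 (hIJ T hT e he).1,
        (hIJ T hT e he).2.2 (hIJ T hT e he).2.1⟩
    have h2 := Finset.card_le_card h1
    rw [Finset.card_product, (TetMesh.isTet hT).card_eq] at h2
    exact_mod_cast h2
  have hw : ∀ T ∈ M.tets, ∀ e ∈ I T,
      0 ≤ ∫ x in hull T, bubble T (J T e) x * fderiv ℝ (f T) x (e.2 - e.1) ^ 2 := by
    intro T hT e he
    refine setIntegral_nonneg (isCompact_hull T).measurableSet fun x hx => ?_
    exact mul_nonneg (bubble_nonneg (TetMesh.isTet hT) hx) (sq_nonneg _)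
  have hbound : ∀ T ∈ M.tets, ∀ e ∈ I T, ‖e.1 - e.2‖ ≤ Metric.diam (hull T) := fun T hT e he =>
    norm_sub_le_diam (subset_convexHull ℝ _ ((hIJ T hT e he).2.2 (hIJ T hT e he).1))
      (subset_convexHull ℝ _ ((hIJ T hT e he).2.2 (hIJ T hT e he).2.1))
  have hest : ∀ T ∈ M.tets, ∀ e ∈ I T, ∀ x ∈ hull T,
      Metric.diam (hull T) ^ 3 * fderiv ℝ (f T) x (e.2 - e.1) ^ 2 ≤
        K * ∫ y in hull T, bubble T (J T e) y * fderiv ℝ (f T) y (e.2 - e.1) ^ 2 ∧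
      Metric.diam (hull T) ^ 3 * (Metric.diam (hull T) *
        ‖fderiv ℝ (fun y => bubble T (J T e) y * fderiv ℝ (f T) y (e.2 - e.1)) x‖) ^ 2 ≤
        K * ∫ y in hull T, bubble T (J T e) y * fderiv ℝ (f T) y (e.2 - e.1) ^ 2 := by
    intro T hT e he x hx
    obtain ⟨x₀, hball⟩ := hs.shapeRegular T hT
    exact hinv T (J T e) x₀ (TetMesh.isTet hT) hball (hIJ T hT e he).2.2 _
      ((hf T hT).fderiv (e.2 - e.1)) x hx
  have hh3 : ∀ T ∈ M.tets, M.h ^ 3 ≤ κ ^ 3 * Metric.diam (hull T) ^ 3 := fun T hT => by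
    rw [← mul_pow]
    exact pow_le_pow_left₀ hh (hs.quasiUniform T hT) 3
  refine hC M Ω δ hs.lipschitz.1 hs.subset_domain I
    (fun T e x => bubble T (J T e) x * fderiv ℝ (f T) x (e.2 - e.1)) (fun e => e.1 - e.2)
    (fun T e => ∫ x in hull T, bubble T (J T e) x * fderiv ℝ (f T) x (e.2 - e.1) ^ 2)
    hu ?_ hcard hI0 hw ?_ ?_ q f (fun T hT => hfc T (hsub hT)) hq ?_ S ?_
  · intro T hT e _
    exact ((isPoly_bubble T (J T e)).mul ((hf T hT).fderiv (e.2 - e.1))).contDiff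
  · intro T hT e he x hx
    have h1 := (hest T hT e he x hx).1
    have hw' := hw T hT e he
    set w := ∫ y in hull T, bubble T (J T e) y * fderiv ℝ (f T) y (e.2 - e.1) ^ 2
    set g := fderiv ℝ (f T) x (e.2 - e.1)
    have hb0 := bubble_nonneg (J := J T e) (TetMesh.isTet hT) hx
    have hb1 := bubble_le_one (J := J T e) (TetMesh.isTet hT) hx
    have hG : ‖bubble T (J T e) x * g‖ ≤ |g| := by
      rw [Real.norm_eq_abs, abs_mul, abs_of_nonneg hb0]
      exact mul_le_of_le_one_left (abs_nonneg _) hb1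
    have ht : ‖e.1 - e.2‖ ≤ M.h := (hbound T hT e he).trans (TetMesh.diam_le_h hT)
    calc M.h ^ 3 * (‖bubble T (J T e) x * g‖ * ‖e.1 - e.2‖) ^ 2
        ≤ (κ ^ 3 * Metric.diam (hull T) ^ 3) * (|g| * M.h) ^ 2 := by
          gcongr
          exact hh3 T hT
      _ = κ ^ 3 * M.h ^ 2 * (Metric.diam (hull T) ^ 3 * g ^ 2) := by
          rw [mul_pow, sq_abs]
          ring
      _ ≤ κ ^ 3 * M.h ^ 2 * (K * w) := by gcongr
      _ = κ ^ 3 * K * (M.h ^ 2 * w) := by ring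
      _ ≤ (κ ^ 3 * K + κ ^ 2 * K₁ ^ 2 * 16 * K * V) * (M.h ^ 2 * w) := by
          gcongr
          have : 0 ≤ κ ^ 2 * K₁ ^ 2 * 16 * K * V := by positivity
          linarith
      _ = _ := by ring
  · intro T hT e he x hx
    have h1 := (hest T hT e he x hx).2
    have hw' := hw T hT e he
    set w := ∫ y in hull T, bubble T (J T e) y * fderiv ℝ (f T) y (e.2 - e.1) ^ 2
    set L := ‖fderiv ℝ (fun y => bubble T (J T e) y * fderiv ℝ (f T) y (e.2 - e.1)) x‖ with hL
    have hL0 : 0 ≤ L := norm_nonneg _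
    calc M.h ^ 3 * (L * ‖e.1 - e.2‖) ^ 2
        ≤ (κ ^ 3 * Metric.diam (hull T) ^ 3) * (L * Metric.diam (hull T)) ^ 2 := by
          gcongr
          · exact hh3 T hT
          · exact hbound T hT e he
      _ = κ ^ 3 * (Metric.diam (hull T) ^ 3 * (Metric.diam (hull T) * L) ^ 2) := by ring
      _ ≤ κ ^ 3 * (K * w) := by gcongr
      _ = κ ^ 3 * K * w := by ring
      _ ≤ (κ ^ 3 * K + κ ^ 2 * K₁ ^ 2 * 16 * K * V) * w := by
          gcongr
          have : 0 ≤ κ ^ 2 * K₁ ^ 2 * 16 * K * V := by positivity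
          linarith
  · refine le_of_eq (Finset.sum_congr rfl fun T hT => Finset.sum_congr rfl fun e he => ?_)
    obtain ⟨h1, h2, h3⟩ := hIJ T (hsub hT) e he
    exact (integral_edge_field (TetMesh.isTet (hsub hT)) h1 h2 h3 (hf T (hsub hT))).symm
  · set W : Finset E3 → ℝ := fun T => ∑ e ∈ I T,
      ∫ x in hull T, bubble T (J T e) x * fderiv ℝ (f T) x (e.2 - e.1) ^ 2 with hW
    have hW0 : ∀ T ∈ M.tets, 0 ≤ W T := fun T hT => Finset.sum_nonneg (hw T hT)
    have hjump : ∀ P ∈ facePairs S, l2Sq (surf (hull P.1 ∩ hull P.2)) (jump q P.1 P.2) = 0 := by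
      intro P hP
      obtain ⟨h1, h2, -, h3⟩ := mem_facePairs.1 hP
      have hm : MeasurableSet (hull P.1 ∩ hull P.2) :=
        (isCompact_hull P.1).measurableSet.inter (isCompact_hull P.2).measurableSet
      rw [l2Sq, surf, setLIntegral_congr_fun (g := fun _ => 0) hm]
      · simp
      · intro x hx
        simp only
        rw [jump_eq_zero hp (hsub (hS h1)) (hsub (hS h2)) h3 (hfc _ (hsub (hS h1)))
          (hfc _ (hsub (hS h2))) (hpf _ (hsub (hS h1))) (hpf _ (hsub (hS h2))) (hq _ (hS h1))
          (hq _ (hS h2)) hx.1 hx.2]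
        simp
    -- On `S` the edge derivatives control the whole gradient by `hspan`, and each is bounded
    -- pointwise by its bubble-weighted integral.
    have hgrad : ∀ T ∈ S, ENNReal.ofReal M.h ^ 2 * l2Sq (volume.restrict (hull T)) (gradient q) ≤
        ENNReal.ofReal (κ ^ 2 * K₁ ^ 2 * 16 * K * V * W T) := by
      intro T hTS
      have hTi := hS hTS
      have hT := hsub hTi
      have hD := diam_hull_pos (TetMesh.isTet hT)
      have hWT := hW0 T hT
      set D := Metric.diam (hull T) with hDdef
      have h1 : ∀ x ∈ hull T, D ^ 3 * ‖fderiv ℝ (f T) x‖ ^ 2 ≤ K₁ ^ 2 * 16 * K * W T / D ^ 2 := by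
        intro x hx
        rw [le_div_iff₀ (by positivity)]
        have h2 := hspan T hTS (fderiv ℝ (f T) x)
        have h3 := sq_sum_le_of_card_le (c := D ^ 3) (hcard T hT)
          (a := fun e => |fderiv ℝ (f T) x (e.2 - e.1)|)
          (b := fun e => K * ∫ y in hull T, bubble T (J T e) y * fderiv ℝ (f T) y (e.2 - e.1) ^ 2)
          (fun e he => by
            simp only [sq_abs]
            exact (hest T hT e he x hx).1) (by positivity)
        rw [← Finset.mul_sum] at h3
        calc D ^ 3 * ‖fderiv ℝ (f T) x‖ ^ 2 * D ^ 2 = D ^ 3 * (D * ‖fderiv ℝ (f T) x‖) ^ 2 := by ring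
          _ ≤ D ^ 3 * (K₁ * ∑ e ∈ I T, |fderiv ℝ (f T) x (e.2 - e.1)|) ^ 2 := by gcongr
          _ = K₁ ^ 2 * (D ^ 3 * (∑ e ∈ I T, |fderiv ℝ (f T) x (e.2 - e.1)|) ^ 2) := by ring
          _ ≤ K₁ ^ 2 * (16 * (K * W T)) := by gcongr
          _ = _ := by ring
      have h2 := l2Sq_gradient_le (TetMesh.isTet hT) (hq T hTi) (by positivity) h1
      rw [← ENNReal.ofReal_pow hh]
      refine (mul_le_mul_right h2 _).trans ?_
      rw [← ENNReal.ofReal_mul (by positivity)]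
      refine ENNReal.ofReal_le_ofReal ?_
      calc M.h ^ 2 * (K₁ ^ 2 * 16 * K * W T / D ^ 2 * V)
          ≤ (κ * D) ^ 2 * (K₁ ^ 2 * 16 * K * W T / D ^ 2 * V) := by
            gcongr
            exact hs.quasiUniform T hT
        _ = _ := by field_simp
    rw [pressureNorm_sq, Finset.sum_congr rfl hjump, Finset.sum_const_zero, mul_zero, mul_zero,
      add_zero, Finset.mul_sum]
    refine (Finset.sum_le_sum hgrad).trans ?_
    rw [← ENNReal.ofReal_sum_of_nonneg fun T hT => by
      have := hW0 T (hsub (hS hT))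
      positivity]
    refine ENNReal.ofReal_le_ofReal ?_
    rw [← Finset.mul_sum]
    have h4 : ∑ T ∈ S, W T ≤ ∑ T ∈ M.inner Ω δ, W T :=
      Finset.sum_le_sum_of_subset_of_nonneg hS fun T hT _ => hW0 T (hsub hT)
    have h5 : 0 ≤ ∑ T ∈ M.inner Ω δ, W T := Finset.sum_nonneg fun T hT => hW0 T (hsub hT)
    calc _ ≤ κ ^ 2 * K₁ ^ 2 * 16 * K * V * ∑ T ∈ M.inner Ω δ, W T := by gcongr
      _ ≤ _ := by
        gcongr
        have : 0 ≤ κ ^ 3 * K := by positivity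
        linarith

end Edge

/-! ### Compatibility of elementary fields -/

section Compat

variable {M : TetMesh} {Ω : Set E3} {δ : ℝ} {T T' : Finset E3} {a b x : E3}

/-- An elementary field that is nonzero at a common point occurs on both sides with the same value,
so the two sums have the same nonzero terms; the index sets themselves may differ. -/
theorem Pieces.of_sum {ι : Type*} {I : Finset E3 → Finset ι} {G : Finset E3 → ι → E3 → ℝ}
    {t : ι → E3} (hG : ∀ T, ∀ j ∈ I T, ContDiff ℝ 1 (G T j)) (hI : ∀ T, T ∉ M.inner Ω δ → I T = ∅)
    (hcompat : ∀ T ∈ M.tets, ∀ T' ∈ M.tets, ∀ x ∈ M.domain, x ∈ hull T → x ∈ hull T' →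
      ∀ j ∈ I T, G T j x ≠ 0 → j ∈ I T' ∧ G T' j x = G T j x)
    (hvanish : ∀ T ∈ M.inner Ω δ, ∀ x ∈ hull T, ∀ j ∈ I T, G T j x ≠ 0 → x ∈ Ω) :
    Pieces M Ω δ (fun T x => ∑ j ∈ I T, G T j x • t j) where
  smooth T i := contDiff_sum_smul (hG T) i
  zero T hT := by
    funext x
    simp [hI T hT]
  compat T hT T' hT' x hx h h' := by
    refine Finset.sum_bij_ne_zero (fun j _ _ => j) ?_ ?_ ?_ ?_
    · exact fun j hj h0 => (hcompat T' hT' T hT x hx h' h j hj (left_ne_zero_of_smul h0)).1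
    · exact fun _ _ _ _ _ _ h => h
    · intro j hj h0
      obtain ⟨h1, h2⟩ := hcompat T hT T' hT' x hx h h' j hj (left_ne_zero_of_smul h0)
      exact ⟨j, h1, by rwa [h2], rfl⟩
    · intro j hj h0
      rw [(hcompat T' hT' T hT x hx h' h j hj (left_ne_zero_of_smul h0)).2]
  vanish T hT x hx hxΩ := by
    refine Finset.sum_eq_zero fun j hj => ?_
    have : G T j x = 0 := by
      by_contra h
      exact hxΩ (hvanish T hT x hx j hj h)
    rw [this, zero_smul]

theorem TetMesh.exists_polynomial_pieces {k : ℕ} {p : E3 → ℝ} (hp : p ∈ M.P k) :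
    ∃ f : Finset E3 → E3 → ℝ, (∀ T, IsPoly k (f T)) ∧
      ∀ T ∈ M.tets, Set.EqOn p (f T) (interior (hull T)) := by
  have h : ∀ T, ∃ f : E3 → ℝ, IsPoly k f ∧ (T ∈ M.tets → Set.EqOn p f (interior (hull T))) := by
    intro T
    by_cases hT : T ∈ M.tets
    · obtain ⟨f, hf, hpf⟩ := hp T hT
      exact ⟨f, hf, fun _ => hpf⟩
    · exact ⟨_, isPoly_const k 0, fun h => absurd h hT⟩
  choose f hf using h
  exact ⟨f, fun T => (hf T).1, fun T hT => (hf T).2 hT⟩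

/-- A tetrahedron that has an interior edge belongs to the interior mesh. -/
theorem TetMesh.mem_inner_of_isInnerEdge (h : M.IsInnerEdge Ω δ a b) (hT : T ∈ M.tets) (ha : a ∈ T)
    (hb : b ∈ T) : T ∈ M.inner Ω δ := by
  have hy : AffineMap.lineMap a b (1 / 2 : ℝ) ∈ openSegment ℝ a b := by
    rw [openSegment_eq_image_lineMap]
    exact ⟨1 / 2, by norm_num, rfl⟩
  have hyT : AffineMap.lineMap a b (1 / 2 : ℝ) ∈ hull T :=
    (convex_convexHull ℝ (T : Set E3)).lineMap_mem (subset_convexHull ℝ _ ha)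
      (subset_convexHull ℝ _ hb) (by norm_num)
  obtain ⟨z, hz, hzT⟩ := mem_closure_iff.1 (mem_closure_interior (isTet hT) hyT) _
    isOpen_interior (h hy)
  obtain ⟨T', hT', hzT'⟩ := exists_mem_hull_of_mem_meshDomain hz
  rwa [eq_of_mem_interior hT (inner_subset_tets hT') hzT hzT']

/-- Short pieces of lines parallel to an edge, through points at which the coordinates of its end
points are positive, stay in the tetrahedron. -/
theorem eventually_add_smul_mem_hull (hT : IsTet T) (ha : a ∈ T) (hb : b ∈ T) (hx : x ∈ hull T)
    (hxa : 0 < bary T a x) (hxb : 0 < bary T b x) :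
    ∀ᶠ s in 𝓝 (0 : ℝ), x + s • (b - a) ∈ hull T := by
  classical
  have hcont : Tendsto (fun s : ℝ => x + s • (b - a)) (𝓝 0) (𝓝 x) := by
    have : Continuous (fun s : ℝ => x + s • (b - a)) := by fun_prop
    have h := this.tendsto 0
    rwa [zero_smul, add_zero] at h
  have hpos : ∀ c ∈ ({a, b} : Finset E3), 0 < bary T c x := by
    intro c hc
    rw [Finset.mem_insert, Finset.mem_singleton] at hc
    rcases hc with rfl | rfl <;> assumption
  filter_upwards [hcont.eventually (eventually_bary_pos hpos)] with s hs
  refine (mem_hull_iff hT).2 fun c hc => ?_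
  by_cases hcm : c ∈ ({a, b} : Finset E3)
  · exact (hs c hcm).le
  · rw [Finset.mem_insert, Finset.mem_singleton, not_or] at hcm
    rw [affine_add_smul, linear_sub, bary_of_ne hT ha (Ne.symm hcm.1),
      bary_of_ne hT hb (Ne.symm hcm.2), sub_zero, mul_zero, add_zero]
    exact bary_nonneg hT hx c

/-- Tangential derivatives of continuous piecewise smooth functions along common edges agree. -/
theorem fderiv_edge_eq {p f f' : E3 → ℝ} (hp : ContinuousOn p M.domain) (hT : T ∈ M.tets)
    (hT' : T' ∈ M.tets) (hf : Differentiable ℝ f) (hf' : Differentiable ℝ f')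
    (hpf : Set.EqOn p f (interior (hull T))) (hpf' : Set.EqOn p f' (interior (hull T')))
    (hx : x ∈ hull T) (hx' : x ∈ hull T') (hxM : x ∈ M.domain) (ha : a ∈ T) (hb : b ∈ T)
    (hxa : 0 < bary T a x) (hxb : 0 < bary T b x) :
    fderiv ℝ f' x (b - a) = fderiv ℝ f x (b - a) := by
  have ha' := TetMesh.mem_of_bary_pos hT hT' hx hx' hxa
  have hb' := TetMesh.mem_of_bary_pos hT hT' hx hx' hxb
  have hxa' := hxa
  have hxb' := hxb
  rw [TetMesh.bary_eq hT hT' hx hx'] at hxa' hxb'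
  have hcont : Tendsto (fun s : ℝ => x + s • (b - a)) (𝓝 0) (𝓝 x) := by
    have : Continuous (fun s : ℝ => x + s • (b - a)) := by fun_prop
    have h := this.tendsto 0
    rwa [zero_smul, add_zero] at h
  -- Short segments parallel to the edge stay in both tetrahedra, where both pieces agree with `p`.
  have e : (fun s : ℝ => f' (x + s • (b - a))) =ᶠ[𝓝 0] fun s => f (x + s • (b - a)) := by
    filter_upwards [eventually_add_smul_mem_hull (TetMesh.isTet hT) ha hb hx hxa hxb,
      eventually_add_smul_mem_hull (TetMesh.isTet hT') ha' hb' hx' hxa' hxb',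
      hcont.eventually (isOpen_interior.mem_nhds hxM)] with s h1 h2 h3
    rw [← eq_of_continuousOn_domain hp hT hf.continuous hpf h1 h3,
      ← eq_of_continuousOn_domain hp hT' hf'.continuous hpf' h2 h3]
  have d1 : HasDerivAt (fun s : ℝ => f (x + s • (b - a))) (fderiv ℝ f x (b - a)) 0 :=
    (hf x).hasFDerivAt.hasLineDerivAt (b - a)
  have d2 : HasDerivAt (fun s : ℝ => f' (x + s • (b - a))) (fderiv ℝ f' x (b - a)) 0 :=
    (hf' x).hasFDerivAt.hasLineDerivAt (b - a)
  exact d2.unique (d1.congr_of_eventuallyEq e)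

theorem IsPoly.smul_sum_smul {ι : Type*} {I : Finset ι} {G : ι → E3 → ℝ} {k : ℕ}
    (hG : ∀ j ∈ I, IsPoly k (G j)) (t : ι → E3) (τ : ℝ) (i : Fin 3) :
    IsPoly k (fun x => (τ • ∑ j ∈ I, G j x • t j) i) := by
  have h : IsPoly k (fun x => τ * ∑ j ∈ I, t j i * G j x) :=
    IsPoly.const_mul τ (IsPoly.sum _ fun j hj => IsPoly.const_mul (t j i) (hG j hj))
  convert h using 2
  rw [PiLp.smul_apply, WithLp.ofLp_sum, Finset.sum_apply, smul_eq_mul]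
  congr 1
  exact Finset.sum_congr rfl fun j _ => by simp [mul_comm]

theorem Pieces.mem_PcVec {u : Finset E3 → E3 → E3} {k : ℕ} (hu : Pieces M Ω δ u)
    (h : ∀ T ∈ M.tets, ∀ i, IsPoly k (fun x => u T x i)) : glue M.tets u ∈ M.PcVec k := by
  refine fun i => ⟨fun T hT => ⟨_, h T hT i, fun x hx => ?_⟩, ?_⟩
  · simp only
    rw [glue_eq_of_mem_interior hT hx]
  · exact (PiLp.continuous_apply 2 _ i).comp_continuousOn hu.continuousOn

end Compat

/-! ### The generalized Taylor–Hood and Mini elements -/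

section Elements

variable {M : TetMesh} {Ω : Set E3} {δ : ℝ} {T : Finset E3} {a b x : E3}

open Classical in
/-- Points at which the coordinates of the end points of an interior edge are positive are interior
to the interior mesh. -/
theorem TetMesh.mem_of_isInnerEdge (hΩ : IsLipschitzDomain Ω) (h : M.IsInnerEdge Ω δ a b)
    (hT : T ∈ M.tets) (ha : a ∈ T) (hb : b ∈ T) (hx : x ∈ hull T) (hxa : 0 < bary T a x)
    (hxb : 0 < bary T b x) : x ∈ Ω := by
  have t := isTet hT
  have hG : ({a, b} : Finset E3) ⊆ T := by
    intro c hc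
    rw [Finset.mem_insert, Finset.mem_singleton] at hc
    rcases hc with rfl | rfl <;> assumption
  have hy : AffineMap.lineMap a b (1 / 2 : ℝ) ∈ openSegment ℝ a b := by
    rw [openSegment_eq_image_lineMap]
    exact ⟨1 / 2, by norm_num, rfl⟩
  have hyG : AffineMap.lineMap a b (1 / 2 : ℝ) ∈ hull {a, b} :=
    (convex_convexHull ℝ _).lineMap_mem (subset_convexHull ℝ _ (by simp))
      (subset_convexHull ℝ _ (by simp)) (by norm_num)
  have hypos : ∀ c ∈ ({a, b} : Finset E3), 0 < bary T c (AffineMap.lineMap a b (1 / 2 : ℝ)) := by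
    intro c hc
    have h1 := bary_nonneg t (subset_convexHull ℝ _ ha) c
    have h2 := bary_nonneg t (subset_convexHull ℝ _ hb) c
    rw [affine_lineMap_eq]
    rw [Finset.mem_insert, Finset.mem_singleton] at hc
    rcases hc with rfl | rfl
    · rw [bary_self t ha]
      linarith
    · rw [bary_self t hb]
      linarith
  have hxpos : ∀ c ∈ ({a, b} : Finset E3), 0 < bary T c x := by
    intro c hc
    rw [Finset.mem_insert, Finset.mem_singleton] at hc
    rcases hc with rfl | rfl <;> assumption
  exact meshDomain_inner_subset hΩ (meshDomain_mono (Finset.filter_subset _ _)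
    (mem_meshDomain_star inner_subset_tets hT hG hyG hypos (h hy) hx hxpos))

open Classical in
/-- The end points of the interior edges of an interior tetrahedron. -/
def TetMesh.innerEdges (M : TetMesh) (Ω : Set E3) (δ : ℝ) (T : Finset E3) : Finset (E3 × E3) :=
  (T ×ˢ T).filter fun e => T ∈ M.inner Ω δ ∧ M.IsInnerEdge Ω δ e.1 e.2

theorem TetMesh.mem_innerEdges {e : E3 × E3} : e ∈ M.innerEdges Ω δ T ↔
    e.1 ∈ T ∧ e.2 ∈ T ∧ T ∈ M.inner Ω δ ∧ M.IsInnerEdge Ω δ e.1 e.2 := by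
  classical
  rw [innerEdges, Finset.mem_filter, Finset.mem_product, and_assoc]

theorem TetMesh.innerEdges_eq_empty (hT : T ∉ M.inner Ω δ) : M.innerEdges Ω δ T = ∅ :=
  Finset.eq_empty_of_forall_notMem fun _ he => hT (mem_innerEdges.1 he).2.2.1

open Classical in
-- The edge bubble is nonzero only where the containing tetrahedra share the edge. All tetrahedra at
-- an interior edge are interior, such points lie in `Ω`, and there the tangential derivative of the
-- pressure is single-valued.
theorem pieces_innerEdges (hΩ : IsLipschitzDomain Ω) {k : ℕ} {p : E3 → ℝ} {f : Finset E3 → E3 → ℝ}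
    (hf : ∀ T, IsPoly k (f T)) (hp : ContinuousOn p M.domain)
    (hpf : ∀ T ∈ M.tets, Set.EqOn p (f T) (interior (hull T))) :
    Pieces M Ω δ (fun T x => ∑ e ∈ M.innerEdges Ω δ T,
      (bubble T {e.1, e.2} x * fderiv ℝ (f T) x (e.2 - e.1)) • (e.1 - e.2)) := by
  refine Pieces.of_sum (I := M.innerEdges Ω δ)
    (G := fun T e x => bubble T {e.1, e.2} x * fderiv ℝ (f T) x (e.2 - e.1))
    (t := fun e => e.1 - e.2)
    ?_
    (fun T hT => TetMesh.innerEdges_eq_empty hT) ?_ ?_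
  · exact fun T e _ => ((isPoly_bubble T _).mul ((hf T).fderiv (e.2 - e.1))).contDiff
  · intro T hT T' hT' x hxM hx hx' e he h0
    obtain ⟨h1, h2, -, h4⟩ := TetMesh.mem_innerEdges.1 he
    have hpos := bary_pos_of_bubble_ne_zero (TetMesh.isTet hT) hx (left_ne_zero_of_mul h0)
    have hp1 := hpos e.1 (by simp)
    have hp2 := hpos e.2 (by simp)
    have m1 := TetMesh.mem_of_bary_pos hT hT' hx hx' hp1
    have m2 := TetMesh.mem_of_bary_pos hT hT' hx hx' hp2
    refine ⟨TetMesh.mem_innerEdges.2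
      ⟨m1, m2, TetMesh.mem_inner_of_isInnerEdge h4 hT' m1 m2, h4⟩, ?_⟩
    rw [TetMesh.bubble_eq hT hT' hx hx', fderiv_edge_eq hp hT hT'
      ((hf T).contDiff (n := 1) |>.differentiable one_ne_zero)
      ((hf T').contDiff (n := 1) |>.differentiable one_ne_zero) (hpf T hT) (hpf T' hT')
      hx hx' hxM h1 h2 hp1 hp2]
  · intro T hT x hx e he h0
    obtain ⟨h1, h2, -, h4⟩ := TetMesh.mem_innerEdges.1 he
    have hT' := TetMesh.inner_subset_tets hT
    have hpos := bary_pos_of_bubble_ne_zero (TetMesh.isTet hT') hx (left_ne_zero_of_mul h0)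
    exact TetMesh.mem_of_isInnerEdge hΩ h4 hT' h1 h2 hx (hpos e.1 (by simp)) (hpos e.2 (by simp))

theorem TetMesh.reduced_subset_inner : M.reduced Ω δ ⊆ M.inner Ω δ := by
  classical
  exact Finset.filter_subset _ _

/-- On the tetrahedra of the reduced mesh, the interior edges control all derivatives. -/
theorem exists_reduced_span {σ : ℝ} (hσ : 0 < σ) : ∃ K : ℝ, ∀ (M : TetMesh) (Ω : Set E3) (δ : ℝ),
    M.ShapeRegular σ → ∀ T ∈ M.reduced Ω δ, ∀ φ : E3 →L[ℝ] ℝ,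
      Metric.diam (hull T) * ‖φ‖ ≤ K * ∑ e ∈ M.innerEdges Ω δ T, |φ (e.2 - e.1)| := by
  classical
  obtain ⟨K, hK, hspan⟩ := exists_edge_span_const
  -- The factor 4 counts vertices, 3 counts the independent interior edges.
  refine ⟨2 * σ * (4 * (K * 3)), fun M Ω δ hs T hT φ => ?_⟩
  have hTi := TetMesh.reduced_subset_inner hT
  have hTt := TetMesh.inner_subset_tets hTi
  have t := TetMesh.isTet hTt
  obtain ⟨x₀, hball⟩ := hs T hTt
  obtain ⟨-, a, b, hab, hli⟩ := Finset.mem_filter.1 hT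
  obtain ⟨p, hp⟩ := t.nonempty
  set Z := ∑ e ∈ M.innerEdges Ω δ T, |φ (e.2 - e.1)| with hZ
  have h1 : ∑ i, |φ (b i - a i)| ≤ 3 * Z := by
    have : ∑ i, |φ (b i - a i)| ≤ ∑ _i : Fin 3, Z := by
      refine Finset.sum_le_sum fun i _ => ?_
      exact Finset.single_le_sum (f := fun e : E3 × E3 => |φ (e.2 - e.1)|)
        (fun _ _ => abs_nonneg _)
        (TetMesh.mem_innerEdges.2 (show (a i, b i).1 ∈ T ∧ _ from
          ⟨(hab i).1, (hab i).2.1, hTi, (hab i).2.2⟩))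
    simpa using this
  have h2 : ∑ c ∈ T, |φ (c - p)| ≤ 4 * (K * 3) * Z := by
    have : ∑ c ∈ T, |φ (c - p)| ≤ ∑ _c ∈ T, K * (3 * Z) := by
      refine Finset.sum_le_sum fun c hc => ?_
      refine (hspan T t a b (fun i => ⟨(hab i).1, (hab i).2.1⟩) hli φ c hc p hp).trans ?_
      gcongr
    rw [Finset.sum_const, t.card_eq, nsmul_eq_mul] at this
    refine this.trans (le_of_eq ?_)
    push_cast
    ring
  calc Metric.diam (hull T) * ‖φ‖ ≤ 2 * σ * ∑ c ∈ T, |φ (c - p)| :=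
        diam_mul_norm_le_sum t hσ hball φ p
    _ ≤ 2 * σ * (4 * (K * 3) * Z) := by gcongr
    _ = _ := by ring

open Classical in
-- The degrees match: two from the edge bubble and `m - 2` from the derivative of the pressure. Only
-- derivatives of the pressure enter, so the same field serves every normalisation of the mean
-- value.
theorem exists_taylorHood_stable {σ κ : ℝ} (hσ : 0 < σ) (hκ : 0 < κ) (m : ℕ) (hm : 2 ≤ m) :
    ∃ C : ℝ≥0, ∀ (M : TetMesh) (Ω : Set E3) (δ : ℝ), Setting σ κ M Ω δ →
      ∀ N, M.StablePair Ω δ N (M.reduced Ω δ) (M.PcVec m) (M.Pc (m - 1)) C := by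
  obtain ⟨K, hK⟩ := exists_reduced_span hσ
  obtain ⟨C, hC⟩ := exists_edge_stable (m - 1) hσ hκ K
  refine ⟨C, fun M Ω δ hs N q hq => ?_⟩
  obtain ⟨p, ⟨hpP, hpc⟩, hqp, -⟩ := hq
  obtain ⟨f, hf, hpf⟩ := TetMesh.exists_polynomial_pieces hpP
  have hu := pieces_innerEdges (Ω := Ω) (δ := δ) hs.lipschitz hf hpc hpf
  obtain ⟨τ, h⟩ := hC M Ω δ hs (M.innerEdges Ω δ) (fun _ e => {e.1, e.2}) (M.reduced Ω δ)
    (fun T _ e he => by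
      obtain ⟨h1, h2, -⟩ := TetMesh.mem_innerEdges.1 he
      refine ⟨by simp, by simp, fun c hc => ?_⟩
      rw [Finset.mem_insert, Finset.mem_singleton] at hc
      rcases hc with rfl | rfl <;> assumption)
    (fun T _ hT => TetMesh.innerEdges_eq_empty hT) TetMesh.reduced_subset_inner
    (hK M Ω δ hs.shapeRegular) q p f (fun T _ => hf T) hpc hpf hqp hu
  refine ⟨_, ⟨_, (hu.const_smul τ).mem_PcVec fun T _ i => ?_, fun _ _ => rfl⟩, h⟩
  refine IsPoly.smul_sum_smul (fun e _ => ?_) _ τ i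
  refine ((isPoly_bubble T {e.1, e.2}).mul ((hf T).fderiv (e.2 - e.1))).mono ?_
  -- Degenerate pairs with equal end points are allowed: they only lower the degree, and their
  -- direction is zero.
  have := Finset.card_le_two (a := e.1) (b := e.2)
  omega

open Classical in
/-- All pairs of vertices of an interior tetrahedron. -/
def TetMesh.innerPairs (M : TetMesh) (Ω : Set E3) (δ : ℝ) (T : Finset E3) : Finset (E3 × E3) :=
  if T ∈ M.inner Ω δ then T ×ˢ T else ∅

theorem TetMesh.innerPairs_of_notMem (hT : T ∉ M.inner Ω δ) : M.innerPairs Ω δ T = ∅ := if_neg hT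

theorem TetMesh.innerPairs_of_mem (hT : T ∈ M.inner Ω δ) : M.innerPairs Ω δ T = T ×ˢ T := if_pos hT

/-- The full bubble vanishes outside the open tetrahedron, so neighbouring pieces never interact. -/
theorem pieces_innerPairs {k : ℕ} {f : Finset E3 → E3 → ℝ} (hf : ∀ T, IsPoly k (f T)) :
    Pieces M Ω δ (fun T x => ∑ e ∈ M.innerPairs Ω δ T,
      (bubble T T x * fderiv ℝ (f T) x (e.2 - e.1)) • (e.1 - e.2)) := by
  have hint : ∀ T ∈ M.tets, ∀ x ∈ hull T, ∀ e : E3 × E3,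
      bubble T T x * fderiv ℝ (f T) x (e.2 - e.1) ≠ 0 → x ∈ interior (hull T) :=
    fun T hT x hx e h0 => (mem_interior_hull_iff (TetMesh.isTet hT)).2
      (bary_pos_of_bubble_ne_zero (TetMesh.isTet hT) hx (left_ne_zero_of_mul h0))
  refine Pieces.of_sum (I := M.innerPairs Ω δ)
    (G := fun T e x => bubble T T x * fderiv ℝ (f T) x (e.2 - e.1)) (t := fun e => e.1 - e.2)
    ?_
    (fun T hT => TetMesh.innerPairs_of_notMem hT) ?_ ?_
  · exact fun T e _ => ((isPoly_bubble T _).mul ((hf T).fderiv (e.2 - e.1))).contDiff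
  · intro T hT T' hT' x _ hx hx' e he h0
    obtain rfl := TetMesh.eq_of_mem_interior hT hT' (hint T hT x hx e h0) hx'
    exact ⟨he, rfl⟩
  · intro T hT x hx e _ h0
    exact TetMesh.interior_hull_subset hT (hint T (TetMesh.inner_subset_tets hT) x hx e h0)

/-- For pressures of degree one the edge derivatives are constant on each tetrahedron, so the sum
over all pairs is a constant vector times the quartic bubble. The edges at a single vertex already
control the gradient, so no reduced mesh is needed. -/
theorem exists_mini_stable {σ κ : ℝ} (hσ : 0 < σ) (hκ : 0 < κ) :
    ∃ C : ℝ≥0, ∀ (M : TetMesh) (Ω : Set E3) (δ : ℝ), Setting σ κ M Ω δ →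
      M.StablePair Ω δ (M.inner Ω δ) (M.inner Ω δ) M.miniVelocity (M.Pc 1) C := by
  obtain ⟨C, hC⟩ := exists_edge_stable 1 hσ hκ (2 * σ)
  refine ⟨C, fun M Ω δ hs q hq => ?_⟩
  obtain ⟨p, ⟨hpP, hpc⟩, hqp, -⟩ := hq
  obtain ⟨f, hf, hpf⟩ := TetMesh.exists_polynomial_pieces hpP
  have hu := pieces_innerPairs (M := M) (Ω := Ω) (δ := δ) hf
  obtain ⟨τ, h⟩ := hC M Ω δ hs (M.innerPairs Ω δ) (fun T _ => T) (M.inner Ω δ)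
    (fun T _ e he => by
      by_cases hT : T ∈ M.inner Ω δ
      · rw [TetMesh.innerPairs_of_mem hT, Finset.mem_product] at he
        exact ⟨he.1, he.2, subset_rfl⟩
      · simp [TetMesh.innerPairs_of_notMem hT] at he)
    (fun T _ hT => TetMesh.innerPairs_of_notMem hT) subset_rfl
    (fun T hT φ => by
      have t := TetMesh.isTet (TetMesh.inner_subset_tets hT)
      obtain ⟨x₀, hball⟩ := hs.shapeRegular T (TetMesh.inner_subset_tets hT)
      obtain ⟨p, hp⟩ := t.nonempty
      refine (diam_mul_norm_le_sum t hσ hball φ p).trans ?_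
      gcongr
      rw [TetMesh.innerPairs_of_mem hT, Finset.sum_product]
      exact Finset.single_le_sum (f := fun a => ∑ c ∈ T, |φ (c - a)|)
        (fun _ _ => Finset.sum_nonneg fun _ _ => abs_nonneg _) hp)
    q p f (fun T _ => hf T) hpc hpf hqp hu
  refine ⟨_, ⟨_, ⟨(hu.const_smul τ).continuousOn, fun T hT => ?_⟩, fun _ _ => rfl⟩, h⟩
  have t := TetMesh.isTet hT
  choose g hg using fun e : E3 × E3 => ((hf T).fderiv (e.2 - e.1)).exists_eq_const
  refine ⟨bary T, fun _ => 0, τ • ∑ e ∈ M.innerPairs Ω δ T, g e • (e.1 - e.2),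
    fun a ha => ⟨bary_self t ha, fun b hb hab => bary_of_ne t hb hab⟩,
    fun i => by simpa using isPoly_const 1 0, fun x hx => ?_⟩
  rw [glue_eq_of_mem_interior hT hx, zero_add]
  simp only [hg, mul_smul]
  rw [← Finset.smul_sum, smul_comm]
  rfl

end Elements

/-! ### Discontinuous pressures -/

section Faces

variable {M : TetMesh} {Ω : Set E3} {δ : ℝ} {T T₁ T₂ : Finset E3} {x : E3}

open Classical in
/-- The face bubble increases on average in the direction of an edge that ends on the face. -/
theorem exists_face_direction {σ κ : ℝ} (hσ : 0 < σ) (hκ : 0 < κ) : ∃ c : ℝ, 0 < c ∧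
    ∀ M : TetMesh, M.ShapeRegular σ → M.QuasiUniform κ → ∀ T₁ ∈ M.tets, ∀ T₂ ∈ M.tets,
    (T₁ ∩ T₂).card = 3 → ∃ t : E3, ‖t‖ ≤ M.h ∧
      c * M.h ^ 3 ≤ ∫ x in hull T₁, fderiv ℝ (bubble T₁ (T₁ ∩ T₂)) x t := by
  set V := volume.real (Metric.ball (0 : E3) 1) with hV
  have hV0 : 0 < V := by
    rw [hV, measureReal_def]
    exact ENNReal.toReal_pos (Metric.measure_ball_pos _ _ one_pos).ne' measure_ball_lt_top.ne
  -- Volume of the inner ball relative to `h ^ 3`, times the lower bound of a bubble on it.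
  refine ⟨V / ((2 * σ * κ) ^ 3 * (2 * σ + 1) ^ 4), by positivity,
    fun M hs hqu T₁ h₁ T₂ h₂ h3 => ?_⟩
  have t₁ := TetMesh.isTet h₁
  obtain ⟨x₀, hball⟩ := hs T₁ h₁
  obtain ⟨d, hd, hdn, -⟩ := exists_opposite t₁ h3
  obtain ⟨a, ha⟩ := Finset.card_pos.1 (by omega : 0 < (T₁ ∩ T₂).card)
  have haT := (Finset.mem_inter.1 ha).1
  have hD := diam_hull_pos t₁
  refine ⟨a - d, (norm_sub_le_diam (subset_convexHull ℝ _ haT)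
    (subset_convexHull ℝ _ hd)).trans (TetMesh.diam_le_h h₁), ?_⟩
  -- Of the coordinates of the face only that of `a` changes along `a - d`, at rate one. What
  -- remains is the nonnegative product of the other two.
  have hder : ∀ x, fderiv ℝ (bubble T₁ (T₁ ∩ T₂)) x (a - d) =
      bubble T₁ ((T₁ ∩ T₂).erase a) x * 1 := by
    intro x
    rw [(hasFDerivAt_bubble T₁ (T₁ ∩ T₂) x).fderiv, sum_apply,
      Finset.sum_eq_single_of_mem a ha]
    · rw [smul_apply, LinearMap.coe_toContinuousLinearMap', linear_sub, bary_self t₁ haT,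
        bary_of_ne t₁ hd (by rintro rfl; exact hdn (Finset.mem_inter.1 ha).2), sub_zero, smul_eq_mul]
    · intro c hc hca
      rw [smul_apply, LinearMap.coe_toContinuousLinearMap', linear_sub,
        bary_of_ne t₁ haT hca.symm,
        bary_of_ne t₁ hd (by rintro rfl; exact hdn (Finset.mem_inter.1 hc).2), sub_zero, smul_zero]
  simp only [hder]
  have hJ : (T₁ ∩ T₂).erase a ⊆ T₁ := (Finset.erase_subset _ _).trans Finset.inter_subset_left
  have h := integral_core_le t₁ hσ hball hJ (g := fun _ => 1) continuous_const
    (fun _ => zero_le_one)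
  have hr : 0 ≤ 1 / (2 * σ) * Metric.diam (hull T₁) := by positivity
  have hvol : volume.real (Metric.ball x₀ (1 / (2 * σ) * Metric.diam (hull T₁))) =
      (1 / (2 * σ) * Metric.diam (hull T₁)) ^ 3 * V := by
    rw [measureReal_def, Measure.addHaar_ball _ _ hr, ENNReal.toReal_mul,
      ENNReal.toReal_ofReal (by positivity)]
    simp [hV, measureReal_def]
  rw [setIntegral_const, hvol, smul_eq_mul, mul_one] at h
  have hh : M.h ^ 3 ≤ (κ * Metric.diam (hull T₁)) ^ 3 :=
    pow_le_pow_left₀ M.h_nonneg (hqu T₁ h₁) 3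
  rw [div_mul_eq_mul_div, div_le_iff₀ (by positivity)]
  calc V * M.h ^ 3 ≤ V * (κ * Metric.diam (hull T₁)) ^ 3 := by gcongr
    _ = (2 * σ * κ) ^ 3 * ((1 / (2 * σ) * Metric.diam (hull T₁)) ^ 3 * V) := by field_simp
    _ ≤ (2 * σ * κ) ^ 3 * ((2 * σ + 1) ^ 4 *
        ∫ x in hull T₁, bubble T₁ ((T₁ ∩ T₂).erase a) x * 1) := by gcongr
    _ = _ := by ring

open Classical in
/-- The pairs of interior tetrahedra sharing a face to which `T` belongs. -/
def TetMesh.innerFacePairs (M : TetMesh) (Ω : Set E3) (δ : ℝ) (T : Finset E3) :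
    Finset (Finset E3 × Finset E3) :=
  (facePairs (M.inner Ω δ)).filter fun P => T = P.1 ∨ T = P.2

theorem TetMesh.mem_innerFacePairs {P : Finset E3 × Finset E3} : P ∈ M.innerFacePairs Ω δ T ↔
    P ∈ facePairs (M.inner Ω δ) ∧ (T = P.1 ∨ T = P.2) := by
  classical
  rw [innerFacePairs, Finset.mem_filter]

theorem TetMesh.innerFacePairs_eq_empty (hT : T ∉ M.inner Ω δ) : M.innerFacePairs Ω δ T = ∅ := by
  refine Finset.eq_empty_of_forall_notMem fun P hP => hT ?_
  obtain ⟨h, h' | h'⟩ := mem_innerFacePairs.1 hP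
  · exact h' ▸ (mem_facePairs.1 h).1
  · exact h' ▸ (mem_facePairs.1 h).2.1

open Classical in
-- An ordered pair is determined by its common face, a subset of the four vertices of `T`, and by
-- the position of `T` in the pair: `2 ^ 4 * 2 = 32`.
theorem TetMesh.card_innerFacePairs_le (hT : T ∈ M.tets) : (M.innerFacePairs Ω δ T).card ≤ 32 := by
  have hmem : ∀ P ∈ facePairs (M.inner Ω δ), P.1 ∈ M.tets ∧ P.2 ∈ M.tets ∧ P.1 ≠ P.2 ∧
      (P.1 ∩ P.2).card = 3 := fun P hP => by
    obtain ⟨h1, h2, h3⟩ := mem_facePairs.1 hP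
    exact ⟨inner_subset_tets h1, inner_subset_tets h2, h3⟩
  have hc : (T.powerset ×ˢ (Finset.univ : Finset Bool)).card = 32 := by
    rw [Finset.card_product, Finset.card_powerset, (isTet hT).card_eq]
    rfl
  rw [← hc]
  refine Finset.card_le_card_of_injOn (fun P => (P.1 ∩ P.2, decide (T = P.1))) ?_ ?_
  · intro P hP
    obtain ⟨-, h⟩ := mem_innerFacePairs.1 hP
    refine Finset.mem_coe.2 (Finset.mem_product.2 ⟨Finset.mem_powerset.2 ?_, Finset.mem_univ _⟩)
    rcases h with rfl | rfl
    · exact Finset.inter_subset_left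
    · exact Finset.inter_subset_right
  · rintro ⟨A, B⟩ hP ⟨A', B'⟩ hP' h
    obtain ⟨hf, h1⟩ := mem_innerFacePairs.1 hP
    obtain ⟨hf', h2⟩ := mem_innerFacePairs.1 hP'
    obtain ⟨hA, hB, -, h3⟩ := hmem _ hf
    obtain ⟨hA', hB', hne', -⟩ := hmem _ hf'
    simp only [Prod.mk.injEq, decide_eq_decide] at h h1 h2 hA hB h3 hA' hB' hne'
    obtain ⟨hF, hi⟩ := h
    by_cases hTA : T = A
    · obtain rfl := hTA
      obtain rfl := hi.1 rfl
      rcases eq_or_eq_of_inter_subset hA hB h3 hB' (hF ▸ Finset.inter_subset_right) with h | h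
      · exact absurd h.symm hne'
      · rw [h]
    · have e1 := h1.resolve_left hTA
      have e2 := h2.resolve_left fun h => hTA (hi.2 h)
      subst e1
      subst e2
      rcases eq_or_eq_of_inter_subset hA hB h3 hA' (hF ▸ Finset.inter_subset_left) with h | h
      · rw [h]
      · exact absurd h hne'

/-- Each ordered pair is met exactly twice, once from each of its two tetrahedra. -/
theorem TetMesh.sum_innerFacePairs (φ : Finset E3 → Finset E3 × Finset E3 → ℝ) :
    ∑ T ∈ M.inner Ω δ, ∑ P ∈ M.innerFacePairs Ω δ T, φ T P =
      ∑ P ∈ facePairs (M.inner Ω δ), (φ P.1 P + φ P.2 P) := by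
  classical
  rw [Finset.sum_comm' (t' := facePairs (M.inner Ω δ)) (s' := fun P => {P.1, P.2})]
  · refine Finset.sum_congr rfl fun P hP => ?_
    rw [Finset.sum_pair (mem_facePairs.1 hP).2.2.1]
  · intro T P
    rw [mem_innerFacePairs, Finset.mem_insert, Finset.mem_singleton]
    constructor
    · exact fun h => ⟨h.2.2, h.2.1⟩
    · rintro ⟨h | h, hP⟩
      · exact ⟨h ▸ (mem_facePairs.1 hP).1, hP, Or.inl h⟩
      · exact ⟨h ▸ (mem_facePairs.1 hP).2.1, hP, Or.inr h⟩

open Classical in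
-- Where a face bubble is nonzero, every containing tetrahedron has that face and is one of the two
-- of the pair. Such points are interior to the union of the two and hence lie in `Ω`.
theorem pieces_innerFacePairs (hΩ : IsLipschitzDomain Ω) (r : Finset E3 × Finset E3 → ℝ)
    (t : Finset E3 × Finset E3 → E3) :
    Pieces M Ω δ (fun T x => ∑ P ∈ M.innerFacePairs Ω δ T,
      (r P * bubble T (P.1 ∩ P.2) x) • t P) := by
  refine Pieces.of_sum (I := M.innerFacePairs Ω δ)
    (G := fun T P x => r P * bubble T (P.1 ∩ P.2) x) (t := t) ?_
    (fun T hT => TetMesh.innerFacePairs_eq_empty hT) ?_ ?_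
  · exact fun T P _ => (IsPoly.const_mul (r P) (isPoly_bubble T _)).contDiff
  · intro T hT T' hT' x _ hx hx' P hP h0
    obtain ⟨hf, h⟩ := TetMesh.mem_innerFacePairs.1 hP
    obtain ⟨h1, h2, -, h3⟩ := mem_facePairs.1 hf
    have hpos := bary_pos_of_bubble_ne_zero (TetMesh.isTet hT) hx (right_ne_zero_of_mul h0)
    have hF : P.1 ∩ P.2 ⊆ T' := fun a ha => TetMesh.mem_of_bary_pos hT hT' hx hx' (hpos a ha)
    refine ⟨TetMesh.mem_innerFacePairs.2 ⟨hf, TetMesh.eq_or_eq_of_inter_subset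
      (TetMesh.inner_subset_tets h1) (TetMesh.inner_subset_tets h2) h3 hT' hF⟩, ?_⟩
    rw [TetMesh.bubble_eq hT hT' hx hx']
  · intro T hT x hx P hP h0
    obtain ⟨hf, h⟩ := TetMesh.mem_innerFacePairs.1 hP
    obtain ⟨h1, h2, -, h3⟩ := mem_facePairs.1 hf
    have hpos := bary_pos_of_bubble_ne_zero (TetMesh.isTet (TetMesh.inner_subset_tets hT)) hx
      (right_ne_zero_of_mul h0)
    have h1' := TetMesh.inner_subset_tets h1
    have h2' := TetMesh.inner_subset_tets h2
    refine TetMesh.meshDomain_inner_subset (M := M) (δ := δ) hΩ (meshDomain_mono (S := {P.1, P.2}) ?_ ?_)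
    · intro T hT
      rw [Finset.mem_insert, Finset.mem_singleton] at hT
      rcases hT with rfl | rfl <;> assumption
    · rcases h with rfl | rfl
      · exact TetMesh.mem_meshDomain_pair h1' h2' h3 hx hpos
      · rw [Finset.pair_comm]
        rw [Finset.inter_comm] at h3 hpos
        exact TetMesh.mem_meshDomain_pair h2' h1' h3 hx hpos

open Classical in
theorem l2Sq_jump_le {A : ℝ≥0} (hA : ∀ T, IsTet T → ∀ F ⊆ T, F.card = 3 →
      (μHE[2] : Measure E3) (hull F) ≤ A * ENNReal.ofReal (Metric.diam (hull T) ^ 2))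
    (h₁ : T₁ ∈ M.tets) (h₂ : T₂ ∈ M.tets) (h3 : (T₁ ∩ T₂).card = 3) {q : E3 → ℝ} {r₁ r₂ : ℝ}
    (hq₁ : Set.EqOn q (fun _ => r₁) (interior (hull T₁)))
    (hq₂ : Set.EqOn q (fun _ => r₂) (interior (hull T₂))) :
    l2Sq (surf (hull T₁ ∩ hull T₂)) (jump q T₁ T₂) ≤
      ENNReal.ofReal (A * M.h ^ 2 * (r₁ - r₂) ^ 2) := by
  have t₁ := TetMesh.isTet h₁
  have hm : MeasurableSet (hull T₁ ∩ hull T₂) :=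
    (isCompact_hull T₁).measurableSet.inter (isCompact_hull T₂).measurableSet
  have e : ∀ x ∈ hull T₁ ∩ hull T₂,
      ‖jump q T₁ T₂ x‖ₑ ^ 2 = ENNReal.ofReal ((r₁ - r₂) ^ 2) := by
    intro x hx
    rw [jump_eq t₁ (TetMesh.isTet h₂) continuous_const continuous_const hq₁ hq₂ hx.1 hx.2,
      ← ofReal_norm, ← ENNReal.ofReal_pow (norm_nonneg _), Real.norm_eq_abs, sq_abs]
  rw [l2Sq, surf, setLIntegral_congr_fun hm e, setLIntegral_const, mul_comm (A * M.h ^ 2 : ℝ),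
    ENNReal.ofReal_mul (sq_nonneg _), ENNReal.ofReal_mul A.coe_nonneg, ENNReal.ofReal_coe_nnreal]
  gcongr
  refine (measure_mono fun x hx => TetMesh.mem_hull_inter h₁ h₂ hx.1 hx.2).trans ?_
  refine (hA T₁ t₁ _ Finset.inter_subset_left h3).trans ?_
  gcongr
  exact TetMesh.diam_le_h h₁

open Classical in
-- The field is the sum over the interior faces of the jump times the cubic face bubble in the
-- direction from `exists_face_direction`; degree three is that of the bubble. For piecewise
-- constants the gradient part of the seminorm is zero, so control of the jumps suffices.
theorem exists_faceBubble_stable {σ κ : ℝ} (hσ : 0 < σ) (hκ : 0 < κ) :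
    ∃ C : ℝ≥0, ∀ (M : TetMesh) (Ω : Set E3) (δ : ℝ), Setting σ κ M Ω δ →
      M.StablePair Ω δ (M.inner Ω δ) (M.inner Ω δ) (M.PcVec 3) (M.P 0) C := by
  obtain ⟨c, hc, hdir⟩ := exists_face_direction hσ hκ
  obtain ⟨A, -, hA⟩ := exists_area_frontier_le
  -- The three summands serve the size of the field, its gradient and the area of the faces. The
  -- first two carry a factor 2 because each pair splits its contribution between two tetrahedra.
  set B : ℝ := 2 + 2 * (8 * σ * κ) ^ 2 + A with hB
  have hB0 : 0 ≤ B := by positivity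
  obtain ⟨C, hC⟩ := exists_stable_sum (Finset E3 × Finset E3) (B / c) 32 (by positivity)
    (by norm_num)
  refine ⟨C, fun M Ω δ hs q hq => ?_⟩
  obtain ⟨p, hpP, hqp, -⟩ := hq
  obtain ⟨f, hf, hpf⟩ := TetMesh.exists_polynomial_pieces hpP
  choose r hr using fun T => (hf T).exists_eq_const
  have hsub : M.inner Ω δ ⊆ M.tets := TetMesh.inner_subset_tets
  have hq : ∀ T ∈ M.inner Ω δ, Set.EqOn q (fun _ => r T) (interior (hull T)) := fun T hT x hx =>
    (hqp (interior_hull_subset_meshDomain (TetMesh.inner_subset_active hT) hx)).trans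
      ((hpf T (hsub hT) hx).trans (hr T x))
  have hh := M.h_nonneg
  have hdir' : ∀ P : Finset E3 × Finset E3, ∃ t : E3, P ∈ facePairs (M.inner Ω δ) →
      ‖t‖ ≤ M.h ∧ c * M.h ^ 3 ≤ ∫ x in hull P.1, fderiv ℝ (bubble P.1 (P.1 ∩ P.2)) x t := by
    intro P
    by_cases hP : P ∈ facePairs (M.inner Ω δ)
    · obtain ⟨h1, h2, -, h3⟩ := mem_facePairs.1 hP
      obtain ⟨t, ht⟩ := hdir M hs.shapeRegular hs.quasiUniform P.1 (hsub h1) P.2 (hsub h2) h3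
      exact ⟨t, fun _ => ht⟩
    · exact ⟨0, fun h => absurd h hP⟩
  choose t ht using hdir'
  set s : Finset E3 × Finset E3 → ℝ := fun P => r P.1 - r P.2 with hsdef
  have hu := pieces_innerFacePairs (M := M) (δ := δ) hs.lipschitz s t
  have hfd : ∀ T, ∀ P, ∀ x, fderiv ℝ (fun x => s P * bubble T (P.1 ∩ P.2) x) x =
      s P • fderiv ℝ (bubble T (P.1 ∩ P.2)) x := fun T P x =>
    fderiv_const_mul ((isPoly_bubble T _).contDiff (n := 1) |>.differentiable one_ne_zero x) _
  have hnorm : ∀ T ∈ M.tets, ∀ P ∈ M.innerFacePairs Ω δ T, P.1 ∩ P.2 ⊆ T ∧ ‖t P‖ ≤ M.h := by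
    intro T hT P hP
    obtain ⟨h, h'⟩ := TetMesh.mem_innerFacePairs.1 hP
    refine ⟨?_, (ht P h).1⟩
    rcases h' with rfl | rfl
    · exact Finset.inter_subset_left
    · exact Finset.inter_subset_right
  have hBc : ∀ z : ℝ, B / c * (c / 2 * z) = B / 2 * z := fun z => by field_simp
  -- The weight `c / 2 * (h ^ 3 * s P ^ 2)` is half of what the pair contributes to the form at
  -- least, since it is summed over both tetrahedra of the pair.
  obtain ⟨τ, h⟩ := hC M Ω δ hs.lipschitz.1 hs.subset_domain (M.innerFacePairs Ω δ)
    (fun T P x => s P * bubble T (P.1 ∩ P.2) x) t (fun _ P => c / 2 * (M.h ^ 3 * s P ^ 2)) hu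
    (fun T _ P _ => (IsPoly.const_mul _ (isPoly_bubble T _)).contDiff)
    (fun T hT => by exact_mod_cast TetMesh.card_innerFacePairs_le hT)
    (fun T _ hT => TetMesh.innerFacePairs_eq_empty hT)
    (fun T _ P _ => by positivity)
    (fun T hT P hP x hx => by
      obtain ⟨hF, htP⟩ := hnorm T hT P hP
      have hb0 := bubble_nonneg (J := P.1 ∩ P.2) (TetMesh.isTet hT) hx
      have hb1 := bubble_le_one (J := P.1 ∩ P.2) (TetMesh.isTet hT) hx
      have hG : ‖s P * bubble T (P.1 ∩ P.2) x‖ ≤ |s P| := by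
        rw [Real.norm_eq_abs, abs_mul, abs_of_nonneg hb0]
        exact mul_le_of_le_one_right (abs_nonneg _) hb1
      calc M.h ^ 3 * (‖s P * bubble T (P.1 ∩ P.2) x‖ * ‖t P‖) ^ 2
          ≤ M.h ^ 3 * (|s P| * M.h) ^ 2 := by gcongr
        _ = M.h ^ 2 * (1 * (M.h ^ 3 * s P ^ 2)) := by
          rw [mul_pow, sq_abs]
          ring
        _ ≤ M.h ^ 2 * (B / 2 * (M.h ^ 3 * s P ^ 2)) := by
          gcongr
          have : 0 ≤ 2 * (8 * σ * κ) ^ 2 + (A : ℝ) := by positivity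
          linarith
        _ = _ := by
          rw [← hBc]
          ring)
    (fun T hT P hP x hx => by
      obtain ⟨hF, htP⟩ := hnorm T hT P hP
      obtain ⟨x₀, hball⟩ := hs.shapeRegular T hT
      have h1 := diam_mul_norm_fderiv_bubble_le (TetMesh.isTet hT) hσ hball hF hx
      rw [hfd, norm_smul, hBc, Real.norm_eq_abs]
      set L := ‖fderiv ℝ (bubble T (P.1 ∩ P.2)) x‖ with hL
      have hL0 : 0 ≤ L := norm_nonneg _
      have h2 : L * M.h ≤ 8 * σ * κ := by
        calc L * M.h ≤ L * (κ * Metric.diam (hull T)) := by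
              gcongr
              exact hs.quasiUniform T hT
          _ = κ * (Metric.diam (hull T) * L) := by ring
          _ ≤ κ * (8 * σ) := by gcongr
          _ = _ := by ring
      calc M.h ^ 3 * (|s P| * L * ‖t P‖) ^ 2 ≤ M.h ^ 3 * (|s P| * (8 * σ * κ)) ^ 2 := by
            have h3 : L * ‖t P‖ ≤ 8 * σ * κ := (mul_le_mul_of_nonneg_left htP hL0).trans h2
            rw [mul_assoc]
            exact mul_le_mul_of_nonneg_left (pow_le_pow_left₀ (by positivity)
              (mul_le_mul_of_nonneg_left h3 (abs_nonneg _)) 2) (by positivity)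
        _ = (8 * σ * κ) ^ 2 * (M.h ^ 3 * s P ^ 2) := by
          rw [mul_pow, sq_abs]
          ring
        _ ≤ B / 2 * (M.h ^ 3 * s P ^ 2) := by
          gcongr
          have : 0 ≤ (A : ℝ) := A.coe_nonneg
          linarith)
    q (fun T _ => r T) (fun T _ => continuous_const) hq
    (by
      rw [TetMesh.sum_innerFacePairs, TetMesh.sum_innerFacePairs]
      refine Finset.sum_le_sum fun P hP => ?_
      obtain ⟨h1, h2, hne, h3⟩ := mem_facePairs.1 hP
      -- The mean derivative over `P.2` is minus that over `P.1`, so together with the two pressure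
      -- values the pair contributes the squared jump times the latter.
      have h0 := TetMesh.integral_fderiv_face_bubble (hsub h1) (hsub h2) hne h3 (t P)
      simp only [hfd, smul_apply, smul_eq_mul]
      rw [integral_mul_const, integral_mul_const, integral_const_mul, integral_const_mul,
        eq_neg_of_add_eq_zero_right h0]
      have h4 := mul_le_mul_of_nonneg_left (ht P hP).2 (sq_nonneg (s P))
      simp only [hsdef] at h4 ⊢
      linarith)
    (M.inner Ω δ)
    (by
      rw [TetMesh.sum_innerFacePairs]
      have hgrad : ∀ T ∈ M.inner Ω δ, l2Sq (volume.restrict (hull T)) (gradient q) = 0 := by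
        intro T hT
        have := l2Sq_gradient_le (TetMesh.isTet (hsub hT)) (hq T hT) le_rfl (fun x _ => by simp)
        simpa using this
      have hjump : ∀ P ∈ facePairs (M.inner Ω δ),
          l2Sq (surf (hull P.1 ∩ hull P.2)) (jump q P.1 P.2) ≤
            ENNReal.ofReal (A * M.h ^ 2 * s P ^ 2) := fun P hP => by
        obtain ⟨h1, h2, -, h3⟩ := mem_facePairs.1 hP
        exact l2Sq_jump_le hA (hsub h1) (hsub h2) h3 (hq _ h1) (hq _ h2)
      rw [pressureNorm_sq, Finset.sum_congr rfl hgrad, Finset.sum_const_zero, mul_zero, zero_add]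
      have e2 : (1 / 2 : ℝ≥0∞) ≤ 1 := by simp
      calc ENNReal.ofReal M.h * (1 / 2 * ∑ P ∈ facePairs (M.inner Ω δ),
            l2Sq (surf (hull P.1 ∩ hull P.2)) (jump q P.1 P.2))
          ≤ ENNReal.ofReal M.h * (1 * ∑ P ∈ facePairs (M.inner Ω δ),
            ENNReal.ofReal (A * M.h ^ 2 * s P ^ 2)) := by
            gcongr with P hP
            exact hjump P hP
        _ = ENNReal.ofReal (M.h * ∑ P ∈ facePairs (M.inner Ω δ), A * M.h ^ 2 * s P ^ 2) := by
            rw [one_mul, ENNReal.ofReal_mul hh, ENNReal.ofReal_sum_of_nonneg]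
            exact fun P _ => by positivity
        _ ≤ _ := by
            refine ENNReal.ofReal_le_ofReal ?_
            rw [Finset.mul_sum, Finset.mul_sum]
            refine Finset.sum_le_sum fun P _ => ?_
            rw [mul_add, hBc]
            have : (A : ℝ) * (M.h ^ 3 * s P ^ 2) ≤ B * (M.h ^ 3 * s P ^ 2) := by
              gcongr
              have : 0 ≤ 2 + 2 * (8 * σ * κ) ^ 2 := by positivity
              linarith
            calc M.h * (A * M.h ^ 2 * s P ^ 2) = A * (M.h ^ 3 * s P ^ 2) := by ring
              _ ≤ B * (M.h ^ 3 * s P ^ 2) := this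
              _ = _ := by ring)
  refine ⟨_, ⟨_, (hu.const_smul τ).mem_PcVec fun T hT i => ?_, fun _ _ => rfl⟩, h⟩
  refine IsPoly.smul_sum_smul (fun P hP => ?_) _ τ i
  have h3 := (mem_facePairs.1 (TetMesh.mem_innerFacePairs.1 hP).1).2.2.2
  exact IsPoly.const_mul _ ((isPoly_bubble T (P.1 ∩ P.2)).mono h3.le)

end Faces

end CutFEM

end

theorem mainTheorem5 (σ κ : ℝ) (hσ : 0 < σ) (hκ : 0 < κ) :
    (∃ C : ℝ≥0, ∀ (M : CutFEM.TetMesh) (Ω : Set CutFEM.E3) (δ : ℝ), CutFEM.Setting σ κ M Ω δ →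
      M.StablePair Ω δ (M.inner Ω δ) (M.inner Ω δ) M.miniVelocity (M.Pc 1) C) ∧
    (∀ m : ℕ, 2 ≤ m → ∃ C : ℝ≥0, ∀ (M : CutFEM.TetMesh) (Ω : Set CutFEM.E3) (δ : ℝ),
      CutFEM.Setting σ κ M Ω δ →
        M.StablePair Ω δ (M.inner Ω δ) (M.reduced Ω δ) (M.PcVec m) (M.Pc (m - 1)) C ∧
        M.StablePair Ω δ (M.reduced Ω δ) (M.reduced Ω δ) (M.PcVec m) (M.Pc (m - 1)) C) ∧
    (∃ C : ℝ≥0, ∀ (M : CutFEM.TetMesh) (Ω : Set CutFEM.E3) (δ : ℝ), CutFEM.Setting σ κ M Ω δ →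
      M.StablePair Ω δ (M.inner Ω δ) (M.inner Ω δ) (M.PcVec 3) (M.P 0) C) := by
  obtain ⟨C, hC⟩ := CutFEM.exists_mini_stable hσ hκ
  obtain ⟨D, hD⟩ := CutFEM.exists_faceBubble_stable hσ hκ
  refine ⟨⟨C, hC⟩, fun m hm => ?_, ⟨D, hD⟩⟩
  obtain ⟨E, hE⟩ := CutFEM.exists_taylorHood_stable hσ hκ m hm
  exact ⟨E, fun M Ω δ hs => ⟨hE M Ω δ hs _, hE M Ω δ hs _⟩⟩
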